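/- Let $S^3\subset\mathbb R^4$ and $S^2\subset\mathbb R^3$ be the unit spheres, with the round metrics and oriented as boundaries of the unit balls. Identify $\mathbb R^4=\mathbb C^2=\mathbb H$ by $(x_0,x_1,x_2,x_3)\leftrightarrow(z_1,z_2)=(x_0+ix_1,x_2+ix_3)\leftrightarrow z_1+jz_2$, and likewise $\mathbb H^2=\mathbb C^4$ by $(z_1+jz_2,z_3+jz_4)\leftrightarrow(z_1,z_2,z_3,z_4)$ (complex linear for right multiplication by $i$). Identify $\mathbb{CP}^1=S^2$ by $[z:w]\mapsto\frac{(2\,\mathrm{Re}\,z\bar w,\,2\,\mathrm{Im}\,z\bar w,\,|w|^2-|z|^2)}{|z|^2+|w|^2}$. On $\mathbb C^4$ put $(z,z)=|z_1|^2+|z_2|^2-|z_3|^2-|z_4|^2$ and $\Omega(z,w)=z_1w_2-z_2w_1-z_3w_4+z_4w_3$, and let $Q=\{[z]\in\mathbb{CP}^3: (z,z)=0\}$. A unit tangent vector $T=x\mu$ of $S^3$ at $x$ (with $\mu\in\mathrm{Im}\,\mathbb H$) defines the point $e_T=\{(x,1)\lambda:\lambda\in\mathbb H,\ \mu\lambda=\lambda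 i\}$ of $Q$. Let $W=\{\omega\in\Lambda^2\mathbb C^4:\Omega(\omega)=0\}$ and let $\mathcal Q^3\subset PW$ be the quadric of null lines of the bilinear form $\frac12(\Omega\wedge\Omega)(\omega\wedge\eta)$. An oriented circle $k\subset S^3$ is represented by the point $[v\wedge w]\in\mathcal Q^3$ for which $P\,\mathrm{Span}(v,w)\cap Q=\{e_T: T \text{ a positive unit tangent vector of } k\}$. Let $\pi\colon S^3\to S^2=\mathbb{CP}^1$ be a conformal fibration by circles, i.e. a smooth submersion such that $d_x\pi$ is conformal on $(\ker d_x\pi)^\perp$ for every $x\in S^3$ and such that every fibre is a circle (the intersection of $S^3$ with an affine 2-plane, consisting of more than one point). Orient the fibres so that a tangent vector $T$ of a fibre is positive if $T\wedge A\wedge B>0$ whenever $A,B\perp T$ satisfy $\pi_*A\wedge\pi_*B>0$. Then for each $p\in\mathbb{CP}^1$ the oriented circle $\pi^{-1}(p)$ is represented by exactly one point $\gamma(p)\in\mathcal Q^3$, and the curve $\gamma\colon\mathbb{CP}^1\to\mathcal Q^3\subset PW$ is holomorphic of degree $1$, that is, there are $v_0,v_1\in W$ such that $wv_0+zv_1\neq0$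 and $\gamma([z:w])=[wv_0+zv_1]$ for all $(z,w)\in\mathbb C^2\setminus\{0\}$. -/

import Mathlib

open scoped Manifold ContDiff LinearAlgebra.Projectivization Quaternion

noncomputable section

namespace CircleFibration

/-! ### Round spheres and conformal submersions -/

/-- The round sphere `Sⁿ ⊂ ℝⁿ⁺¹`, with Mathlib's smooth structure. -/
abbrev Sph (n : ℕ) : Type := Metric.sphere (0 : EuclideanSpace ℝ (Fin (n + 1))) 1

/-- The differential of the inclusion `Sⁿ ⊂ ℝⁿ⁺¹`: it turns abstract tangent vectors into
vectors of `ℝⁿ⁺¹`. -/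
def incl {n : ℕ} (x : Sph n) : TangentSpace (𝓡 n) x →L[ℝ] EuclideanSpace ℝ (Fin (n + 1)) :=
  mfderiv (𝓡 n) 𝓘(ℝ, EuclideanSpace ℝ (Fin (n + 1)))
    (fun y : Sph n => (y : EuclideanSpace ℝ (Fin (n + 1)))) x

/-- The round Riemannian metric of `Sⁿ`. -/
def metric {n : ℕ} (x : Sph n) (X Y : TangentSpace (𝓡 n) x) : ℝ :=
  inner ℝ (incl x X) (incl x Y)

/-- The differential of `π : S³ → S²` at `x`. -/
def dif (π : Sph 3 → Sph 2) (x : Sph 3) :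
    TangentSpace (𝓡 3) x →L[ℝ] TangentSpace (𝓡 2) (π x) :=
  mfderiv (𝓡 3) (𝓡 2) π x

/-- The horizontal space `(ker d_xπ)^⊥`. -/
def horizontal (π : Sph 3 → Sph 2) (x : Sph 3) : Set (TangentSpace (𝓡 3) x) :=
  {X | ∀ V, dif π x V = 0 → metric x V X = 0}

/-- A smooth submersion whose differential is conformal on the horizontal spaces. -/
structure IsConformalSubmersion (π : Sph 3 → Sph 2) : Prop where
  smooth : ContMDiff (𝓡 3) (𝓡 2) ∞ π
  submersion : ∀ x, Function.Surjective (dif π x)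
  conformal : ∀ x, ∃ c : ℝ, 0 < c ∧ ∀ X ∈ horizontal π x, ∀ Y ∈ horizontal π x,
    metric (π x) (dif π x X) (dif π x Y) = c * metric x X Y

/-- A (nondegenerate) circle in `S³`: the intersection with an affine 2-plane of `ℝ⁴`, if it has
more than one point. -/
def IsCircle (C : Set (Sph 3)) : Prop :=
  C.Nontrivial ∧ ∃ P : AffineSubspace ℝ (EuclideanSpace ℝ (Fin (3 + 1))),
    Module.finrank ℝ P.direction = 2 ∧ C = {x : Sph 3 | (x : EuclideanSpace ℝ (Fin (3 + 1))) ∈ P}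

/-- A conformal fibration of `S³` by circles. -/
def IsConformalCircleFibration (π : Sph 3 → Sph 2) : Prop :=
  IsConformalSubmersion π ∧ ∀ p : Sph 2, IsCircle (π ⁻¹' {p})

/-- `T ∈ ℝ⁴` is the unit tangent vector at `x`, in positive direction, of the fibre of `π` through
`x`: if `A`, `B` are horizontal and `dπ A`, `dπ B` is positively oriented in `S²`, then
`T, A, B` is positively oriented in `S³`. Both spheres are oriented as boundaries of the unit balls
in `ℝ⁴` and `ℝ³` (outward normal first). -/
def IsPositiveUnitTangent (π : Sph 3 → Sph 2) (x : Sph 3)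
    (T : EuclideanSpace ℝ (Fin (3 + 1))) : Prop :=
  ‖T‖ = 1 ∧ (∃ τ : TangentSpace (𝓡 3) x, dif π x τ = 0 ∧ incl x τ = T) ∧
    ∀ A ∈ horizontal π x, ∀ B ∈ horizontal π x,
      0 < Matrix.det (Matrix.of fun i j : Fin 3 =>
          (![(π x : EuclideanSpace ℝ (Fin (2 + 1))),
            incl (π x) (dif π x A), incl (π x) (dif π x B)] i) j) →
      0 < Matrix.det (Matrix.of fun i j : Fin 4 =>
          (![(x : EuclideanSpace ℝ (Fin (3 + 1))), T, incl x A, incl x B] i) j)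

/-! ### The tangent sphere bundle of `S³` inside `ℂP³` -/

/-- `ℝ⁴ = ℂ² = ℍ`, where `(x₀, x₁, x₂, x₃)` is `(z₁, z₂) = (x₀ + x₁ i, x₂ + x₃ i)` and
`z₁ + j z₂ = x₀ + x₁ i + x₂ j - x₃ k`. -/
def toQuat (x : EuclideanSpace ℝ (Fin (3 + 1))) : ℍ[ℝ] := ⟨x 0, x 1, x 2, -x 3⟩

/-- The quaternion `i`. -/
def qI : ℍ[ℝ] := ⟨0, 1, 0, 0⟩

/-- The identification `ℍ² = ℂ⁴`, `(z₁ + j z₂, z₃ + j z₄) = (z₁, z₂, z₃, z₄)`; it is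
complex linear for right multiplication by `i` on `ℍ²`. -/
def toC4 (p q : ℍ[ℝ]) : Fin 4 → ℂ :=
  ![⟨p.re, p.imI⟩, ⟨p.imJ, -p.imK⟩, ⟨q.re, q.imI⟩, ⟨q.imJ, -q.imK⟩]

/-- The Hermitian square `(z, z) = |z₁|² + |z₂|² - |z₃|² - |z₄|²`. -/
def herm (z : Fin 4 → ℂ) : ℝ :=
  Complex.normSq (z 0) + Complex.normSq (z 1) - Complex.normSq (z 2) - Complex.normSq (z 3)

/-- The complex line of `ℂ⁴ = ℍ²` given by the unit tangent vector `T = x μ` of `S³` at `x`,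
namely `{(x, 1) λ | μ λ = λ i}`. -/
def tangentLine (x : Sph 3) (T : EuclideanSpace ℝ (Fin (3 + 1))) : Set (Fin 4 → ℂ) :=
  {ψ | ∃ l : ℍ[ℝ], ((toQuat x)⁻¹ * toQuat T) * l = l * qI ∧ ψ = toC4 (toQuat x * l) l}

/-! ### The quadric of contact lines -/

/-- The complex bilinear form `Ω` on `ℂ⁴`: the form `v̄₁ w₁ - v̄₂ w₂` on `ℍ²` is `( , ) + j Ω`. -/
def Om (z w : Fin 4 → ℂ) : ℂ := z 0 * w 1 - z 1 * w 0 - (z 2 * w 3 - z 3 * w 2)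

/-- `Ω` as an alternating form. -/
def OmForm : (Fin 4 → ℂ) [⋀^Fin 2]→ₗ[ℂ] ℂ where
  toFun v := Om (v 0) (v 1)
  map_update_add' {inst} v i x y := by
    rw [Subsingleton.elim inst (instDecidableEqFin 2)]
    clear inst
    fin_cases i <;> simp [Om] <;> ring
  map_update_smul' {inst} v i c x := by
    rw [Subsingleton.elim inst (instDecidableEqFin 2)]
    clear inst
    fin_cases i <;> simp [Om] <;> ring
  map_eq_zero_of_eq' v i j h hij := by
    fin_cases i <;> fin_cases j <;> first
      | exact absurd rfl hij
      | (simp at h; simp only [h, Om]; ring)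

/-- The 4-form `½ Ω ∧ Ω`. -/
def OmOmForm : (Fin 4 → ℂ) [⋀^Fin 4]→ₗ[ℂ] ℂ where
  toFun v := Om (v 0) (v 1) * Om (v 2) (v 3) - Om (v 0) (v 2) * Om (v 1) (v 3)
    + Om (v 0) (v 3) * Om (v 1) (v 2)
  map_update_add' {inst} v i x y := by
    rw [Subsingleton.elim inst (instDecidableEqFin 4)]
    clear inst
    fin_cases i <;> simp [Om, Function.update] <;> ring
  map_update_smul' {inst} v i c x := by
    rw [Subsingleton.elim inst (instDecidableEqFin 4)]
    clear inst
    fin_cases i <;> simp [Om, Function.update] <;> ring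
  map_eq_zero_of_eq' v i j h hij := by
    fin_cases i <;> fin_cases j <;> first
      | exact absurd rfl hij
      | (simp at h; simp only [h, Om]; ring)

/-- `W = {ω ∈ Λ²ℂ⁴ | Ω(ω) = 0}`. -/
def W : Submodule ℂ (⋀[ℂ]^2 (Fin 4 → ℂ)) :=
  LinearMap.ker (exteriorPower.alternatingMapLinearEquiv OmForm)

/-- The linear functional on `Λ(ℂ⁴)` which is `½ Ω ∧ Ω` on `Λ⁴(ℂ⁴)` and zero in the other
degrees. -/
def OmOm : ExteriorAlgebra ℂ (Fin 4 → ℂ) →ₗ[ℂ] ℂ :=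
  ExteriorAlgebra.liftAlternating (Pi.single 4 OmOmForm)

/-- The quadric `𝒬³ ⊂ PW` of null lines of the bilinear form `(½ Ω ∧ Ω)(ω ∧ η)`. -/
def Q3 : Set (ℙ ℂ W) :=
  {η | ∀ a ∈ η.submodule, OmOm ((a : ⋀[ℂ]^2 (Fin 4 → ℂ)) * (a : ⋀[ℂ]^2 (Fin 4 → ℂ)) :
    ExteriorAlgebra ℂ (Fin 4 → ℂ)) = 0}

/-- The point `η = [v ∧ w]` of `𝒬³` is the fibre of `π` over `p` with its induced orientation:
the contact line `P Span(v, w)` meets the real quadric `Q = {(z, z) = 0}` of `ℂP³` exactly in the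
positive tangent directions of the fibre. -/
def RepresentsFibre (π : Sph 3 → Sph 2) (p : Sph 2) (η : Q3) : Prop :=
  ∃ (v w : Fin 4 → ℂ) (a : W) (ha : a ≠ 0),
    (a : ⋀[ℂ]^2 (Fin 4 → ℂ)) = exteriorPower.ιMulti ℂ 2 ![v, w] ∧
    (η : ℙ ℂ W) = Projectivization.mk ℂ a ha ∧
    ∀ ψ : Fin 4 → ℂ, ψ ≠ 0 →
      ((ψ ∈ Submodule.span ℂ {v, w} ∧ herm ψ = 0) ↔
        ∃ x T, π x = p ∧ IsPositiveUnitTangent π x T ∧ ψ ∈ tangentLine x T)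

/-! ### Holomorphic curves and their degree -/

/-- The complex projective line. -/
abbrev CP1 : Type := ℙ ℂ (Fin 2 → ℂ)

/-- The point of `S²` with homogeneous coordinates `[z : w]`. -/
def homToS2 (u : Fin 2 → ℂ) : EuclideanSpace ℝ (Fin (2 + 1)) :=
  (Complex.normSq (u 0) + Complex.normSq (u 1))⁻¹ •
    !₂[2 * (u 0 * (starRingEnd ℂ) (u 1)).re, 2 * (u 0 * (starRingEnd ℂ) (u 1)).im,
      Complex.normSq (u 1) - Complex.normSq (u 0)]

theorem normSq_add_pos {u : Fin 2 → ℂ} (hu : u ≠ 0) :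
    0 < Complex.normSq (u 0) + Complex.normSq (u 1) := by
  by_contra h
  apply hu
  have h0 := Complex.normSq_nonneg (u 0)
  have h1 := Complex.normSq_nonneg (u 1)
  funext i
  fin_cases i
  · exact Complex.normSq_eq_zero.1 (show Complex.normSq (u 0) = 0 by linarith)
  · exact Complex.normSq_eq_zero.1 (show Complex.normSq (u 1) = 0 by linarith)

theorem homToS2_mem {u : Fin 2 → ℂ} (hu : u ≠ 0) :
    homToS2 u ∈ Metric.sphere (0 : EuclideanSpace ℝ (Fin (2 + 1))) 1 := by
  have hp := normSq_add_pos hu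
  rw [mem_sphere_zero_iff_norm, homToS2, norm_smul, EuclideanSpace.norm_eq, norm_inv,
    Real.norm_of_nonneg hp.le, inv_mul_eq_one₀ hp.ne', eq_comm, Real.sqrt_eq_iff_mul_self_eq_of_pos hp]
  simp [Fin.sum_univ_three, Complex.normSq_apply]
  ring

theorem homToS2_smul {u : Fin 2 → ℂ} {t : ℂ} (ht : t ≠ 0) :
    homToS2 (t • u) = homToS2 u := by
  have h := Complex.normSq_pos.2 ht
  have e1 : ∀ a b : ℝ, (Complex.normSq t * a + Complex.normSq t * b)⁻¹
      = (Complex.normSq t)⁻¹ * (a + b)⁻¹ := fun a b => by rw [← mul_add, mul_inv]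
  ext i
  fin_cases i <;>
    simp only [homToS2, Pi.smul_apply, smul_eq_mul, map_mul, e1] <;> simp <;> field_simp <;>
    simp only [Complex.normSq_apply] <;> ring

/-- The orientation preserving conformal identification `ℂP¹ = S²`, with
`[z : w] ↦ (2 Re z w̄, 2 Im z w̄, |w|² - |z|²) / (|z|² + |w|²)`. -/
def toS2 : CP1 → Sph 2 :=
  Projectivization.lift (fun u => ⟨homToS2 u.1, homToS2_mem u.2⟩) (by
    rintro ⟨a, ha⟩ ⟨b, hb⟩ t h
    have h' : a = t • b := h
    have ht : t ≠ 0 := fun h0 => ha (by rw [h', h0, zero_smul])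
    subst h'
    exact Subtype.ext (homToS2_smul ht))

/-- A map `ℂP¹ → P(E)` is holomorphic if it has local holomorphic lifts to `E ∖ {0}` (with
holomorphy tested by linear functionals, `E` being finite dimensional). -/
def IsHolomorphicCurve {E : Type*} [AddCommGroup E] [Module ℂ E] (γ : CP1 → ℙ ℂ E) : Prop :=
  ∀ u₀ : Fin 2 → ℂ, u₀ ≠ 0 → ∃ U : Set (Fin 2 → ℂ), IsOpen U ∧ u₀ ∈ U ∧
    ∃ f : (Fin 2 → ℂ) → E,
      (∀ l : Module.Dual ℂ E, DifferentiableOn ℂ (fun u => l (f u)) U) ∧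
      ∀ u ∈ U, ∀ hu : u ≠ 0, ∃ hf : f u ≠ 0,
        γ (Projectivization.mk ℂ u hu) = Projectivization.mk ℂ (f u) hf

/-- A map `ℂP¹ → P(E)` is a curve of degree `n` if it is given by a homogeneous polynomial map
`ℂ² → E` of degree `n` without zeros on `ℂ² ∖ {0}`. -/
def HasDegree {E : Type*} [AddCommGroup E] [Module ℂ E] (γ : CP1 → ℙ ℂ E) (n : ℕ) : Prop :=
  ∃ v : ℕ → E, ∀ (u : Fin 2 → ℂ) (hu : u ≠ 0),
    ∃ h : ∑ k ∈ Finset.range (n + 1), (u 0 ^ k * u 1 ^ (n - k)) • v k ≠ 0,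
      γ (Projectivization.mk ℂ u hu) = Projectivization.mk ℂ _ h

end CircleFibration

end

/-!
A point of `S³` is `y ∈ ℝ⁴`, or the null vector `(y, 1)` of the Lorentz space `ℝ⁴ × ℝ`. An
oriented circle of `S³` is given by a complex null vector `(a, c) ∈ ℂ⁴ × ℂ`, `a · a = c²`, up to a
factor: the circle is the zero set of the form `y ↦ a · y - c` on `S³`, and its orientation is the
one for which the positive tangent followed by the real and the imaginary part of the form is
positive.

In a stereographic coordinate of `S²` the map `π` becomes a complex function on an open part of
`S³`. Conformality says that its gradient `g` is isotropic, `g · g = 0`, and the positive unit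
tangent of the fibre is the unit normal to `Re g` and `Im g` (`grad_chart`). For each fibre there
is a null vector `(a, c)` such that the differential of its form along the fibre is a complex
multiple of `g` (`Rep`, `rep_of_ne`). At one point this can be arranged; elsewhere on the fibre
the differential is a multiple of `g` or of its conjugate, and the second case is excluded by
connectedness.

Normalise the form to be `1` at a point of the fibre over `∞`, and call it `G(z)` for the fibre
over `z ∈ ℂ`. Differentiating the relation that `G(π(y))` vanishes at `y` shows that the
derivative of `G` at `z` is complex linear, when evaluated on the fibre over `z`. So the
antilinear part of the derivative vanishes on this fibre; it is also orthogonal to `G(z)`, because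
`G` stays isotropic, and it vanishes at the normalising point. This forces it to be zero
(`eq_zero_of_ev`), and `G` is entire. Near infinity `G` is the form of the other stereographic
coordinate divided by its value at a point of the fibre over `∞`, which has a simple zero there.
Hence `G` grows linearly, and it is affine (`exists_affine`): the curve of null vectors has degree
`1`.

It remains to pass from null vectors to `𝒬³`. The spin representation identifies `ℂ⁴ × ℂ` with
`W`: the kernel in `ℂ⁴` of the Clifford multiplication by a null vector `(a, c)` is a plane, and
its Plücker vector is linear in `(a, c)` (`toBivector`, `exists_basis_onLine`). The vectors
`(x λ, λ)` with `|x| = 1`, `λ ≠ 0`, in this plane are those with `a · x = c` and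
`(a - c x) λ = 0`, and the latter equation defines the positive tangent direction of the circle
at `x` (`mem_tangentLine_iff`, `Rep.onLine_iff`). A line which contains the tangent directions of the circle at two of its points
is determined by them, which gives the uniqueness of the point of `𝒬³`
(`Rep.representsFibre_iff`).
-/

noncomputable section

open scoped Matrix
open Filter Topology

namespace CircleFibration

/-! ### Maps between spheres in Cartesian coordinates -/

/-- The form in which Mathlib asks for the dimension of `ℝⁿ⁺¹` to make `Sⁿ` a manifold. -/
theorem factFinrank (n : ℕ) : Fact (Module.finrank ℝ (EuclideanSpace ℝ (Fin (n + 1))) = n + 1) :=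
  ⟨finrank_euclideanSpace_fin⟩

attribute [local instance] factFinrank

/-- The Euclidean space `ℝ⁴`. -/
abbrev E4 : Type := EuclideanSpace ℝ (Fin (3 + 1))
/-- The Euclidean space `ℝ³`. -/
abbrev E3 : Type := EuclideanSpace ℝ (Fin (2 + 1))

theorem Sph.norm_eq {n : ℕ} (x : Sph n) : ‖(x : EuclideanSpace ℝ (Fin (n + 1)))‖ = 1 := by
  simp

theorem Sph.ne_zero {n : ℕ} (x : Sph n) : (x : EuclideanSpace ℝ (Fin (n + 1))) ≠ 0 := by
  intro h; have := x.norm_eq; rw [h] at this; simp at this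

theorem normalize_mem {x : E4} (hx : x ≠ 0) : ‖x‖⁻¹ • x ∈ Metric.sphere (0 : E4) 1 := by
  rw [mem_sphere_zero_iff_norm, norm_smul, norm_inv, norm_norm,
    inv_mul_cancel₀ (norm_ne_zero_iff.2 hx)]

open Classical in
/-- The extension of `π : S³ → S²` to `ℝ⁴ ∖ {0}` which is homogeneous of degree `0`, as a map to
`ℝ³` (with value `0` at the origin). -/
def ext (π : Sph 3 → Sph 2) (x : E4) : E3 :=
  if hx : x ≠ 0 then (π ⟨‖x‖⁻¹ • x, normalize_mem hx⟩ : E3) else 0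

theorem ext_of_ne (π : Sph 3 → Sph 2) {x : E4} (hx : x ≠ 0) :
    ext π x = π ⟨‖x‖⁻¹ • x, normalize_mem hx⟩ := dif_pos hx

theorem ext_coe (π : Sph 3 → Sph 2) (x : Sph 3) : ext π x = π x := by
  rw [ext_of_ne π x.ne_zero]
  congr 2
  ext1
  simp [x.norm_eq]

theorem ext_smul (π : Sph 3 → Sph 2) (x : E4) {t : ℝ} (ht : 0 < t) : ext π (t • x) = ext π x := by
  by_cases hx : x = 0
  · simp [hx]
  · rw [ext_of_ne π hx, ext_of_ne π (smul_ne_zero ht.ne' hx)]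
    congr 2
    ext1
    simp only [norm_smul, Real.norm_of_nonneg ht.le, smul_smul, mul_inv]
    congr 1
    field_simp

theorem contDiffAt_ext {π : Sph 3 → Sph 2} (hπ : ContMDiff (𝓡 3) (𝓡 2) ∞ π) {x : E4} (hx : x ≠ 0) :
    ContDiffAt ℝ ∞ (ext π) x := by
  let U : TopologicalSpace.Opens E4 := ⟨{0}ᶜ, isOpen_compl_singleton⟩
  have h1 : ContMDiff 𝓘(ℝ, E4) 𝓘(ℝ, E4) ∞ (fun y : U => ‖(y : E4)‖⁻¹ • (y : E4)) := by
    intro y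
    refine (contMDiffAt_subtype_iff (U := U) (f := fun y : E4 => ‖y‖⁻¹ • y)).2 ?_
    have hy : (y : E4) ≠ 0 := y.2
    exact (((contDiffAt_norm ℝ hy).inv (norm_ne_zero_iff.2 hy)).smul contDiffAt_id).contMDiffAt
  have h2 : ContMDiff 𝓘(ℝ, E4) (𝓡 3) ∞
      (fun y : U => (⟨‖(y : E4)‖⁻¹ • (y : E4), normalize_mem y.2⟩ : Sph 3)) :=
    h1.codRestrict_sphere _
  have h3 : ContMDiff 𝓘(ℝ, E4) 𝓘(ℝ, E3) ∞ (fun y : U => ext π (y : E4)) := by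
    have := (contMDiff_coe_sphere (m := ∞) (E := E3) (n := 2)).comp (hπ.comp h2)
    have e : (fun y : U => ext π (y : E4)) = _ := funext fun y => ext_of_ne π y.2
    rw [e]
    exact this
  have h4 := (contMDiffAt_subtype_iff (U := U) (f := ext π) (x := ⟨x, hx⟩)).1 (h3 ⟨x, hx⟩)
  exact h4.contDiffAt

/-- The derivative of the homogeneous extension is the differential of `π`, on tangent vectors of
`S³`. -/
theorem fderiv_ext_incl {π : Sph 3 → Sph 2} (hπ : ContMDiff (𝓡 3) (𝓡 2) ∞ π) (x : Sph 3)
    (X : TangentSpace (𝓡 3) x) :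
    fderiv ℝ (ext π) (x : E4) (incl x X) = incl (π x) (dif π x X) := by
  have e : (ext π) ∘ (fun y : Sph 3 => (y : E4)) = (fun y : Sph 2 => (y : E3)) ∘ π := by
    funext y; exact ext_coe π y
  have d1 : MDifferentiableAt (𝓡 3) 𝓘(ℝ, E4) (fun y : Sph 3 => (y : E4)) x :=
    (contMDiff_coe_sphere (m := ∞) x).mdifferentiableAt (by simp)
  have d2 : MDifferentiableAt (𝓡 2) 𝓘(ℝ, E3) (fun y : Sph 2 => (y : E3)) (π x) :=
    (contMDiff_coe_sphere (m := ∞) (π x)).mdifferentiableAt (by simp)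
  have d3 : MDifferentiableAt (𝓡 3) (𝓡 2) π x := (hπ x).mdifferentiableAt (by simp)
  have d4 : MDifferentiableAt 𝓘(ℝ, E4) 𝓘(ℝ, E3) (ext π) (x : E4) :=
    ((contDiffAt_ext hπ x.ne_zero).differentiableAt (by simp)).mdifferentiableAt
  have c1 := mfderiv_comp x d4 d1
  have c2 := mfderiv_comp x d2 d3
  rw [e] at c1
  have := congrArg (fun L => L X) (c1.symm.trans c2)
  rw [mfderiv_eq_fderiv] at this
  exact this

/-- Euler's relation in degree `0`. -/
theorem fderiv_ext_self {π : Sph 3 → Sph 2} (hπ : ContMDiff (𝓡 3) (𝓡 2) ∞ π) {x : E4} (hx : x ≠ 0) :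
    fderiv ℝ (ext π) x x = 0 := by
  have h := (contDiffAt_ext hπ hx).differentiableAt (by simp)
  have h1 : HasDerivAt (fun t : ℝ => t • x) x 1 := by
    simpa using (hasDerivAt_id (1 : ℝ)).smul_const x
  have h2 : HasDerivAt (fun t : ℝ => ext π (t • x)) (fderiv ℝ (ext π) x x) 1 := by
    refine HasFDerivAt.comp_hasDerivAt (f := fun t : ℝ => t • x) (l := ext π) (1 : ℝ) ?_ h1
    simpa using h.hasFDerivAt
  have h3 : HasDerivAt (fun t : ℝ => ext π (t • x)) 0 1 := by
    refine (hasDerivAt_const (1 : ℝ) (ext π x)).congr_of_eventuallyEq ?_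
    filter_upwards [lt_mem_nhds (zero_lt_one' ℝ)] with t ht
    exact ext_smul π x ht
  exact h2.unique h3

/-- The tangent space of `Sⁿ` at `x`, as a subspace of `ℝⁿ⁺¹`, is the orthogonal complement of
`x`. -/
theorem exists_incl_eq {n : ℕ} (x : Sph n) (v : EuclideanSpace ℝ (Fin (n + 1))) :
    (∃ X, incl x X = v) ↔ inner ℝ (x : EuclideanSpace ℝ (Fin (n + 1))) v = 0 := by
  have h := range_mvfderiv_subtypeVal (E := EuclideanSpace ℝ (Fin (n + 1))) (n := n) x
  have : v ∈ (ℝ ∙ (x : EuclideanSpace ℝ (Fin (n + 1))))ᗮ ↔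
      inner ℝ (x : EuclideanSpace ℝ (Fin (n + 1))) v = 0 :=
    Submodule.mem_orthogonal_singleton_iff_inner_right
  rw [← this, ← h]
  rfl

theorem incl_injective {n : ℕ} (x : Sph n) : Function.Injective (incl x) :=
  injective_mvfderiv_subtypeVal_sphere (E := EuclideanSpace ℝ (Fin (n + 1))) x

theorem inner_incl {n : ℕ} (x : Sph n) (X : TangentSpace (𝓡 n) x) :
    inner ℝ (x : EuclideanSpace ℝ (Fin (n + 1))) (incl x X) = 0 :=
  (exists_incl_eq x _).1 ⟨X, rfl⟩

/-! ### The stereographic coordinates of `S²` -/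

/-- The determinant of four vectors of `ℝ⁴`. -/
def det4 (x y z w : E4) : ℝ := Matrix.det (Matrix.of fun i j : Fin 4 => (![x, y, z, w] i) j)

/-- The determinant of three vectors of `ℝ³`. -/
def det3 (x y z : E3) : ℝ := Matrix.det (Matrix.of fun i j : Fin 3 => (![x, y, z] i) j)

theorem det3_eq (x y z : E3) : det3 x y z =
    x 0 * (y 1 * z 2 - y 2 * z 1) - x 1 * (y 0 * z 2 - y 2 * z 0)
      + x 2 * (y 0 * z 1 - y 1 * z 0) := by
  simp [det3, Matrix.det_fin_three]
  ring

theorem det4_eq (x y z w : E4) : det4 x y z w =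
    x 0 * (y 1 * (z 2 * w 3 - z 3 * w 2) - y 2 * (z 1 * w 3 - z 3 * w 1)
        + y 3 * (z 1 * w 2 - z 2 * w 1))
    - x 1 * (y 0 * (z 2 * w 3 - z 3 * w 2) - y 2 * (z 0 * w 3 - z 3 * w 0)
        + y 3 * (z 0 * w 2 - z 2 * w 0))
    + x 2 * (y 0 * (z 1 * w 3 - z 3 * w 1) - y 1 * (z 0 * w 3 - z 3 * w 0)
        + y 3 * (z 0 * w 1 - z 1 * w 0))
    - x 3 * (y 0 * (z 1 * w 2 - z 2 * w 1) - y 1 * (z 0 * w 2 - z 2 * w 0)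
        + y 2 * (z 0 * w 1 - z 1 * w 0)) := by
  simp [det4, Matrix.det_succ_row_zero, Fin.sum_univ_succ, Fin.succAbove]
  ring

theorem det3_comb (u X Y : E3) (a b c d : ℝ) :
    det3 u (a • X + b • Y) (c • X + d • Y) = (a * d - b * c) * det3 u X Y := by
  simp only [det3_eq, PiLp.add_apply, PiLp.smul_apply, smul_eq_mul]
  ring

theorem det4_comb (u v X Y : E4) (a b c d : ℝ) :
    det4 u v (a • X + b • Y) (c • X + d • Y) = (a * d - b * c) * det4 u v X Y := by
  simp only [det4_eq, PiLp.add_apply, PiLp.smul_apply, smul_eq_mul]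
  ring

theorem inner_E3 (x y : E3) : inner ℝ x y = x 0 * y 0 + x 1 * y 1 + x 2 * y 2 := by
  simp [PiLp.inner_apply, Fin.sum_univ_succ]
  ring

theorem inner_E4 (x y : E4) : inner ℝ x y = x 0 * y 0 + x 1 * y 1 + x 2 * y 2 + x 3 * y 3 := by
  simp [PiLp.inner_apply, Fin.sum_univ_succ]
  ring

/-- Stereographic projection of `S²` from the pole `(0, 0, -ε)`, for `ε = ±1`. Both maps preserve
the orientation, and they are inverse to each other as points of `ℂP¹`. -/
def stereo (ε : ℝ) (u : E3) : ℂ := ((u 0 : ℂ) + ε * Complex.I * u 1) / (1 + ε * u 2)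

/-- The derivative of `stereo ε`. -/
def dstereo (ε : ℝ) (u Y : E3) : ℂ :=
  ((Y 0 : ℂ) + ε * Complex.I * Y 1) / (1 + ε * u 2)
    - ((u 0 : ℂ) + ε * Complex.I * u 1) * (ε * Y 2) / (1 + ε * u 2) ^ 2

theorem contDiffAt_coord {n : ℕ} (i : Fin n) (u : EuclideanSpace ℝ (Fin n)) {m : WithTop ℕ∞} :
    ContDiffAt ℝ m (fun u : EuclideanSpace ℝ (Fin n) => ((u i : ℝ) : ℂ)) u :=
  (Complex.ofRealCLM.contDiff.comp (EuclideanSpace.proj (𝕜 := ℝ) i).contDiff).contDiffAt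

theorem cast_ne {ε : ℝ} {u : E3} (hm : 1 + ε * u 2 ≠ 0) : (1 + (ε : ℂ) * (u 2 : ℝ)) ≠ 0 := by
  exact_mod_cast hm

theorem contDiffAt_stereo {ε : ℝ} {u : E3} (hm : 1 + ε * u 2 ≠ 0) :
    ContDiffAt ℝ ∞ (stereo ε) u := by
  unfold stereo
  simp only [div_eq_mul_inv]
  refine ContDiffAt.mul ?_ (ContDiffAt.inv ?_ (cast_ne hm))
  · exact (contDiffAt_coord 0 u).add (contDiffAt_const.mul (contDiffAt_coord 1 u))
  · exact contDiffAt_const.add (contDiffAt_const.mul (contDiffAt_coord 2 u))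

theorem fderiv_stereo {ε : ℝ} {u : E3} (hm : 1 + ε * u 2 ≠ 0) (Y : E3) :
    fderiv ℝ (stereo ε) u Y = dstereo ε u Y := by
  have hl : HasDerivAt (fun t : ℝ => u + t • Y) Y 0 := by
    simpa using ((hasDerivAt_id (0 : ℝ)).smul_const Y).const_add u
  have h1 : HasDerivAt (fun t : ℝ => stereo ε (u + t • Y)) (fderiv ℝ (stereo ε) u Y) 0 := by
    refine HasFDerivAt.comp_hasDerivAt (f := fun t : ℝ => u + t • Y) (l := stereo ε) (0 : ℝ) ?_ hl
    simpa using ((contDiffAt_stereo hm).differentiableAt (by simp)).hasFDerivAt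
  have hc : ∀ i, HasDerivAt (fun t : ℝ => (((u + t • Y) i : ℝ) : ℂ)) (Y i : ℂ) 0 := by
    intro i
    have := ((hasDerivAt_id (0 : ℝ)).mul_const (Y i)).const_add (u i)
    simpa using this.ofReal_comp
  have h2 := ((hc 0).add ((hc 1).const_mul (ε * Complex.I))).fun_div
    (((hc 2).const_mul (ε : ℂ)).const_add 1) (by simpa using cast_ne hm)
  rw [h1.unique h2, dstereo]
  simp only [zero_smul, add_zero]
  have := cast_ne hm
  simp only [Pi.add_apply, zero_smul, add_zero]
  field_simp

/-- The tangent vector of `S²` at `u` which `stereo ε` maps to `1`. -/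
def frame1 (ε : ℝ) (u : E3) : E3 :=
  !₂[1 + ε * u 2 - u 0 ^ 2, -(u 0 * u 1), -(ε * u 0 * (1 + ε * u 2))]

/-- The tangent vector of `S²` at `u` which `stereo ε` maps to `i`. -/
def frame2 (ε : ℝ) (u : E3) : E3 :=
  !₂[-(ε * u 0 * u 1), ε * (1 + ε * u 2 - u 1 ^ 2), -((1 + ε * u 2) * u 1)]

theorem inner_frame1 {ε : ℝ} (hε : ε ^ 2 = 1) {u : E3}
    (hu : u 0 ^ 2 + u 1 ^ 2 + u 2 ^ 2 = 1) : inner ℝ u (frame1 ε u) = 0 := by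
  rw [inner_E3]
  simp [frame1]
  linear_combination (-u 0) * hu + (-u 0 * u 2 ^ 2) * hε

theorem inner_frame2 {ε : ℝ} (hε : ε ^ 2 = 1) {u : E3}
    (hu : u 0 ^ 2 + u 1 ^ 2 + u 2 ^ 2 = 1) : inner ℝ u (frame2 ε u) = 0 := by
  rw [inner_E3]
  simp [frame2]
  linear_combination (-ε * u 1) * hu + (u 1 * u 2) * hε

theorem inner_frame1_frame1 {ε : ℝ} (hε : ε ^ 2 = 1) {u : E3}
    (hu : u 0 ^ 2 + u 1 ^ 2 + u 2 ^ 2 = 1) :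
    inner ℝ (frame1 ε u) (frame1 ε u) = (1 + ε * u 2) ^ 2 := by
  rw [inner_E3]
  simp [frame1]
  linear_combination (u 0 ^ 2) * hu + (u 0 ^ 2 * (ε ^ 2 * u 2 ^ 2 + 2 * ε * u 2 + u 2 ^ 2 + 1)) * hε

theorem inner_frame2_frame2 {ε : ℝ} (hε : ε ^ 2 = 1) {u : E3}
    (hu : u 0 ^ 2 + u 1 ^ 2 + u 2 ^ 2 = 1) :
    inner ℝ (frame2 ε u) (frame2 ε u) = (1 + ε * u 2) ^ 2 := by
  rw [inner_E3]
  simp [frame2]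
  linear_combination (u 1 ^ 2) * hu +
    (u 0 ^ 2 * u 1 ^ 2 + (1 + ε * u 2 - u 1 ^ 2) ^ 2 + u 1 ^ 2 * u 2 ^ 2) * hε

theorem inner_frame1_frame2 {ε : ℝ} (hε : ε ^ 2 = 1) {u : E3}
    (hu : u 0 ^ 2 + u 1 ^ 2 + u 2 ^ 2 = 1) : inner ℝ (frame1 ε u) (frame2 ε u) = 0 := by
  rw [inner_E3]
  simp [frame1, frame2]
  linear_combination (ε * u 0 * u 1) * hu + (u 0 * u 1 * ε * u 2 ^ 2) * hε

theorem det3_frame {ε : ℝ} (hε : ε ^ 2 = 1) {u : E3}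
    (hu : u 0 ^ 2 + u 1 ^ 2 + u 2 ^ 2 = 1) :
    det3 u (frame1 ε u) (frame2 ε u) = (1 + ε * u 2) ^ 2 := by
  rw [det3_eq]
  simp [frame1, frame2]
  linear_combination ((1 + ε * u 2) ^ 2 - ε * (1 + ε * u 2) * u 2) * hu +
    (1 + ε * u 2) * (u 0 ^ 2 * (1 + ε * u 2 - u 1 ^ 2) + u 0 ^ 2 * u 1 ^ 2 + u 2 ^ 2) * hε

theorem dstereo_frame1 {ε : ℝ} (hε : ε ^ 2 = 1) {u : E3}
    (hm : 1 + ε * u 2 ≠ 0) : dstereo ε u (frame1 ε u) = 1 := by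
  have := cast_ne hm
  have hε' : (ε : ℂ) ^ 2 = 1 := by exact_mod_cast hε
  rw [dstereo, div_sub_div _ _ this (pow_ne_zero 2 this),
    div_eq_one_iff_eq (mul_ne_zero this (pow_ne_zero 2 this))]
  simp [frame1]
  linear_combination (1 + (ε : ℂ) * u 2) ^ 2 * u 0 * (u 0 + Complex.I * ε * u 1) * hε'

theorem dstereo_frame2 {ε : ℝ} (hε : ε ^ 2 = 1) {u : E3}
    (hm : 1 + ε * u 2 ≠ 0) : dstereo ε u (frame2 ε u) = Complex.I := by
  have := cast_ne hm
  have hε' : (ε : ℂ) ^ 2 = 1 := by exact_mod_cast hε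
  rw [dstereo, div_sub_div _ _ this (pow_ne_zero 2 this),
    div_eq_iff (mul_ne_zero this (pow_ne_zero 2 this))]
  simp [frame2]
  linear_combination (1 + (ε : ℂ) * u 2) ^ 3 * Complex.I * hε'

theorem eq_zero_of_dstereo {ε : ℝ} (hε : ε ^ 2 = 1) {u : E3}
    (hu : u 0 ^ 2 + u 1 ^ 2 + u 2 ^ 2 = 1) (hm : 1 + ε * u 2 ≠ 0) {Y : E3} (hY : inner ℝ u Y = 0)
    (h : dstereo ε u Y = 0) : Y = 0 := by
  have := cast_ne hm
  rw [dstereo, sub_eq_zero, div_eq_div_iff this (pow_ne_zero 2 this)] at h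
  have h2 : ((Y 0 : ℂ) + ε * Complex.I * Y 1) * (1 + ε * u 2) =
      ((u 0 : ℂ) + ε * Complex.I * u 1) * (ε * Y 2) := by
    apply mul_right_cancel₀ this
    linear_combination h
  have r := congrArg Complex.re h2
  have i := congrArg Complex.im h2
  simp at r i
  rw [inner_E3] at hY
  have hε0 : ε ≠ 0 := by rintro rfl; norm_num at hε
  have i' : Y 1 * (1 + ε * u 2) = u 1 * (ε * Y 2) := by
    apply mul_left_cancel₀ hε0
    linear_combination i
  have h2 : Y 2 = 0 := by
    have : ε * (1 + ε * u 2) * Y 2 = 0 := by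
      linear_combination (1 + ε * u 2) * hY - u 0 * r - u 1 * i' - ε * Y 2 * hu + u 2 * Y 2 * hε
    simpa [hε0, hm] using this
  ext j
  fin_cases j
  · simpa [h2, hm] using r
  · simpa [h2, hm] using i'
  · exact h2

/-! ### Conformality in a stereographic coordinate -/

/-- Vectors of `ℝ⁴` tangent to `S³` at `x` and orthogonal to the fibre of `π`. -/
def IsHor (π : Sph 3 → Sph 2) (x : Sph 3) (A : E4) : Prop :=
  inner ℝ (x : E4) A = 0 ∧
    ∀ V : E4, inner ℝ (x : E4) V = 0 → fderiv ℝ (ext π) (x : E4) V = 0 → inner ℝ V A = 0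

/-- `IsHor` is the description in `ℝ⁴` of the horizontal space. -/
theorem isHor_incl {π : Sph 3 → Sph 2} (hπ : ContMDiff (𝓡 3) (𝓡 2) ∞ π) (x : Sph 3)
    (X : TangentSpace (𝓡 3) x) : IsHor π x (incl x X) ↔ X ∈ horizontal π x := by
  constructor
  · rintro ⟨-, h⟩ V hV
    refine h _ (inner_incl x V) ?_
    rw [fderiv_ext_incl hπ, hV, map_zero]
  · intro h
    refine ⟨inner_incl x X, fun V hV hV' => ?_⟩
    obtain ⟨V, rfl⟩ := (exists_incl_eq x V).2 hV
    refine h V (incl_injective (π x) ?_)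
    rw [← fderiv_ext_incl hπ, hV', map_zero]

theorem IsHor.comb {π : Sph 3 → Sph 2} {x : Sph 3} {A B : E4} (hA : IsHor π x A)
    (hB : IsHor π x B) (a b : ℝ) : IsHor π x (a • A + b • B) := by
  refine ⟨?_, fun V h1 h2 => ?_⟩
  · rw [inner_add_right, inner_smul_right, inner_smul_right, hA.1, hB.1]; simp
  · rw [inner_add_right, inner_smul_right, inner_smul_right, hA.2 V h1 h2, hB.2 V h1 h2]; simp

theorem IsHor.eq_zero {π : Sph 3 → Sph 2} {x : Sph 3} {A : E4} (hA : IsHor π x A)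
    (h : fderiv ℝ (ext π) (x : E4) A = 0) : A = 0 :=
  inner_self_eq_zero.1 (hA.2 A hA.1 h)

theorem inner_fderiv_ext {π : Sph 3 → Sph 2} (hπ : ContMDiff (𝓡 3) (𝓡 2) ∞ π) (x : Sph 3) {V : E4}
    (hV : inner ℝ (x : E4) V = 0) : inner ℝ (π x : E3) (fderiv ℝ (ext π) (x : E4) V) = 0 := by
  obtain ⟨V, rfl⟩ := (exists_incl_eq x V).2 hV
  rw [fderiv_ext_incl hπ]
  exact inner_incl _ _

/-- Tangent vectors of `S²` have horizontal lifts: subtract from any lift its projection to the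
kernel of the differential. -/
theorem exists_lift {π : Sph 3 → Sph 2} (hπ : IsConformalSubmersion π) (x : Sph 3) {Y : E3}
    (hY : inner ℝ (π x : E3) Y = 0) : ∃ A, IsHor π x A ∧ fderiv ℝ (ext π) (x : E4) A = Y := by
  obtain ⟨Y, rfl⟩ := (exists_incl_eq (π x) Y).2 hY
  obtain ⟨X, rfl⟩ := hπ.submersion x Y
  let K : Submodule ℝ E4 := (ℝ ∙ (x : E4))ᗮ ⊓ (fderiv ℝ (ext π) (x : E4)).ker
  have hK : ∀ V, V ∈ K ↔ inner ℝ (x : E4) V = 0 ∧ fderiv ℝ (ext π) (x : E4) V = 0 := by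
    intro V
    rw [Submodule.mem_inf, Submodule.mem_orthogonal_singleton_iff_inner_right]
    rfl
  have hp := (hK _).1 (K.starProjection_apply_mem (incl x X))
  refine ⟨incl x X - K.starProjection (incl x X), ⟨?_, fun V h1 h2 => ?_⟩, ?_⟩
  · rw [inner_sub_right, inner_incl, hp.1, sub_zero]
  · exact (Submodule.mem_orthogonal _ _).1 (K.sub_starProjection_mem_orthogonal (incl x X)) V
      ((hK V).2 ⟨h1, h2⟩)
  · rw [map_sub, hp.2, fderiv_ext_incl hπ.smooth, sub_zero]

/-- The complex coordinate `stereo ε ∘ π`, extended to a function on `ℝ⁴ ∖ {0}` which is homogeneous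
of degree `0`. -/
def chart (ε : ℝ) (π : Sph 3 → Sph 2) (x : E4) : ℂ := stereo ε (ext π x)

theorem contDiffAt_chart {π : Sph 3 → Sph 2} (hπ : ContMDiff (𝓡 3) (𝓡 2) ∞ π) {ε : ℝ} {x : E4}
    (hx : x ≠ 0) (hm : 1 + ε * ext π x 2 ≠ 0) : ContDiffAt ℝ ∞ (chart ε π) x :=
  (contDiffAt_stereo hm).comp x (contDiffAt_ext hπ hx)

theorem fderiv_chart {π : Sph 3 → Sph 2} (hπ : ContMDiff (𝓡 3) (𝓡 2) ∞ π) {ε : ℝ} {x : Sph 3}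
    (hm : 1 + ε * (π x : E3) 2 ≠ 0) (V : E4) :
    fderiv ℝ (chart ε π) (x : E4) V = dstereo ε (π x) (fderiv ℝ (ext π) (x : E4) V) := by
  have hm' : 1 + ε * ext π x 2 ≠ 0 := by rwa [ext_coe]
  have h := fderiv_comp (x : E4) ((contDiffAt_stereo hm').differentiableAt (by simp))
    ((contDiffAt_ext hπ x.ne_zero).differentiableAt (by simp))
  have h2 : fderiv ℝ (chart ε π) (x : E4) = _ := h
  rw [h2, ContinuousLinearMap.comp_apply, fderiv_stereo hm', ext_coe]

theorem Sph2.sq (u : Sph 2) : (u : E3) 0 ^ 2 + (u : E3) 1 ^ 2 + (u : E3) 2 ^ 2 = 1 := by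
  have h : inner ℝ (u : E3) (u : E3) = 1 := by rw [real_inner_self_eq_norm_sq, u.norm_eq, one_pow]
  rw [inner_E3] at h
  linarith

/-- Conformality in terms of the complex coordinate: horizontal lifts `A`, `B` of the coordinate
directions `1` and `i` are orthogonal and of the same length. Hence the gradient of the coordinate
is a multiple of `A + i B`. -/
theorem exists_frame {π : Sph 3 → Sph 2} (hπ : IsConformalSubmersion π) (x : Sph 3) {ε : ℝ}
    (hε : ε ^ 2 = 1) (hm : 1 + ε * (π x : E3) 2 ≠ 0) :
    ∃ (A B : E4) (r : ℝ), 0 < r ∧ inner ℝ (x : E4) A = 0 ∧ inner ℝ (x : E4) B = 0 ∧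
      inner ℝ A B = 0 ∧ inner ℝ A A = r ∧ inner ℝ B B = r ∧
      (∀ V, fderiv ℝ (chart ε π) (x : E4) V =
        ((inner ℝ A V : ℝ) + (inner ℝ B V : ℝ) * Complex.I) / r) ∧
      ∀ T, IsPositiveUnitTangent π x T ↔
        ‖T‖ = 1 ∧ inner ℝ (x : E4) T = 0 ∧ inner ℝ A T = 0 ∧ inner ℝ B T = 0 ∧
          0 < det4 x T A B := by
  have hu := Sph2.sq (π x)
  obtain ⟨A, hA, hA'⟩ := exists_lift hπ x (inner_frame1 hε hu)
  obtain ⟨B, hB, hB'⟩ := exists_lift hπ x (inner_frame2 hε hu)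
  obtain ⟨c, hc, hconf⟩ := hπ.conformal x
  have hconf' : ∀ X Y : E4, IsHor π x X → IsHor π x Y →
      inner ℝ (fderiv ℝ (ext π) (x : E4) X) (fderiv ℝ (ext π) (x : E4) Y) = c * inner ℝ X Y := by
    intro X Y hX hY
    obtain ⟨X, rfl⟩ := (exists_incl_eq x X).2 hX.1
    obtain ⟨Y, rfl⟩ := (exists_incl_eq x Y).2 hY.1
    rw [fderiv_ext_incl hπ.smooth, fderiv_ext_incl hπ.smooth]
    exact hconf X ((isHor_incl hπ.smooth x X).1 hX) Y ((isHor_incl hπ.smooth x Y).1 hY)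
  have hAA := hconf' A A hA hA
  have hBB := hconf' B B hB hB
  have hAB := hconf' A B hA hB
  rw [hA', inner_frame1_frame1 hε hu] at hAA
  rw [hB', inner_frame2_frame2 hε hu] at hBB
  rw [hA', hB', inner_frame1_frame2 hε hu] at hAB
  have hAB0 : inner ℝ A B = 0 := by
    rcases mul_eq_zero.1 hAB.symm with h | h
    · exact absurd h hc.ne'
    · exact h
  set r : ℝ := (1 + ε * (π x : E3) 2) ^ 2 / c with hr
  have hr0 : 0 < r := by positivity
  have hAA' : inner ℝ A A = r := by rw [hr, eq_div_iff hc.ne', hAA]; ring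
  have hBB' : inner ℝ B B = r := by rw [hr, eq_div_iff hc.ne', hBB]; ring
  have dA : fderiv ℝ (chart ε π) (x : E4) A = 1 := by
    rw [fderiv_chart hπ.smooth hm, hA', dstereo_frame1 hε hm]
  have dB : fderiv ℝ (chart ε π) (x : E4) B = Complex.I := by
    rw [fderiv_chart hπ.smooth hm, hB', dstereo_frame2 hε hm]
  have dx : fderiv ℝ (chart ε π) (x : E4) x = 0 := by
    rw [fderiv_chart hπ.smooth hm, fderiv_ext_self hπ.smooth x.ne_zero]
    simp [dstereo]
  have hxx : inner ℝ (x : E4) (x : E4) = 1 := by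
    rw [real_inner_self_eq_norm_sq, x.norm_eq, one_pow]
  -- a vector tangent to `S³` is determined modulo the kernel of `dπ` by the derivative of the chart
  have ker : ∀ V : E4, inner ℝ (x : E4) V = 0 → fderiv ℝ (chart ε π) (x : E4) V = 0 →
      fderiv ℝ (ext π) (x : E4) V = 0 := by
    intro V hV hV'
    rw [fderiv_chart hπ.smooth hm] at hV'
    exact eq_zero_of_dstereo hε hu hm (inner_fderiv_ext hπ.smooth x hV) hV'
  have grad : ∀ V, fderiv ℝ (chart ε π) (x : E4) V =
      ((inner ℝ A V : ℝ) + (inner ℝ B V : ℝ) * Complex.I) / r := by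
    intro V
    set d := fderiv ℝ (chart ε π) (x : E4) V with hd
    set V' : E4 := V - (inner ℝ (x : E4) V : ℝ) • (x : E4) - (d.re • A + d.im • B) with hV'
    have h1 : inner ℝ (x : E4) V' = 0 := by
      rw [hV', inner_sub_right, inner_sub_right, inner_add_right, inner_smul_right,
        inner_smul_right, inner_smul_right, hA.1, hB.1, hxx]
      ring
    have h2 : fderiv ℝ (chart ε π) (x : E4) V' = 0 := by
      rw [hV', map_sub, map_sub, map_add, map_smul, map_smul, map_smul, dA, dB, dx, ← hd]
      apply Complex.ext <;> simp
    have h3 := ker V' h1 h2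
    have hAx : inner ℝ A (x : E4) = 0 := by rw [real_inner_comm, hA.1]
    have hBx : inner ℝ B (x : E4) = 0 := by rw [real_inner_comm, hB.1]
    have hBA0 : inner ℝ B A = 0 := by rw [real_inner_comm, hAB0]
    have hA2 := hA.2 V' h1 h3
    have hB2 := hB.2 V' h1 h3
    rw [real_inner_comm, hV', inner_sub_right, inner_sub_right, inner_add_right, inner_smul_right,
      inner_smul_right, inner_smul_right, hAx, hAA', hAB0] at hA2
    rw [real_inner_comm, hV', inner_sub_right, inner_sub_right, inner_add_right, inner_smul_right,
      inner_smul_right, inner_smul_right, hBx, hBB', hBA0] at hB2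
    have e1 : inner ℝ A V = d.re * r := by linarith
    have e2 : inner ℝ B V = d.im * r := by linarith
    rw [e1, e2, eq_div_iff (by exact_mod_cast hr0.ne')]
    apply Complex.ext <;> simp
  refine ⟨A, B, r, hr0, hA.1, hB.1, hAB0, hAA', hBB', grad, fun T => ⟨?_, ?_⟩⟩
  · rintro ⟨hT, ⟨τ, hτ, rfl⟩, hpos⟩
    have hT0 : fderiv ℝ (chart ε π) (x : E4) (incl x τ) = 0 := by
      rw [fderiv_chart hπ.smooth hm, fderiv_ext_incl hπ.smooth, hτ, map_zero]
      simp [dstereo]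
    rw [grad, div_eq_zero_iff, or_iff_left (by exact_mod_cast hr0.ne')] at hT0
    have hre := congrArg Complex.re hT0
    have him := congrArg Complex.im hT0
    simp at hre him
    obtain ⟨a, ha⟩ := (exists_incl_eq x A).2 hA.1
    obtain ⟨b, hb⟩ := (exists_incl_eq x B).2 hB.1
    have := hpos a ((isHor_incl hπ.smooth x a).1 (by rwa [ha])) b
      ((isHor_incl hπ.smooth x b).1 (by rwa [hb]))
    rw [← fderiv_ext_incl hπ.smooth, ← fderiv_ext_incl hπ.smooth, ha, hb, hA', hB'] at this
    refine ⟨hT, inner_incl x τ, hre, him, this ?_⟩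
    have h := det3_frame hε hu
    rw [det3] at h
    rw [h]
    positivity
  · rintro ⟨hT, hxT, hAT, hBT, hdet⟩
    obtain ⟨τ, rfl⟩ := (exists_incl_eq x T).2 hxT
    refine ⟨hT, ⟨τ, incl_injective _ ?_, rfl⟩, ?_⟩
    · rw [← fderiv_ext_incl hπ.smooth, map_zero]
      refine ker _ hxT ?_
      rw [grad, hAT, hBT]
      simp
    · have comb : ∀ X ∈ horizontal π x, ∃ a b : ℝ, incl x X = a • A + b • B := by
        intro X hX
        have hX' := (isHor_incl hπ.smooth x X).2 hX
        set d := fderiv ℝ (chart ε π) (x : E4) (incl x X) with hd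
        refine ⟨d.re, d.im, ?_⟩
        have h0 := (hX'.comb (hA.comb hB d.re d.im) 1 (-1))
        have := h0.eq_zero (ker _ h0.1 ?_)
        · rwa [one_smul, neg_one_smul, ← sub_eq_add_neg, sub_eq_zero] at this
        · rw [map_add, map_smul, map_smul, map_add, map_smul, map_smul, dA, dB, ← hd]
          apply Complex.ext <;> simp
      intro X hX Y hY h
      obtain ⟨a, b, hab⟩ := comb X hX
      obtain ⟨a', b', hab'⟩ := comb Y hY
      rw [← fderiv_ext_incl hπ.smooth, ← fderiv_ext_incl hπ.smooth, hab, hab'] at h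
      simp only [map_add, map_smul, hA', hB'] at h
      rw [hab, hab']
      change 0 < det3 _ _ _ at h
      change 0 < det4 _ _ _ _
      rw [det3_comb, det3_frame hε hu] at h
      rw [det4_comb]
      exact mul_pos (pos_of_mul_pos_left h (by positivity)) hdet

/-! ### The isotropic gradient of the coordinate -/

/-- A vector of `ℝ⁴` as a vector of `ℂ⁴`. -/
def cx (x : E4) : Fin 4 → ℂ := fun i => (x i : ℂ)

/-- The real part of a vector of `ℂ⁴`. -/
def reV (w : Fin 4 → ℂ) : E4 := WithLp.toLp 2 fun i => (w i).re

/-- The imaginary part of a vector of `ℂ⁴`. -/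
def imV (w : Fin 4 → ℂ) : E4 := WithLp.toLp 2 fun i => (w i).im

theorem dot4 (a b : Fin 4 → ℂ) : a ⬝ᵥ b = a 0 * b 0 + a 1 * b 1 + a 2 * b 2 + a 3 * b 3 := by
  simp [dotProduct, Fin.sum_univ_succ]
  ring

theorem dot_cx_re (w : Fin 4 → ℂ) (x : E4) : (w ⬝ᵥ cx x).re = inner ℝ (reV w) x := by
  simp [dot4, inner_E4, cx, reV]

theorem dot_cx_im (w : Fin 4 → ℂ) (x : E4) : (w ⬝ᵥ cx x).im = inner ℝ (imV w) x := by
  simp [dot4, inner_E4, cx, imV]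

theorem cx_dot_cx (x y : E4) : cx x ⬝ᵥ cx y = (inner ℝ x y : ℝ) := by
  simp [dot4, inner_E4, cx]

theorem dot_self_re (w : Fin 4 → ℂ) :
    (w ⬝ᵥ w).re = inner ℝ (reV w) (reV w) - inner ℝ (imV w) (imV w) := by
  rw [inner_E4, inner_E4]
  simp [dot4, imV, reV]
  ring

theorem dot_self_im (w : Fin 4 → ℂ) : (w ⬝ᵥ w).im = 2 * inner ℝ (reV w) (imV w) := by
  simp [dot4, inner_E4, imV, reV]
  ring

@[simp] theorem cx_zero : cx 0 = 0 := by ext i; simp [cx]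

theorem cx_add (x y : E4) : cx (x + y) = cx x + cx y := by ext i; simp [cx]

theorem cx_sub (x y : E4) : cx (x - y) = cx x - cx y := by ext i; simp [cx]

theorem cx_smul (t : ℝ) (x : E4) : cx (t • x) = (t : ℂ) • cx x := by ext i; simp [cx]

theorem reV_add_imV (w : Fin 4 → ℂ) : w = cx (reV w) + Complex.I • cx (imV w) := by
  ext i
  simp only [cx, reV, imV, Pi.add_apply, Pi.smul_apply, smul_eq_mul]
  rw [mul_comm, Complex.re_add_im]

/-- `T` is the unit tangent vector of `S³` at `x` which is orthogonal to the plane spanned by the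
real and imaginary parts of `w` and for which `T, Re w, Im w` is positively oriented. -/
def IsNormalTo (x T : E4) (w : Fin 4 → ℂ) : Prop :=
  ‖T‖ = 1 ∧ inner ℝ x T = 0 ∧ w ⬝ᵥ cx T = 0 ∧ 0 < det4 x T (reV w) (imV w)

theorem reV_smul (c : ℂ) (w : Fin 4 → ℂ) : reV (c • w) = c.re • reV w + (-c.im) • imV w := by
  ext i; simp [reV, imV]; ring

theorem imV_smul (c : ℂ) (w : Fin 4 → ℂ) : imV (c • w) = c.im • reV w + c.re • imV w := by
  ext i; simp [reV, imV]; ring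

/-- Multiplication of `w` by a complex number rotates and scales its real and imaginary part, which
keeps their plane and its orientation. -/
theorem isNormalTo_smul {x T : E4} {w : Fin 4 → ℂ} {c : ℂ} (hc : c ≠ 0) :
    IsNormalTo x T (c • w) ↔ IsNormalTo x T w := by
  have : 0 < c.re * c.re - -c.im * c.im := by
    have := Complex.normSq_pos.2 hc
    rw [Complex.normSq_apply] at this
    linarith
  rw [IsNormalTo, IsNormalTo, reV_smul, imV_smul, det4_comb, mul_pos_iff_of_pos_left this,
    smul_dotProduct, smul_eq_zero, or_iff_right hc]

/-- The complex gradient at `x` of a function on `ℝ⁴`. -/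
def grad (f : E4 → ℂ) (x : E4) : Fin 4 → ℂ := fun i => fderiv ℝ f x (EuclideanSpace.single i 1)

theorem fderiv_eq_grad (f : E4 → ℂ) (x V : E4) : fderiv ℝ f x V = grad f x ⬝ᵥ cx V := by
  have : V = ∑ i, V i • EuclideanSpace.single i (1 : ℝ) := by
    ext j
    simp [Pi.single_apply]
  conv_lhs => rw [this]
  rw [map_sum, dotProduct]
  refine Finset.sum_congr rfl fun i _ => ?_
  rw [map_smul, grad, cx, Complex.real_smul, mul_comm]

/-- The gradient of the complex coordinate of a conformal submersion is isotropic, and it determines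
the positive unit tangent vector of the fibre. -/
theorem grad_chart {π : Sph 3 → Sph 2} (hπ : IsConformalSubmersion π) (x : Sph 3) {ε : ℝ}
    (hε : ε ^ 2 = 1) (hm : 1 + ε * (π x : E3) 2 ≠ 0) :
    grad (chart ε π) x ≠ 0 ∧ grad (chart ε π) x ⬝ᵥ grad (chart ε π) x = 0 ∧
      grad (chart ε π) x ⬝ᵥ cx x = 0 ∧
      ∀ T, IsPositiveUnitTangent π x T ↔ IsNormalTo x T (grad (chart ε π) x) := by
  obtain ⟨A, B, r, hr, hxA, hxB, hAB, hAA, hBB, hd, hT⟩ := exists_frame hπ x hε hm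
  have hr' : (r : ℂ) ≠ 0 := by exact_mod_cast hr.ne'
  set w := cx A + Complex.I • cx B with hw
  have hg : grad (chart ε π) x = (r : ℂ)⁻¹ • w := by
    ext i
    rw [grad, hd]
    have e : ∀ A : E4, inner ℝ A (EuclideanSpace.single i (1 : ℝ)) = A i := by
      intro A
      rw [inner_E4]
      fin_cases i <;> simp
    rw [e, e, hw]
    simp [cx]
    field_simp
  have hre : reV w = A := by ext i; simp [hw, reV, cx]
  have him : imV w = B := by ext i; simp [hw, imV, cx]
  have hww : w ⬝ᵥ w = 0 := by
    apply Complex.ext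
    · rw [dot_self_re, hre, him, hAA, hBB]; simp
    · rw [dot_self_im, hre, him, hAB]; simp
  have hwv : ∀ v : E4, w ⬝ᵥ cx v = 0 ↔ inner ℝ A v = 0 ∧ inner ℝ B v = 0 := by
    intro v
    rw [Complex.ext_iff, dot_cx_re, dot_cx_im, hre, him]
    simp
  rw [hg]
  refine ⟨?_, by simp [hww], ?_, fun T => ?_⟩
  · refine smul_ne_zero (inv_ne_zero hr') fun h => ?_
    rw [h] at hre
    have : A = 0 := by rw [← hre]; ext i; simp [reV]
    rw [this] at hAA
    simp at hAA
    exact hr.ne hAA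
  · have : w ⬝ᵥ cx x = 0 := (hwv x).2 ⟨by rw [real_inner_comm, hxA], by rw [real_inner_comm, hxB]⟩
    simp [this]
  · rw [isNormalTo_smul (inv_ne_zero hr'), hT, IsNormalTo, hwv, hre, him, and_assoc]

/-! ### Clifford multiplication and tangent lines -/

/-- Left multiplication by the quaternion `a`, on `ℍ = ℂ²`, extended to be complex linear in
`a ∈ ℂ⁴`. -/
def cliff (a : Fin 4 → ℂ) : Matrix (Fin 2) (Fin 2) ℂ :=
  !![a 0 + Complex.I * a 1, -a 2 + Complex.I * a 3; a 2 + Complex.I * a 3, a 0 - Complex.I * a 1]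

/-- Left multiplication by the conjugate of the quaternion `a`, extended to `a ∈ ℂ⁴`. -/
def cliffT (a : Fin 4 → ℂ) : Matrix (Fin 2) (Fin 2) ℂ :=
  !![a 0 - Complex.I * a 1, a 2 - Complex.I * a 3; -a 2 - Complex.I * a 3, a 0 + Complex.I * a 1]

/-- The Clifford relation. -/
theorem cliffT_cliff (a b : Fin 4 → ℂ) :
    cliffT a * cliff b + cliffT b * cliff a = (2 * a ⬝ᵥ b) • (1 : Matrix (Fin 2) (Fin 2) ℂ) := by
  ext i j
  fin_cases i <;> fin_cases j <;> simp [cliff, cliffT, dot4] <;> first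
    | ring1
    | linear_combination (-2 * a 1 * b 1 - 2 * a 3 * b 3) * Complex.I_sq

@[simp] theorem toQuat_re (x : E4) : (toQuat x).re = x 0 := rfl
@[simp] theorem toQuat_imI (x : E4) : (toQuat x).imI = x 1 := rfl
@[simp] theorem toQuat_imJ (x : E4) : (toQuat x).imJ = x 2 := rfl
@[simp] theorem toQuat_imK (x : E4) : (toQuat x).imK = -x 3 := rfl
@[simp] theorem qI_re : qI.re = 0 := rfl
@[simp] theorem qI_imI : qI.imI = 1 := rfl
@[simp] theorem qI_imJ : qI.imJ = 0 := rfl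
@[simp] theorem qI_imK : qI.imK = 0 := rfl

/-- The quaternion `z₁ + j z₂`. -/
def quatOf (q : Fin 2 → ℂ) : ℍ[ℝ] := ⟨(q 0).re, (q 0).im, (q 1).re, -(q 1).im⟩

@[simp] theorem quatOf_re (q : Fin 2 → ℂ) : (quatOf q).re = (q 0).re := rfl
@[simp] theorem quatOf_imI (q : Fin 2 → ℂ) : (quatOf q).imI = (q 0).im := rfl
@[simp] theorem quatOf_imJ (q : Fin 2 → ℂ) : (quatOf q).imJ = (q 1).re := rfl
@[simp] theorem quatOf_imK (q : Fin 2 → ℂ) : (quatOf q).imK = -(q 1).im := rfl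

/-- The Gram determinant of an orthogonal frame of `ℝ⁴`. -/
theorem det4_sq {x T A B : E4} {r : ℝ} (hx : inner ℝ x x = 1) (hT : inner ℝ T T = 1)
    (hA : inner ℝ A A = r) (hB : inner ℝ B B = r) (hxT : inner ℝ x T = 0) (hxA : inner ℝ x A = 0)
    (hxB : inner ℝ x B = 0) (hTA : inner ℝ T A = 0) (hTB : inner ℝ T B = 0)
    (hAB : inner ℝ A B = 0) : det4 x T A B ^ 2 = r ^ 2 := by
  have h : (Matrix.of fun i j : Fin 4 => (![x, T, A, B] i) j) *
      (Matrix.of fun i j : Fin 4 => (![x, T, A, B] i) j)ᵀ =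
      Matrix.diagonal ![1, 1, r, r] := by
    rw [inner_E4] at *
    ext i j
    fin_cases i <;> fin_cases j <;> simp [Matrix.mul_apply, Fin.sum_univ_succ] <;> linarith
  have h2 := congrArg Matrix.det h
  rw [Matrix.det_mul, Matrix.det_transpose, Matrix.det_diagonal] at h2
  simp [Fin.prod_univ_succ] at h2
  rw [det4]
  linarith

/-- In terms of quaternions, the normalised fourth vector of an orthogonal frame `x, T, A, B` of
`ℝ⁴` is `T = -x B̄ A`. -/
theorem toQuat_normal {x T A B : E4} {r : ℝ} (hx : inner ℝ x x = 1) (hT : inner ℝ T T = 1)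
    (hA : inner ℝ A A = r) (hB : inner ℝ B B = r) (hxT : inner ℝ x T = 0) (hxA : inner ℝ x A = 0)
    (hxB : inner ℝ x B = 0) (hTA : inner ℝ T A = 0) (hTB : inner ℝ T B = 0)
    (hAB : inner ℝ A B = 0) (hpos : 0 < det4 x T A B) :
    r • toQuat T = -(toQuat x * star (toQuat B) * toQuat A) := by
  have hr : 0 ≤ r := by rw [← hA]; exact real_inner_self_nonneg
  have hdet : det4 x T A B = r := by
    have := det4_sq hx hT hA hB hxT hxA hxB hTA hTB hAB
    rcases sq_eq_sq_iff_eq_or_eq_neg.1 this with h | h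
    · exact h
    · linarith
  set Q := -(toQuat x * star (toQuat B) * toQuat A) with hQ
  have hn : ∀ v : E4, Quaternion.normSq (toQuat v) = inner ℝ v v := by
    intro v
    rw [Quaternion.normSq_def', inner_E4]
    simp [toQuat]
    ring
  have hQn : Quaternion.normSq Q = r ^ 2 := by
    rw [hQ, Quaternion.normSq_neg, map_mul, map_mul, Quaternion.normSq_star, hn, hn, hn, hx, hA, hB]
    ring
  have hQT : Q.re * T 0 + Q.imI * T 1 + Q.imJ * T 2 - Q.imK * T 3 = r := by
    rw [← hdet, hQ, det4_eq]
    rw [inner_E4] at hxT hxA hxB hTA hTB hAB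
    simp
    linear_combination -(T 0 * A 0 + T 1 * A 1 + T 2 * A 2 + T 3 * A 3) * hxB
      - (x 0 * T 0 + x 1 * T 1 + x 2 * T 2 + x 3 * T 3) * hAB
      + (T 0 * B 0 + T 1 * B 1 + T 2 * B 2 + T 3 * B 3) * hxA
  have : Quaternion.normSq (r • toQuat T - Q) = 0 := by
    rw [inner_E4] at hT
    rw [Quaternion.normSq_def'] at hQn ⊢
    have e : (r • toQuat T).re = r * T 0 ∧ (r • toQuat T).imI = r * T 1 ∧
        (r • toQuat T).imJ = r * T 2 ∧ (r • toQuat T).imK = r * -T 3 := ⟨rfl, rfl, rfl, rfl⟩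
    simp only [Quaternion.re_sub, Quaternion.imI_sub, Quaternion.imJ_sub, Quaternion.imK_sub, e]
    linear_combination hQn - 2 * r * hQT + r ^ 2 * hT
  rw [Quaternion.normSq_eq_zero, sub_eq_zero] at this
  exact this

/-- In the coordinates of `ℂ⁴`, left multiplication by `x ∈ ℝ⁴ = ℍ` is `cliff x`. -/
theorem toC4_eq_iff (x : E4) (l : ℍ[ℝ]) (ψ : Fin 4 → ℂ) : toC4 (toQuat x * l) l = ψ ↔
    l = quatOf ![ψ 2, ψ 3] ∧ ![ψ 0, ψ 1] = cliff (cx x) *ᵥ ![ψ 2, ψ 3] := by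
  rw [Quaternion.ext_iff, funext_iff, funext_iff]
  simp [Fin.forall_fin_succ, toC4, cliff, Complex.ext_iff, cx]
  constructor
  · rintro ⟨⟨a, b⟩, ⟨c, d⟩, ⟨e, f⟩, g, h⟩
    have h' : l.imK = -(ψ 3).im := by linarith
    rw [e, f, g, h'] at a b c d
    refine ⟨⟨e, f, g, h'⟩, ⟨?_, ?_⟩, ?_, ?_⟩ <;> linarith
  · rintro ⟨⟨e, f, g, h⟩, ⟨a, b⟩, c, d⟩
    rw [e, f, g, h]
    refine ⟨⟨?_, ?_⟩, ⟨?_, ?_⟩, ⟨rfl, rfl⟩, rfl, ?_⟩ <;> linarith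

/-- The equations of `e_T` in terms of an isotropic vector `w` to which `T` is normal. As
`T = -x B̄ A`, up to a factor, where `w = A + i B`, the condition `μ λ = λ i` on `μ = x⁻¹ T` reads
`(A + B i) λ = 0` with `i` acting from the right, that is `cliff w` kills `λ`. -/
theorem mem_tangentLine_iff {x : Sph 3} {T : E4} {w : Fin 4 → ℂ} (hww : w ⬝ᵥ w = 0)
    (hwx : w ⬝ᵥ cx x = 0) (h : IsNormalTo x T w) (ψ : Fin 4 → ℂ) :
    ψ ∈ tangentLine x T ↔
      ![ψ 0, ψ 1] = cliff (cx x) *ᵥ ![ψ 2, ψ 3] ∧ cliff w *ᵥ ![ψ 2, ψ 3] = 0 := by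
  obtain ⟨hT, hxT, hwT, hdet⟩ := h
  set A := reV w with hA
  set B := imV w with hB
  have hTT : inner ℝ T T = 1 := by rw [real_inner_self_eq_norm_sq, hT, one_pow]
  have hxx : inner ℝ (x : E4) (x : E4) = 1 := by
    rw [real_inner_self_eq_norm_sq, x.norm_eq, one_pow]
  have e1 := dot_self_re w
  have e2 := dot_self_im w
  have e3 := dot_cx_re w x
  have e4 := dot_cx_im w x
  have e5 := dot_cx_re w T
  have e6 := dot_cx_im w T
  rw [hww] at e1 e2
  rw [hwx] at e3 e4
  rw [hwT] at e5 e6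
  simp only [Complex.zero_re, Complex.zero_im] at e1 e2 e3 e4 e5 e6
  set r := inner ℝ A A with hr
  have key := toQuat_normal hxx hTT rfl (by linarith) hxT (by rw [real_inner_comm]; exact e3.symm)
    (by rw [real_inner_comm]; exact e4.symm) (by rw [real_inner_comm]; exact e5.symm)
    (by rw [real_inner_comm]; exact e6.symm) (by linarith) hdet
  have hr0 : r ≠ 0 := by
    intro h0
    rw [hr, inner_self_eq_zero] at h0
    rw [h0] at hdet
    simp [det4_eq] at hdet
  have hX : toQuat x ≠ 0 := by
    intro h0
    rw [h0] at key
    rw [zero_mul, zero_mul, neg_zero, smul_eq_zero, or_iff_right hr0] at key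
    rw [inner_E4] at hTT
    have := congrArg (fun q : ℍ[ℝ] => (q.re, q.imI, q.imJ, q.imK)) key
    simp [toQuat] at this
    simp [this] at hTT
  have hBB : toQuat B * star (toQuat B) = (r : ℍ[ℝ]) := by
    rw [Quaternion.self_mul_star]
    congr 1
    rw [Quaternion.normSq_def', show r = inner ℝ B B by linarith, inner_E4]
    simp [toQuat]
    ring
  have hB0 : toQuat B ≠ 0 := by
    intro h0
    rw [h0, zero_mul] at hBB
    exact hr0 (congrArg QuaternionAlgebra.re hBB.symm)
  -- the defining condition of the tangent line, cleared of `T`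
  have cond : ∀ l : ℍ[ℝ], ((toQuat x)⁻¹ * toQuat T) * l = l * qI ↔
      toQuat A * l + toQuat B * (l * qI) = 0 := by
    intro l
    have h1 : (toQuat x)⁻¹ * toQuat T = -(r⁻¹ • (star (toQuat B) * toQuat A)) := by
      have : toQuat T = r⁻¹ • -(toQuat x * star (toQuat B) * toQuat A) := by
        rw [← key, smul_smul, inv_mul_cancel₀ hr0, one_smul]
      rw [this, smul_neg, mul_neg, mul_smul_comm, mul_assoc, ← mul_assoc, inv_mul_cancel₀ hX,
        one_mul]
    rw [h1, ← mul_right_inj' hB0]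
    have h2 : toQuat B * (-(r⁻¹ • (star (toQuat B) * toQuat A)) * l) = -(toQuat A * l) := by
      rw [neg_mul, mul_neg, smul_mul_assoc, mul_smul_comm, mul_assoc, ← mul_assoc (toQuat B), hBB,
        Quaternion.coe_mul_eq_smul, smul_smul, inv_mul_cancel₀ hr0, one_smul]
    rw [h2, neg_eq_iff_eq_neg, eq_neg_iff_add_eq_zero]
  have hw : ∀ i, w i = ⟨A i, B i⟩ := fun i => rfl
  have cond2 : ∀ q0 q1 : ℂ, toQuat A * quatOf ![q0, q1] + toQuat B * (quatOf ![q0, q1] * qI) = 0 ↔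
      cliff w *ᵥ ![q0, q1] = 0 := by
    intro q0 q1
    rw [Quaternion.ext_iff, funext_iff]
    simp [Fin.forall_fin_succ, cliff, Complex.ext_iff, hw]
    constructor
    · rintro ⟨a, b, c, d⟩
      refine ⟨⟨?_, ?_⟩, ?_, ?_⟩ <;> linarith
    · rintro ⟨⟨a, b⟩, c, d⟩
      refine ⟨?_, ?_, ?_, ?_⟩ <;> linarith
  constructor
  · rintro ⟨l, hl, hψ⟩
    obtain ⟨rfl, h2⟩ := (toC4_eq_iff _ l ψ).1 hψ.symm
    exact ⟨h2, (cond2 _ _).1 ((cond _).1 hl)⟩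
  · rintro ⟨h1, h2⟩
    exact ⟨quatOf ![ψ 2, ψ 3], (cond _).2 ((cond2 _ _).2 h2),
      ((toC4_eq_iff _ _ ψ).2 ⟨rfl, h1⟩).symm⟩

/-! ### Complex covectors on `ℝ⁴` -/

/-- The real linear map `ℝ⁴ → ℂ` given by a complex covector. -/
def dotL (a : Fin 4 → ℂ) : E4 →ₗ[ℝ] ℂ where
  toFun v := a ⬝ᵥ cx v
  map_add' x y := by rw [cx_add, dotProduct_add]
  map_smul' t x := by rw [cx_smul, dotProduct_smul, Complex.real_smul, smul_eq_mul]; rfl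

theorem dotL_apply (a : Fin 4 → ℂ) (v : E4) : dotL a v = a ⬝ᵥ cx v := rfl

theorem star_dot_cx (a : Fin 4 → ℂ) (v : E4) : star a ⬝ᵥ cx v = star (a ⬝ᵥ cx v) := by
  simp [dot4, cx]

/-- A complex covector is determined by its values on `ℝ⁴`. -/
theorem ext_dot_cx {a b : Fin 4 → ℂ} (h : ∀ v : E4, a ⬝ᵥ cx v = b ⬝ᵥ cx v) : a = b := by
  funext i
  have := h (EuclideanSpace.single i 1)
  rw [dot4, dot4] at this
  fin_cases i <;> simpa [cx] using this

/-- An isotropic covector is conformal on the plane spanned by its real and imaginary part. -/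
theorem exists_dot_eq {w : Fin 4 → ℂ} (hw : w ⬝ᵥ w = 0) (hw0 : w ≠ 0) (ζ : ℂ) :
    ∃ v : E4, w ⬝ᵥ cx v = ζ ∧ ∀ x : E4, w ⬝ᵥ cx x = 0 → inner ℝ x v = 0 := by
  set r := inner ℝ (reV w) (reV w) with hr
  have h1 := dot_self_re w
  have h2 := dot_self_im w
  rw [hw] at h1 h2
  simp only [Complex.zero_re, Complex.zero_im] at h1 h2
  have hBB : inner ℝ (imV w) (imV w) = r := by linarith
  have hAB : inner ℝ (reV w) (imV w) = 0 := by linarith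
  have hBA : inner ℝ (imV w) (reV w) = 0 := by rw [real_inner_comm, hAB]
  have hr0 : r ≠ 0 := by
    intro h
    rw [h] at hBB
    rw [hr, inner_self_eq_zero] at h
    rw [inner_self_eq_zero] at hBB
    apply hw0
    rw [reV_add_imV w, h, hBB]
    simp
  refine ⟨(ζ.re / r) • reV w + (ζ.im / r) • imV w, ?_, fun x hx => ?_⟩
  · apply Complex.ext
    · rw [dot_cx_re, inner_add_right, inner_smul_right, inner_smul_right, hAB, ← hr]
      field_simp
      ring
    · rw [dot_cx_im, inner_add_right, inner_smul_right, inner_smul_right, hBA, hBB]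
      field_simp
      ring
  · have h1 := dot_cx_re w x
    have h2 := dot_cx_im w x
    rw [hx, real_inner_comm] at h1 h2
    simp only [Complex.zero_re, Complex.zero_im] at h1 h2
    rw [inner_add_right, inner_smul_right, inner_smul_right, ← h1, ← h2]
    simp

theorem surjective_dotL_add {w : Fin 4 → ℂ} (hw : w ⬝ᵥ w = 0) (hw0 : w ≠ 0) {x : E4}
    (hwx : w ⬝ᵥ cx x = 0) {f : ℂ} (hf : f ≠ 0) (c : ℂ) :
    Function.Surjective (dotL (f • w + c • cx x)) := by
  intro ζ
  obtain ⟨v, hv, hv'⟩ := exists_dot_eq hw hw0 (ζ / f)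
  refine ⟨v, ?_⟩
  rw [dotL_apply, add_dotProduct, smul_dotProduct, smul_dotProduct, hv, cx_dot_cx, hv' x hwx]
  simp [mul_div_cancel₀ _ hf]

theorem surjective_dotL {w : Fin 4 → ℂ} (hw : w ⬝ᵥ w = 0) (hw0 : w ≠ 0) :
    Function.Surjective (dotL w) := by
  have := surjective_dotL_add hw hw0 (x := 0) (by simp) one_ne_zero 0
  simpa using this

theorem finrank_ker_dotL {a : Fin 4 → ℂ} (ha : Function.Surjective (dotL a)) :
    Module.finrank ℝ (LinearMap.ker (dotL a)) = 2 := by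
  have h := LinearMap.finrank_range_add_finrank_ker (dotL a)
  rw [LinearMap.range_eq_top.2 ha, finrank_top, Complex.finrank_real_complex,
    finrank_euclideanSpace_fin] at h
  omega

theorem eq_ker_dotL {a : Fin 4 → ℂ} (ha : Function.Surjective (dotL a)) {V : Submodule ℝ E4}
    (hV : Module.finrank ℝ V = 2) (h : ∀ v ∈ V, a ⬝ᵥ cx v = 0) : V = LinearMap.ker (dotL a) :=
  Submodule.eq_of_le_of_finrank_eq (fun v hv => h v hv) (by rw [hV, finrank_ker_dotL ha])

/-- A covector which vanishes on the kernel of `g` is a combination of `g` and its conjugate. -/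
theorem exists_comb {g e : Fin 4 → ℂ} (hg : Function.Surjective (dotL g))
    (h : ∀ v : E4, g ⬝ᵥ cx v = 0 → e ⬝ᵥ cx v = 0) : ∃ α β : ℂ, e = α • g + β • star g := by
  obtain ⟨v, hv⟩ := hg 1
  obtain ⟨v', hv'⟩ := hg Complex.I
  rw [dotL_apply] at hv hv'
  refine ⟨(e ⬝ᵥ cx v - Complex.I * e ⬝ᵥ cx v') / 2, (e ⬝ᵥ cx v + Complex.I * e ⬝ᵥ cx v') / 2,
    ext_dot_cx fun y => ?_⟩
  have h1 := h (y - (g ⬝ᵥ cx y).re • v - (g ⬝ᵥ cx y).im • v') (by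
    rw [cx_sub, cx_sub, cx_smul, cx_smul, dotProduct_sub, dotProduct_sub, dotProduct_smul,
      dotProduct_smul, hv, hv']
    apply Complex.ext <;> simp)
  rw [cx_sub, cx_sub, cx_smul, cx_smul, dotProduct_sub, dotProduct_sub, dotProduct_smul,
      dotProduct_smul] at h1
  rw [add_dotProduct, smul_dotProduct, smul_dotProduct, star_dot_cx]
  generalize g ⬝ᵥ cx y = z at h1 ⊢
  have hz : z = z.re + z.im * Complex.I := (Complex.re_add_im z).symm
  have hz' : star z = z.re - z.im * Complex.I := by apply Complex.ext <;> simp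
  rw [hz']
  nth_rewrite 1 [hz]
  simp only [smul_eq_mul] at h1 ⊢
  linear_combination h1 + z.im * (e ⬝ᵥ cx v') * Complex.I_sq

open scoped ComplexOrder in
theorem dot_star_self_ne_zero {g : Fin 4 → ℂ} (hg : g ≠ 0) : g ⬝ᵥ star g ≠ 0 := by
  rw [Ne, dotProduct_comm, dotProduct_star_self_eq_zero]
  exact hg

/-! ### The linear form representing a fibre -/

/-- The affine complex linear form `y ↦ a · y - c` represents the oriented fibre of `π` over `p`: it
vanishes on `S³` exactly along the fibre, and its differential along the fibre is a complex multiple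
of the differential of the coordinate `stereo ε ∘ π`. -/
structure Rep (ε : ℝ) (π : Sph 3 → Sph 2) (p : Sph 2) (a : Fin 4 → ℂ) (c : ℂ) : Prop where
  fibre : ∀ y : Sph 3, π y = p ↔ a ⬝ᵥ cx y = c
  pos : ∀ y : Sph 3, π y = p → ∃ f : ℂ, f ≠ 0 ∧ a - c • cx y = f • grad (chart ε π) y

theorem Sph3.inner_self (x : Sph 3) : inner ℝ (x : E4) (x : E4) = 1 := by
  rw [real_inner_self_eq_norm_sq, x.norm_eq, one_pow]

theorem Sph3.inner_lt_one {x y : Sph 3} (h : x ≠ y) : inner ℝ (x : E4) (y : E4) < 1 := by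
  refine (inner_lt_one_iff_real_of_norm_eq_one x.norm_eq y.norm_eq).2 fun h' => h (Subtype.ext h')

/-- The second intersection point of `S³` with the line through `x` in direction `d`. -/
def second (x d : E4) : E4 := x - (2 * inner ℝ x d / inner ℝ d d) • d

theorem second_mem (x : Sph 3) {d : E4} (hd : d ≠ 0) :
    second x d ∈ Metric.sphere (0 : E4) 1 := by
  have h : inner ℝ d d ≠ (0 : ℝ) := inner_self_ne_zero.2 hd
  have h1 : inner ℝ (second x d) (second x d) = (1 : ℝ) := by
    rw [second, inner_sub_left, inner_sub_right, inner_sub_right, inner_smul_left,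
      inner_smul_right, inner_smul_left, inner_smul_right, Sph3.inner_self,
      real_inner_comm (x : E4)]
    simp only [conj_trivial]
    field_simp
    ring
  rw [mem_sphere_zero_iff_norm]
  rw [real_inner_self_eq_norm_sq] at h1
  nlinarith [norm_nonneg (second (x : E4) d)]

theorem second_sub (x y : Sph 3) (h : x ≠ y) : second x ((y : E4) - x) = y := by
  have h1 := Sph3.inner_lt_one h
  have h2 : inner ℝ ((y : E4) - x) ((y : E4) - x) = 2 * (1 - inner ℝ (x : E4) (y : E4)) := by
    rw [inner_sub_left, inner_sub_right, inner_sub_right, Sph3.inner_self, Sph3.inner_self,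
      real_inner_comm (x : E4)]
    ring
  have h3 : (2 * inner ℝ (x : E4) ((y : E4) - x) /
       inner ℝ ((y : E4) - x) ((y : E4) - x) : ℝ) = -1 := by
    rw [h2, inner_sub_right, Sph3.inner_self, div_eq_iff (by linarith)]
    ring
  rw [second, h3]
  simp

section circle

variable {π : Sph 3 → Sph 2} {p : Sph 2} {P : AffineSubspace ℝ E4}

theorem second_mem_fibre (hP : π ⁻¹' {p} = {x : Sph 3 | (x : E4) ∈ P}) {x : Sph 3} (hx : π x = p)
    {d : E4} (hd : d ∈ P.direction) (hd0 : d ≠ 0) : π ⟨second x d, second_mem x hd0⟩ = p := by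
  have hxP : x ∈ {x : Sph 3 | (x : E4) ∈ P} := by rw [← hP]; exact hx
  have : (⟨second x d, second_mem x hd0⟩ : Sph 3) ∈ {x : Sph 3 | (x : E4) ∈ P} := by
    change x - _ • d ∈ P
    rw [sub_eq_neg_add, ← neg_smul]
    exact AffineSubspace.vadd_mem_of_mem_direction (P.direction.smul_mem _ hd) hxP
  rw [← hP] at this
  exact this

theorem sub_mem_direction (hP : π ⁻¹' {p} = {x : Sph 3 | (x : E4) ∈ P}) {x y : Sph 3}
    (hx : π x = p) (hy : π y = p) : (y : E4) - x ∈ P.direction := by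
  have hxP : x ∈ {x : Sph 3 | (x : E4) ∈ P} := by rw [← hP]; exact hx
  have hyP : y ∈ {x : Sph 3 | (x : E4) ∈ P} := by rw [← hP]; exact hy
  exact AffineSubspace.vsub_mem_direction hyP hxP

/-- The plane of a circle is spanned by a chord from `x` and a tangent vector at `x`. -/
theorem exists_tangent (hV : Module.finrank ℝ P.direction = 2)
    (hP : π ⁻¹' {p} = {x : Sph 3 | (x : E4) ∈ P}) {x x' : Sph 3} (hx : π x = p) (hx' : π x' = p)
    (hne : x ≠ x') : ∃ t ∈ P.direction, t ≠ 0 ∧ inner ℝ (x : E4) t = 0 ∧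
      P.direction = Submodule.span ℝ {t, (x' : E4) - x} := by
  set u : E4 := x' - x with hu
  have huV : u ∈ P.direction := sub_mem_direction hP hx hx'
  have hxu : inner ℝ (x : E4) u ≠ 0 := by
    rw [hu, inner_sub_right, Sph3.inner_self]
    linarith [Sph3.inner_lt_one hne]
  have hu0 : u ≠ 0 := by rintro h; rw [h] at hxu; simp at hxu
  -- a vector of the plane outside the line spanned by `u`
  obtain ⟨e, heV, he⟩ : ∃ e ∈ P.direction, e ∉ Submodule.span ℝ {u} := by
    by_contra! h
    have := Submodule.finrank_mono (show P.direction ≤ Submodule.span ℝ {u} from h)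
    rw [hV, finrank_span_singleton hu0] at this
    omega
  set t : E4 := (inner ℝ (x : E4) u : ℝ) • e - (inner ℝ (x : E4) e : ℝ) • u with ht
  have htV : t ∈ P.direction :=
    P.direction.sub_mem (P.direction.smul_mem _ heV) (P.direction.smul_mem _ huV)
  have ht0 : t ≠ 0 := by
    intro h
    apply he
    rw [ht, sub_eq_zero] at h
    rw [Submodule.mem_span_singleton]
    refine ⟨(inner ℝ (x : E4) u)⁻¹ * inner ℝ (x : E4) e, ?_⟩
    rw [mul_smul, ← h, smul_smul, inv_mul_cancel₀ hxu, one_smul]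
  have hxt : inner ℝ (x : E4) t = 0 := by
    rw [ht, inner_sub_right, inner_smul_right, inner_smul_right]
    ring
  refine ⟨t, htV, ht0, hxt, ?_⟩
  have hli : LinearIndependent ℝ ![t, u] := by
    rw [LinearIndependent.pair_iff]
    intro a b hab
    have h1 := congrArg (fun v => inner ℝ (x : E4) v) hab
    simp only [inner_add_right, inner_smul_right, hxt, mul_zero, zero_add, inner_zero_right,
      mul_eq_zero, hxu, or_false] at h1
    rw [h1, zero_smul, add_zero, smul_eq_zero, or_iff_left ht0] at hab
    exact ⟨hab, h1⟩
  symm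
  refine Submodule.eq_of_le_of_finrank_eq ?_ ?_
  · rw [Submodule.span_le]
    rintro v (rfl | rfl)
    · exact htV
    · exact huV
  · rw [hV]
    have := finrank_span_eq_card hli
    rw [Matrix.range_cons_cons_empty, Fintype.card_fin] at this
    exact this

theorem chart_coe (ε : ℝ) (x : Sph 3) : chart ε π x = stereo ε (π x) := by
  rw [chart, ext_coe]

/-- The differential of the coordinate vanishes along the circle. -/
theorem grad_dot_tangent (hπ : ContMDiff (𝓡 3) (𝓡 2) ∞ π) {ε : ℝ} (hm : 1 + ε * (p : E3) 2 ≠ 0)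
    (hP : π ⁻¹' {p} = {x : Sph 3 | (x : E4) ∈ P}) {x x' : Sph 3} (hx : π x = p) (hx' : π x' = p)
    (hne : x ≠ x') {t : E4} (ht : t ∈ P.direction) (hxt : inner ℝ (x : E4) t = 0) :
    grad (chart ε π) x ⬝ᵥ cx t = 0 := by
  rcases eq_or_ne t 0 with rfl | ht0
  · simp
  set u : E4 := x' - x with hu
  have huV : u ∈ P.direction := sub_mem_direction hP hx hx'
  have hxu : inner ℝ (x : E4) u ≠ 0 := by
    rw [hu, inner_sub_right, Sph3.inner_self]
    linarith [Sph3.inner_lt_one hne]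
  have htt : inner ℝ t t ≠ (0 : ℝ) := inner_self_ne_zero.2 ht0
  -- the curve `s ↦ second x (t + s u)` in the fibre passes through `x` in direction `t`
  have hlin : HasDerivAt (fun s : ℝ => t + s • u) u 0 := by
    simpa using ((hasDerivAt_id (0 : ℝ)).smul_const u).const_add t
  have hnum : HasDerivAt (fun s : ℝ => 2 * inner ℝ (x : E4) (t + s • u))
      (2 * inner ℝ (x : E4) u) 0 := by
    have := ((hasDerivAt_const (0 : ℝ) (x : E4)).inner ℝ hlin).const_mul 2
    simpa using this
  have hden := hlin.inner ℝ hlin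
  have hq := hnum.fun_div hden (by simpa using htt)
  have hc := (hq.smul hlin).const_sub (x : E4)
  have hsec : HasDerivAt (fun s : ℝ => second x (t + s • u))
      (-((2 * inner ℝ (x : E4) u / inner ℝ t t) • t)) 0 := by
    refine hc.congr_deriv ?_
    simp [hxt]
    have : ‖t‖ ≠ 0 := norm_ne_zero_iff.2 ht0
    congr 1
    field_simp
  have h0 : second (x : E4) (t + (0 : ℝ) • u) = x := by simp [second, hxt]
  have hm' : 1 + ε * ext π x 2 ≠ 0 := by rwa [ext_coe, hx]
  have hd := ((contDiffAt_chart hπ x.ne_zero hm').differentiableAt (by simp)).hasFDerivAt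
  have h1 : HasDerivAt (fun s : ℝ => chart ε π (second x (t + s • u)))
      (fderiv ℝ (chart ε π) x (-((2 * inner ℝ (x : E4) u / inner ℝ t t) • t))) 0 := by
    refine HasFDerivAt.comp_hasDerivAt (f := fun s : ℝ => second x (t + s • u)) (l := chart ε π)
      (0 : ℝ) ?_ hsec
    rw [h0]
    exact hd
  have h2 : HasDerivAt (fun s : ℝ => chart ε π (second x (t + s • u))) 0 0 := by
    refine (hasDerivAt_const (0 : ℝ) (stereo ε p)).congr_of_eventuallyEq ?_
    have : ∀ᶠ s : ℝ in nhds 0, t + s • u ≠ 0 := by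
      refine hlin.continuousAt.eventually_ne ?_
      simpa using ht0
    filter_upwards [this] with s hs
    have h3 := second_mem_fibre hP hx (P.direction.add_mem ht (P.direction.smul_mem s huV)) hs
    have h4 := chart_coe (π := π) ε ⟨second x (t + s • u), second_mem x hs⟩
    rw [h3] at h4
    exact h4
  have h3 := h1.unique h2
  rw [map_neg, map_smul, neg_eq_zero, smul_eq_zero, fderiv_eq_grad] at h3
  refine h3.resolve_left ?_
  positivity

end circle

/-- An isotropic covector with the same two-dimensional real kernel as the isotropic covector `g` is
a multiple of `g` or of its conjugate. -/
theorem comb_of_isotropic {g w : Fin 4 → ℂ} (hg : g ⬝ᵥ g = 0) (hg0 : g ≠ 0) (hw : w ⬝ᵥ w = 0)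
    {y t : E4} (ht0 : t ≠ 0) (hyy : inner ℝ y y = 1) (hyt : inner ℝ y t = 0)
    (hgy : g ⬝ᵥ cx y = 0) (hgt : g ⬝ᵥ cx t = 0) (hwy : w ⬝ᵥ cx y = 0) (hwt : w ⬝ᵥ cx t = 0) :
    ∃ α β : ℂ, w = α • g + β • star g ∧ α * β = 0 := by
  have hli : LinearIndependent ℝ ![y, t] := by
    rw [LinearIndependent.pair_iff]
    intro a b hab
    have h1 := congrArg (fun v => inner ℝ y v) hab
    simp only [inner_add_right, inner_smul_right, hyt, hyy, mul_zero, add_zero, inner_zero_right,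
      mul_one] at h1
    rw [h1, zero_smul, zero_add, smul_eq_zero, or_iff_left ht0] at hab
    exact ⟨h1, hab⟩
  have hs : Submodule.span ℝ {y, t} = LinearMap.ker (dotL g) := by
    refine eq_ker_dotL (surjective_dotL hg hg0) ?_ ?_
    · have := finrank_span_eq_card hli
      rw [Matrix.range_cons_cons_empty, Fintype.card_fin] at this
      exact this
    · intro v hv
      obtain ⟨a, b, rfl⟩ := Submodule.mem_span_pair.1 hv
      rw [cx_add, cx_smul, cx_smul, dotProduct_add, dotProduct_smul, dotProduct_smul, hgy, hgt]
      simp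
  obtain ⟨α, β, h⟩ := exists_comb (e := w) (surjective_dotL hg hg0) (by
    intro v hv
    have hv' : v ∈ LinearMap.ker (dotL g) := hv
    rw [← hs] at hv'
    obtain ⟨a, b, rfl⟩ := Submodule.mem_span_pair.1 hv'
    rw [cx_add, cx_smul, cx_smul, dotProduct_add, dotProduct_smul, dotProduct_smul, hwy, hwt]
    simp)
  refine ⟨α, β, h, ?_⟩
  have hgs : star g ⬝ᵥ star g = 0 := by
    rw [Matrix.star_dotProduct_star, hg, star_zero]
  rw [h, add_dotProduct, dotProduct_add, dotProduct_add] at hw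
  simp only [smul_dotProduct, dotProduct_smul, hg, hgs, dotProduct_comm (star g) g,
    smul_eq_mul, mul_zero, zero_add, add_zero] at hw
  have := dot_star_self_ne_zero hg0
  have h2 : (α * β) * (g ⬝ᵥ star g) = 0 := by linear_combination hw / 2
  exact (mul_eq_zero.1 h2).resolve_right this

theorem contDiffAt_grad {f : E4 → ℂ} {x : E4} (hf : ContDiffAt ℝ ∞ f x) :
    ContDiffAt ℝ ∞ (grad f) x := by
  rw [contDiffAt_pi]
  intro i
  exact (hf.fderiv_right (m := ∞) (by simp)).clm_apply contDiffAt_const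

theorem continuous_cx : Continuous cx :=
  continuous_pi fun i => Complex.continuous_ofReal.comp (EuclideanSpace.proj (𝕜 := ℝ) i).continuous

theorem isotropic_sub {a : Fin 4 → ℂ} {c : ℂ} (ha : a ⬝ᵥ a = c ^ 2) {y : Sph 3}
    (hy : a ⬝ᵥ cx y = c) : (a - c • cx y) ⬝ᵥ (a - c • cx y) = 0 := by
  rw [sub_dotProduct, dotProduct_sub, dotProduct_sub, smul_dotProduct, dotProduct_smul,
    smul_dotProduct, dotProduct_smul, dotProduct_comm (cx y) a, cx_dot_cx, Sph3.inner_self, ha, hy]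
  simp only [smul_eq_mul, Complex.ofReal_one]
  ring

theorem sub_dot_self {a : Fin 4 → ℂ} {c : ℂ} {y : Sph 3} (hy : a ⬝ᵥ cx y = c) :
    (a - c • cx y) ⬝ᵥ cx y = 0 := by
  rw [sub_dotProduct, smul_dotProduct, cx_dot_cx, Sph3.inner_self, hy]
  simp

/-- The linear form through two points `x ≠ x'` of a fibre. Its differential is a multiple of that
of the coordinate at `x` by construction, and at the other points of the fibre because the fibre is
connected: there it is a multiple either of that differential or of its conjugate. -/
theorem rep_of_ne {π : Sph 3 → Sph 2} (hπ : IsConformalCircleFibration π) {ε : ℝ} (hε : ε ^ 2 = 1)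
    {p : Sph 2} (hm : 1 + ε * (p : E3) 2 ≠ 0) {x x' : Sph 3} (hx : π x = p) (hx' : π x' = p)
    (hne : x ≠ x') :
    Rep ε π p ((1 - (inner ℝ (x : E4) (x' : E4) : ℂ)) • grad (chart ε π) x +
      (grad (chart ε π) x ⬝ᵥ cx x') • cx x) (grad (chart ε π) x ⬝ᵥ cx x') := by
  obtain ⟨-, P, hV, hP⟩ := hπ.2 p
  have hg : ∀ y : Sph 3, π y = p → _ := fun y hy => grad_chart hπ.1 y hε (by rwa [hy])
  obtain ⟨hgx0, hgxx, hgx, -⟩ := hg x hx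
  set G := grad (chart ε π) with hG
  set g := G x with hgdef
  set s : ℂ := 1 - (inner ℝ (x : E4) (x' : E4) : ℝ) with hs
  have hs0 : s ≠ 0 := by
    have := Sph3.inner_lt_one hne
    rw [hs, sub_ne_zero]
    exact_mod_cast this.ne'
  set c := g ⬝ᵥ cx x' with hc
  set a := s • g + c • cx x with ha
  have hsurj : Function.Surjective (dotL a) := surjective_dotL_add hgxx hgx0 hgx hs0 c
  obtain ⟨t, htV, ht0, hxt, hspan⟩ := exists_tangent hV hP hx hx' hne
  have hgt := grad_dot_tangent hπ.1.smooth hm hP hx hx' hne htV hxt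
  have hax : a ⬝ᵥ cx x = c := by
    rw [ha, add_dotProduct, smul_dotProduct, smul_dotProduct, hgx, cx_dot_cx, Sph3.inner_self]
    simp
  have haa : a ⬝ᵥ a = c ^ 2 := by
    rw [ha, add_dotProduct, dotProduct_add, dotProduct_add]
    simp only [smul_dotProduct, dotProduct_smul, hgxx, hgx, dotProduct_comm (cx x) g, cx_dot_cx,
      Sph3.inner_self, smul_eq_mul]
    simp
    ring
  have hau : a ⬝ᵥ cx ((x' : E4) - x) = 0 := by
    rw [cx_sub, dotProduct_sub, hax, ha, add_dotProduct, smul_dotProduct, smul_dotProduct, ← hc,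
      cx_dot_cx, smul_eq_mul, smul_eq_mul, hs]
    ring
  have hat : a ⬝ᵥ cx t = 0 := by
    rw [ha, add_dotProduct, smul_dotProduct, smul_dotProduct, hgt, cx_dot_cx, hxt]
    simp
  have hker : P.direction = LinearMap.ker (dotL a) := by
    refine eq_ker_dotL hsurj hV fun v hv => ?_
    rw [hspan] at hv
    obtain ⟨i, j, rfl⟩ := Submodule.mem_span_pair.1 hv
    rw [cx_add, cx_smul, cx_smul, dotProduct_add, dotProduct_smul, dotProduct_smul, hat, hau]
    simp
  have hfib : ∀ y : Sph 3, π y = p ↔ a ⬝ᵥ cx y = c := by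
    intro y
    constructor
    · intro hy
      have := sub_mem_direction hP hx hy
      rw [hker, LinearMap.mem_ker, dotL_apply, cx_sub, dotProduct_sub, hax, sub_eq_zero] at this
      exact this
    · intro hy
      have h1 : (y : E4) - x ∈ P.direction := by
        rw [hker, LinearMap.mem_ker, dotL_apply, cx_sub, dotProduct_sub, hax, hy, sub_self]
      have hxP : x ∈ {x : Sph 3 | (x : E4) ∈ P} := by rw [← hP]; exact hx
      have h2 : y ∈ {x : Sph 3 | (x : E4) ∈ P} := by
        have := AffineSubspace.vadd_mem_of_mem_direction h1 hxP
        simpa using this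
      rw [← hP] at h2
      exact h2
  refine ⟨hfib, ?_⟩
  -- at each point of the fibre the differential is proportional to that of the coordinate or to its
  -- conjugate
  have alt : ∀ y : Sph 3, π y = p → ∃ α β : ℂ, a - c • cx y = α • G y + β • star (G y) ∧
      α * β = 0 ∧ (α ≠ 0 ∨ β ≠ 0) := by
    intro y hy
    obtain ⟨y', hy', hne'⟩ : ∃ y', π y' = p ∧ y ≠ y' := by
      by_cases h : y = x
      · exact ⟨x', hx', by rw [h]; exact hne⟩
      · exact ⟨x, hx, h⟩
    obtain ⟨τ, hτV, hτ0, hyτ, -⟩ := exists_tangent hV hP hy hy' hne'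
    have hgτ := grad_dot_tangent hπ.1.smooth hm hP hy hy' hne' hτV hyτ
    obtain ⟨hgy0, hgyy, hgy, -⟩ := hg y hy
    have hay := (hfib y).1 hy
    have hwτ : (a - c • cx y) ⬝ᵥ cx τ = 0 := by
      have : τ ∈ LinearMap.ker (dotL a) := hker ▸ hτV
      rw [LinearMap.mem_ker, dotL_apply] at this
      rw [sub_dotProduct, smul_dotProduct, this, cx_dot_cx, hyτ]
      simp
    obtain ⟨α, β, h1, h2⟩ := comb_of_isotropic hgyy hgy0 (isotropic_sub haa hay) hτ0
      (Sph3.inner_self y) hyτ hgy hgτ (sub_dot_self hay) hwτ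
    refine ⟨α, β, h1, h2, ?_⟩
    by_contra! h
    rw [h.1, h.2, zero_smul, zero_smul, add_zero, sub_eq_zero] at h1
    -- otherwise `a` is a complex multiple of a real covector
    obtain ⟨v, hv⟩ := hsurj 1
    obtain ⟨v', hv'⟩ := hsurj Complex.I
    rw [dotL_apply, h1, smul_dotProduct, cx_dot_cx, smul_eq_mul] at hv hv'
    have h3 : ((inner ℝ (y : E4) v' : ℝ) : ℂ) = Complex.I * (inner ℝ (y : E4) v : ℝ) := by
      linear_combination (inner ℝ (y : E4) v : ℝ) * hv' - (inner ℝ (y : E4) v' : ℝ) * hv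
    have h4 := congrArg Complex.re h3
    simp at h4
    rw [h4] at hv'
    simp at hv'
    exact Complex.I_ne_zero hv'.symm
  -- The fibre is the image of the connected set of nonzero directions in its plane, and the
  -- products of `a - c y` with the gradient and its conjugate vanish exactly where the first and
  -- the second alternative hold, respectively.
  set φ : P.direction → E4 := fun d => second x d with hφ
  set F : P.direction → ℂ × ℂ := fun d =>
    ((a - c • cx (φ d)) ⬝ᵥ G (φ d), (a - c • cx (φ d)) ⬝ᵥ star (G (φ d))) with hF
  have hpre : IsPreconnected ({0}ᶜ : Set P.direction) := by
    refine (isConnected_compl_singleton_of_one_lt_rank ?_ 0).isPreconnected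
    rw [← Module.finrank_eq_rank, hV]
    norm_num
  have hφs : ∀ d : P.direction, d ≠ 0 → ∃ y : Sph 3, π y = p ∧ φ d = y := by
    intro d hd
    have hd' : (d : E4) ≠ 0 := by simpa using hd
    exact ⟨_, second_mem_fibre hP hx d.2 hd', rfl⟩
  have hcont : ContinuousOn F ({0}ᶜ : Set P.direction) := by
    intro d hd
    have hd' : (d : E4) ≠ 0 := by simpa using hd
    obtain ⟨y, hy, hyφ⟩ := hφs d hd
    have hcφ : ContinuousAt φ d := by
      have hdd : inner ℝ (d : E4) (d : E4) ≠ (0 : ℝ) := inner_self_ne_zero.2 hd'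
      have : ContinuousAt (fun d : E4 => second x d) (d : E4) := by
        unfold second
        fun_prop (disch := assumption)
      exact this.comp continuous_subtype_val.continuousAt
    have hGc : ContinuousAt G (φ d) := by
      rw [hyφ]
      exact (contDiffAt_grad (contDiffAt_chart hπ.1.smooth y.ne_zero
        (by rwa [ext_coe, hy]))).continuousAt
    have h1 : ContinuousAt (fun d => G (φ d)) d := hGc.comp hcφ
    have h2 : ContinuousAt (fun d => a - c • cx (φ d)) d :=
      continuousAt_const.sub ((continuous_cx.continuousAt.comp hcφ).const_smul c)
    have h3 : Continuous (fun q : (Fin 4 → ℂ) × (Fin 4 → ℂ) => (q.1 ⬝ᵥ q.2, q.1 ⬝ᵥ star q.2)) := by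
      fun_prop
    exact (h3.continuousAt.comp (h2.prodMk h1)).continuousWithinAt
  have hdots : ∀ y : Sph 3, π y = p → ∀ α β : ℂ, a - c • cx y = α • G y + β • star (G y) →
      (a - c • cx y) ⬝ᵥ G y = β * (G y ⬝ᵥ star (G y)) ∧
      (a - c • cx y) ⬝ᵥ star (G y) = α * (G y ⬝ᵥ star (G y)) := by
    intro y hy α β h
    obtain ⟨hgy0, hgyy, hgy, -⟩ := hg y hy
    have hgs : star (G y) ⬝ᵥ star (G y) = 0 := by
      rw [Matrix.star_dotProduct_star, hgyy, star_zero]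
    rw [h, add_dotProduct, add_dotProduct]
    simp only [smul_dotProduct, hgyy, hgs, dotProduct_comm (star (G y)) (G y), smul_eq_mul]
    constructor <;> ring
  have himg := isPreconnected_closed_iff.1 (hpre.image F hcont)
    {q : ℂ × ℂ | q.1 = 0} {q : ℂ × ℂ | q.2 = 0} (isClosed_eq continuous_fst continuous_const)
    (isClosed_eq continuous_snd continuous_const) (by
      rintro _ ⟨d, hd, rfl⟩
      obtain ⟨y, hy, hyφ⟩ := hφs d hd
      obtain ⟨α, β, h1, h2, -⟩ := alt y hy
      obtain ⟨h3, h4⟩ := hdots y hy α β h1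
      simp only [hF, hyφ, Set.mem_union, Set.mem_ofPred_eq, h3, h4]
      rcases mul_eq_zero.1 h2 with h | h
      · right; rw [h, zero_mul]
      · left; rw [h, zero_mul])
    (by
      have ht' : (⟨t, htV⟩ : P.direction) ≠ 0 := by simpa using ht0
      refine ⟨F ⟨t, htV⟩, ⟨_, ht', rfl⟩, ?_⟩
      have e : φ ⟨t, htV⟩ = x := by simp [hφ, second, hxt]
      simp only [hF, e, Set.mem_ofPred_eq, ← hgdef]
      rw [ha, add_sub_cancel_right, smul_dotProduct, hgxx, smul_zero])
  intro y hy
  obtain ⟨α, β, h1, h2, h3⟩ := alt y hy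
  rcases mul_eq_zero.1 h2 with h | h
  swap
  · rw [h, zero_smul, add_zero] at h1
    exact ⟨α, by simpa [h] using h3, h1⟩
  exfalso
  obtain ⟨d, hd0, hdy⟩ : ∃ d : P.direction, d ≠ 0 ∧ φ d = y := by
    by_cases hxy : x = y
    · exact ⟨⟨t, htV⟩, by simpa using ht0, by simp only [hφ, second, hxt]; simp [hxy]⟩
    · refine ⟨⟨(y : E4) - x, sub_mem_direction hP hx hy⟩, ?_, second_sub x y hxy⟩
      intro h0
      have := congrArg Subtype.val h0
      simp only [Submodule.coe_zero, sub_eq_zero] at this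
      exact hxy (Subtype.ext this.symm)
  obtain ⟨_, ⟨d', hd', rfl⟩, hq1, hq2⟩ := himg ⟨F d, ⟨d, hd0, rfl⟩, by
    simp only [hF, hdy, Set.mem_ofPred_eq]
    rw [(hdots y hy α β h1).2, h, zero_mul]⟩
  obtain ⟨z, hz, hzφ⟩ := hφs d' hd'
  obtain ⟨α', β', h1', -, h3'⟩ := alt z hz
  obtain ⟨h4, h5⟩ := hdots z hz α' β' h1'
  simp only [hF, hzφ, Set.mem_ofPred_eq] at hq1 hq2
  have hne0 := dot_star_self_ne_zero (hg z hz).1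
  rw [h4, mul_eq_zero, or_iff_left hne0] at hq1
  rw [h5, mul_eq_zero, or_iff_left hne0] at hq2
  rcases h3' with h | h
  · exact h hq2
  · exact h hq1

/-! ### Local sections -/

theorem invStereo_mem {ε : ℝ} (hε : ε ^ 2 = 1) (z : ℂ) :
    (!₂[2 * z.re / (1 + Complex.normSq z), 2 * (ε * z.im) / (1 + Complex.normSq z),
      ε * (1 - Complex.normSq z) / (1 + Complex.normSq z)] : E3) ∈
      Metric.sphere (0 : E3) 1 := by
  have h : (1 + Complex.normSq z) ≠ 0 := by have := Complex.normSq_nonneg z; positivity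
  rw [mem_sphere_zero_iff_norm, ← sq_eq_sq₀ (norm_nonneg _) zero_le_one,
    ← real_inner_self_eq_norm_sq, inner_E3]
  simp
  field_simp
  rw [Complex.normSq_apply, hε]
  ring

/-- The inverse of the stereographic projection `stereo ε`. -/
def invStereo {ε : ℝ} (hε : ε ^ 2 = 1) (z : ℂ) : Sph 2 := ⟨_, invStereo_mem hε z⟩

theorem one_add_invStereo {ε : ℝ} (hε : ε ^ 2 = 1) (z : ℂ) :
    1 + ε * (invStereo hε z : E3) 2 = 2 / (1 + Complex.normSq z) := by
  have h : (1 + Complex.normSq z) ≠ 0 := by have := Complex.normSq_nonneg z; positivity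
  simp [invStereo]
  field_simp
  linear_combination (1 - Complex.normSq z) * hε

theorem one_add_invStereo_ne {ε : ℝ} (hε : ε ^ 2 = 1) (z : ℂ) :
    1 + ε * (invStereo hε z : E3) 2 ≠ 0 := by
  rw [one_add_invStereo]
  have := Complex.normSq_nonneg z
  positivity

theorem stereo_invStereo {ε : ℝ} (hε : ε ^ 2 = 1) (z : ℂ) : stereo ε (invStereo hε z) = z := by
  have h : (1 + Complex.normSq z) ≠ 0 := by have := Complex.normSq_nonneg z; positivity
  have e : (1 + (ε : ℂ) * ((invStereo hε z : E3) 2 : ℝ)) =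
      ((2 / (1 + Complex.normSq z) : ℝ) : ℂ) := by
    rw [← one_add_invStereo hε]; push_cast; rfl
  have h0 : (2 / (1 + Complex.normSq z) : ℝ) ≠ 0 := by positivity
  rw [stereo, e, div_eq_iff (by exact_mod_cast h0)]
  have e0 : (invStereo hε z : E3) 0 = z.re * (2 / (1 + Complex.normSq z)) := by
    simp [invStereo]; ring
  have e1 : (invStereo hε z : E3) 1 = ε * z.im * (2 / (1 + Complex.normSq z)) := by
    simp [invStereo]; ring
  rw [e0, e1]
  generalize 2 / (1 + Complex.normSq z) = k
  have hε' : (ε : ℂ) ^ 2 = 1 := by exact_mod_cast hε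
  push_cast
  linear_combination (k : ℂ) * Complex.re_add_im z + Complex.I * z.im * k * hε'

theorem invStereo_stereo {ε : ℝ} (hε : ε ^ 2 = 1) {u : Sph 2} (hm : 1 + ε * (u : E3) 2 ≠ 0) :
    invStereo hε (stereo ε u) = u := by
  have hu := Sph2.sq u
  have hε0 : ε ≠ 0 := by rintro rfl; norm_num at hε
  have e : stereo ε u = (((u : E3) 0 / (1 + ε * (u : E3) 2) : ℝ) : ℂ) +
      ((ε * (u : E3) 1 / (1 + ε * (u : E3) 2) : ℝ) : ℂ) * Complex.I := by
    have := cast_ne hm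
    rw [stereo]
    push_cast
    field_simp
  have hri : ∀ s t : ℝ, ((s : ℂ) + t * Complex.I).re = s ∧ ((s : ℂ) + t * Complex.I).im = t := by
    intro s t; simp
  have hre : (stereo ε u).re = (u : E3) 0 / (1 + ε * (u : E3) 2) := by rw [e]; exact (hri _ _).1
  have him : (stereo ε u).im = ε * (u : E3) 1 / (1 + ε * (u : E3) 2) := by rw [e]; exact (hri _ _).2
  have hn : 1 + Complex.normSq (stereo ε u) = 2 / (1 + ε * (u : E3) 2) := by
    rw [Complex.normSq_apply, hre, him]
    field_simp
    linear_combination hu + ((u : E3) 1 ^ 2 + (u : E3) 2 ^ 2) * hε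
  have hn' : Complex.normSq (stereo ε u) = 2 / (1 + ε * (u : E3) 2) - 1 := by linarith
  ext i
  fin_cases i
  · simp [invStereo]
    rw [hn, hre]
    field_simp
  · simp [invStereo]
    rw [hn, him]
    field_simp
    linear_combination (u : E3) 1 * hε
  · simp [invStereo]
    rw [hn, hn']
    field_simp
    linear_combination (2 * (u : E3) 2) * hε

/-- The image under `π` of the radial projection of `y` is the point with coordinate `chart ε π
y`. -/
theorem apply_normalize {π : Sph 3 → Sph 2} {ε : ℝ} (hε : ε ^ 2 = 1) {y : E4} (hy : y ≠ 0)
    (hm : 1 + ε * ext π y 2 ≠ 0) :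
    π ⟨‖y‖⁻¹ • y, normalize_mem hy⟩ = invStereo hε (chart ε π y) := by
  rw [ext_of_ne π hy] at hm
  rw [chart, ext_of_ne π hy, invStereo_stereo hε hm]

theorem eventually_ne {π : Sph 3 → Sph 2} (hπ : ContMDiff (𝓡 3) (𝓡 2) ∞ π) {ε : ℝ}
    {x : E4} (hx : x ≠ 0) (hm : 1 + ε * ext π x 2 ≠ 0) :
    ∀ᶠ y in 𝓝 x, y ≠ 0 ∧ 1 + ε * ext π y 2 ≠ 0 := by
  refine (continuousAt_id.eventually_ne hx).and ?_
  have h1 : ContinuousAt (fun y => 1 + ε * ext π y 2) x :=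
    continuousAt_const.add (continuousAt_const.mul
      ((EuclideanSpace.proj (𝕜 := ℝ) (2 : Fin (2 + 1))).continuous.continuousAt.comp
        (contDiffAt_ext hπ hx).continuousAt))
  exact h1.eventually_ne hm

/-- The inverse function theorem gives a local section of `π` through each point of `S³`. -/
theorem exists_section {π : Sph 3 → Sph 2} (hπ : IsConformalSubmersion π) {ε : ℝ}
    (hε : ε ^ 2 = 1) {z₀ : ℂ} {x : Sph 3} (hx : π x = invStereo hε z₀) :
    ∃ S : ℂ → E4, S z₀ = x ∧ DifferentiableAt ℝ S z₀ ∧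
      ∀ᶠ z in 𝓝 z₀, ∃ y : Sph 3, (y : E4) = S z ∧ π y = invStereo hε z := by
  have hm : 1 + ε * (π x : E3) 2 ≠ 0 := by rw [hx]; exact one_add_invStereo_ne hε z₀
  have hm' : 1 + ε * ext π x 2 ≠ 0 := by rwa [ext_coe]
  obtain ⟨hg0, hgg, -, -⟩ := grad_chart hπ x hε hm
  obtain ⟨v, hv⟩ := surjective_dotL hgg hg0 1
  obtain ⟨v', hv'⟩ := surjective_dotL hgg hg0 Complex.I
  rw [dotL_apply, ← fderiv_eq_grad] at hv hv'
  let R : ℂ →L[ℝ] E4 := Complex.reCLM.smulRight v + Complex.imCLM.smulRight v'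
  have hR : ∀ z, R z = z.re • v + z.im • v' := fun z => rfl
  have hcx : chart ε π x = z₀ := by rw [chart, ext_coe, hx, stereo_invStereo]
  have hs := (contDiffAt_chart hπ.smooth x.ne_zero hm').hasStrictFDerivAt (by simp)
  have h0 : (x : E4) + R 0 = x := by simp
  have h1 : HasStrictFDerivAt (fun ζ : ℂ => (x : E4) + R ζ) R 0 :=
    R.hasStrictFDerivAt.const_add _
  rw [← h0] at hs
  have h2 := hs.comp (0 : ℂ) h1
  rw [h0] at h2
  have h3 : (fderiv ℝ (chart ε π) (x : E4)).comp R =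
      ((ContinuousLinearEquiv.refl ℝ ℂ : ℂ ≃L[ℝ] ℂ) : ℂ →L[ℝ] ℂ) := by
    ext ζ
    simp [hR, hv, hv']
  rw [h3] at h2
  have h4 := h2.to_localInverse
  set L := h2.localInverse with hL
  have hv0 : chart ε π ((x : E4) + R 0) = z₀ := by rw [h0, hcx]
  rw [hv0] at h4
  have hL0 : L z₀ = 0 := by rw [← hv0]; exact h2.localInverse_apply_image
  have hinv : ∀ᶠ z in 𝓝 z₀, chart ε π (x + R (L z)) = z := by
    have := h2.eventually_right_inverse
    rwa [hv0] at this
  set s : ℂ → E4 := fun z => x + R (L z) with hsdef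
  have hsd : DifferentiableAt ℝ s z₀ :=
    (R.differentiableAt.comp z₀ h4.hasFDerivAt.differentiableAt).const_add _
  have hs0 : s z₀ = x := by simp [hsdef, hL0]
  have hev : ∀ᶠ z in 𝓝 z₀, s z ≠ 0 ∧ 1 + ε * ext π (s z) 2 ≠ 0 := by
    have := eventually_ne hπ.smooth x.ne_zero hm'
    rw [← hs0] at this
    exact hsd.continuousAt.eventually this
  refine ⟨fun z => ‖s z‖⁻¹ • s z, ?_, ?_, ?_⟩
  · simp [hs0, x.norm_eq]
  · have : s z₀ ≠ 0 := by rw [hs0]; exact x.ne_zero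
    exact ((hsd.norm ℝ this).inv (norm_ne_zero_iff.2 this)).smul hsd
  · filter_upwards [hinv, hev] with z hz hz'
    refine ⟨⟨‖s z‖⁻¹ • s z, normalize_mem hz'.1⟩, rfl, ?_⟩
    rw [apply_normalize hε hz'.1 hz'.2]
    congr 1

/-! ### The normalised representing linear form -/

theorem exists_ne_fibre {π : Sph 3 → Sph 2} (hπ : IsConformalCircleFibration π) (p : Sph 2) :
    ∃ x x' : Sph 3, π x = p ∧ π x' = p ∧ x ≠ x' := by
  obtain ⟨x, hx, x', hx', hne⟩ := (hπ.2 p).1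
  exact ⟨x, x', hx, hx', hne⟩

theorem Rep.smul {ε : ℝ} {π : Sph 3 → Sph 2} {p : Sph 2} {a : Fin 4 → ℂ} {c : ℂ}
    (h : Rep ε π p a c) {t : ℂ} (ht : t ≠ 0) : Rep ε π p (t • a) (t * c) := by
  refine ⟨fun y => ?_, fun y hy => ?_⟩
  · rw [h.fibre, smul_dotProduct, smul_eq_mul, mul_right_inj' ht]
  · obtain ⟨f, hf, h⟩ := h.pos y hy
    exact ⟨t * f, mul_ne_zero ht hf, by rw [mul_smul, mul_smul, ← h, smul_sub]⟩

/-- A pair which represents a fibre is unique up to a factor: at a point `x` of the fibre the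
gradient fixes `a - c x`, and a second point of the fibre then fixes `c`. -/
theorem Rep.unique {ε : ℝ} {π : Sph 3 → Sph 2} (hπ : IsConformalCircleFibration π) {p : Sph 2}
    {a a' : Fin 4 → ℂ} {c c' : ℂ} (h : Rep ε π p a c) (h' : Rep ε π p a' c') :
    ∃ t : ℂ, t ≠ 0 ∧ a' = t • a ∧ c' = t * c := by
  obtain ⟨x, x', hx, hx', hne⟩ := exists_ne_fibre hπ p
  obtain ⟨f, hf, e⟩ := h.pos x hx
  obtain ⟨f', hf', e'⟩ := h'.pos x hx
  have h1 : a' - c' • cx x = (f' / f) • (a - c • cx x) := by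
    rw [e, e', smul_smul, div_mul_cancel₀ _ hf]
  have hs : (1 : ℂ) - (inner ℝ (x : E4) (x' : E4) : ℝ) ≠ 0 := by
    rw [sub_ne_zero]
    exact_mod_cast (Sph3.inner_lt_one hne).ne'
  have h2 := congrArg (fun b => b ⬝ᵥ cx x') h1
  simp only [sub_dotProduct, smul_dotProduct, cx_dot_cx, (h.fibre x').1 hx', (h'.fibre x').1 hx',
    smul_eq_mul] at h2
  have h3 : c' = f' / f * c := by
    apply mul_right_cancel₀ hs
    linear_combination h2
  refine ⟨f' / f, div_ne_zero hf' hf, ?_, h3⟩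
  rw [h3, sub_eq_iff_eq_add] at h1
  rw [h1, smul_sub, smul_smul, sub_add_cancel]

theorem Rep.exists {π : Sph 3 → Sph 2} (hπ : IsConformalCircleFibration π) {ε : ℝ} (hε : ε ^ 2 = 1)
    {p : Sph 2} (hm : 1 + ε * (p : E3) 2 ≠ 0) : ∃ a c, Rep ε π p a c := by
  obtain ⟨x, x', hx, hx', hne⟩ := exists_ne_fibre hπ p
  exact ⟨_, _, rep_of_ne hπ hε hm hx hx' hne⟩

/-- The value of the form `g = (a, c)` at `y`. It is the Lorentz product of `g` with the lift `(y,
1)` of `y ∈ S³` to the light cone. -/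
def ev (y : E4) (g : (Fin 4 → ℂ) × ℂ) : ℂ := g.1 ⬝ᵥ cx y - g.2

theorem ev_smul (y : E4) (t : ℂ) (g : (Fin 4 → ℂ) × ℂ) : ev y (t • g) = t * ev y g := by
  simp only [ev, Prod.smul_fst, Prod.smul_snd, smul_dotProduct, smul_eq_mul]
  ring

theorem ev_sub (y : E4) (g h : (Fin 4 → ℂ) × ℂ) : ev y (g - h) = ev y g - ev y h := by
  simp only [ev, Prod.fst_sub, Prod.snd_sub, sub_dotProduct]
  ring

/-- The form representing the fibre over the point with coordinate `z`, normalised to take the value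
`1` at the point `X` of the fibre at infinity. -/
def Normalised {ε : ℝ} (hε : ε ^ 2 = 1) (π : Sph 3 → Sph 2) (X : Sph 3) (z : ℂ)
    (g : (Fin 4 → ℂ) × ℂ) : Prop :=
  Rep ε π (invStereo hε z) g.1 g.2 ∧ ev X g = 1

section normalised

variable {π : Sph 3 → Sph 2} {ε : ℝ} {X : Sph 3}

theorem Rep.ev_ne_zero {p : Sph 2} {g : (Fin 4 → ℂ) × ℂ} (h : Rep ε π p g.1 g.2) (hX : π X ≠ p) :
    ev X g ≠ 0 := by
  rw [ev, sub_ne_zero]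
  exact fun h' => hX ((h.fibre X).2 h')

theorem Normalised.of_rep (hε : ε ^ 2 = 1) {z : ℂ} (hX : π X ≠ invStereo hε z)
    {g : (Fin 4 → ℂ) × ℂ} (h : Rep ε π (invStereo hε z) g.1 g.2) :
    Normalised hε π X z ((ev X g)⁻¹ • g) :=
  ⟨h.smul (inv_ne_zero (h.ev_ne_zero hX)), by
    rw [ev_smul, inv_mul_cancel₀ (h.ev_ne_zero hX)]⟩

theorem Normalised.unique (hπ : IsConformalCircleFibration π) (hε : ε ^ 2 = 1) {z : ℂ}
    {g g' : (Fin 4 → ℂ) × ℂ} (h : Normalised hε π X z g) (h' : Normalised hε π X z g') :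
    g' = g := by
  obtain ⟨t, -, h1, h2⟩ := h.1.unique hπ h'.1
  have h3 : g' = t • g := Prod.ext h1 h2
  have h4 := h'.2
  rw [h3, ev_smul, h.2, mul_one] at h4
  rw [h3, h4, one_smul]

theorem Normalised.exists (hπ : IsConformalCircleFibration π) (hε : ε ^ 2 = 1) (z : ℂ)
    (hX : π X ≠ invStereo hε z) : ∃ g, Normalised hε π X z g := by
  obtain ⟨a, c, h⟩ := Rep.exists hπ hε (one_add_invStereo_ne hε z)
  exact ⟨_, Normalised.of_rep hε hX (g := (a, c)) h⟩

theorem differentiableAt_cx (y : E4) : DifferentiableAt ℝ cx y := by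
  rw [differentiableAt_pi]
  intro i
  exact (contDiffAt_coord (m := 1) i y).differentiableAt (by simp)

theorem DifferentiableAt.dotProduct' {E : Type*} [NormedAddCommGroup E] [NormedSpace ℝ E]
    {f g : E → Fin 4 → ℂ} {x : E} (hf : DifferentiableAt ℝ f x) (hg : DifferentiableAt ℝ g x) :
    DifferentiableAt ℝ (fun x => f x ⬝ᵥ g x) x := by
  simp only [dot4]
  rw [differentiableAt_pi] at hf hg
  exact ((((hf 0).mul (hg 0)).add ((hf 1).mul (hg 1))).add ((hf 2).mul (hg 2))).add
    ((hf 3).mul (hg 3))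

/-- Real differentiability holds because two local sections of `π` give an explicit formula for the
form, by `rep_of_ne`. -/
theorem Normalised.differentiableAt (hπ : IsConformalCircleFibration π) (hε : ε ^ 2 = 1)
    (hX : ∀ z, π X ≠ invStereo hε z) {G : ℂ → (Fin 4 → ℂ) × ℂ}
    (hG : ∀ z, Normalised hε π X z (G z)) (z₀ : ℂ) : DifferentiableAt ℝ G z₀ := by
  obtain ⟨x, x', hx, hx', hne⟩ := exists_ne_fibre hπ (invStereo hε z₀)
  obtain ⟨S, hS0, hSd, hS⟩ := exists_section hπ.1 hε hx
  obtain ⟨S', hS0', hSd', hS'⟩ := exists_section hπ.1 hε hx'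
  have hne' : ∀ᶠ z in 𝓝 z₀, S z ≠ S' z := by
    have h : ContinuousAt (fun z => S z - S' z) z₀ := hSd.continuousAt.sub hSd'.continuousAt
    have h0 : S z₀ - S' z₀ ≠ 0 := by
      rw [hS0, hS0', sub_ne_zero]
      exact fun h => hne (Subtype.ext h)
    filter_upwards [h.eventually_ne h0] with z hz
    exact sub_ne_zero.1 hz
  -- an explicit formula near `z₀` in terms of two local sections
  set g : ℂ → Fin 4 → ℂ := fun z => grad (chart ε π) (S z) with hg
  set H : ℂ → (Fin 4 → ℂ) × ℂ := fun z =>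
    ((1 - (inner ℝ (S z) (S' z) : ℂ)) • g z + (g z ⬝ᵥ cx (S' z)) • cx (S z),
      g z ⬝ᵥ cx (S' z)) with hH
  have hrep : ∀ᶠ z in 𝓝 z₀, Rep ε π (invStereo hε z) (H z).1 (H z).2 := by
    filter_upwards [hne', hS, hS'] with z h1 ⟨y, hy, hy'⟩ ⟨w, hw, hw'⟩
    have := rep_of_ne hπ hε (one_add_invStereo_ne hε z) hy' hw' (by
      rintro rfl; exact h1 (hy.symm.trans hw))
    rw [hy, hw] at this
    exact this
  have hgd : DifferentiableAt ℝ g z₀ := by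
    have hm : 1 + ε * ext π x 2 ≠ 0 := by rw [ext_coe, hx]; exact one_add_invStereo_ne hε z₀
    have h1 := (contDiffAt_grad (contDiffAt_chart hπ.1.smooth x.ne_zero hm)).differentiableAt
      (by simp)
    rw [← hS0] at h1
    exact h1.comp z₀ hSd
  have hc : DifferentiableAt ℝ (fun z => cx (S z)) z₀ := (differentiableAt_cx _).comp z₀ hSd
  have hc' : DifferentiableAt ℝ (fun z => cx (S' z)) z₀ := (differentiableAt_cx _).comp z₀ hSd'
  have hd2 := DifferentiableAt.dotProduct' hgd hc'
  have hin : DifferentiableAt ℝ (fun z => (inner ℝ (S z) (S' z) : ℂ)) z₀ := by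
    have := DifferentiableAt.dotProduct' hc hc'
    simpa only [cx_dot_cx] using this
  have hHd : DifferentiableAt ℝ H z₀ :=
    ((((differentiableAt_const _).sub hin).smul hgd).add (hd2.smul hc)).prodMk hd2
  have hevd : DifferentiableAt ℝ (fun z => ev X (H z)) z₀ :=
    (DifferentiableAt.dotProduct' hHd.fst (differentiableAt_const _)).sub hHd.snd
  have hev0 := (hrep.self_of_nhds).ev_ne_zero (hX z₀)
  refine ((hevd.inv hev0).smul hHd).congr_of_eventuallyEq ?_
  filter_upwards [hrep] with z hz
  exact (Normalised.of_rep hε (hX z) hz).unique hπ hε (hG z)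

end normalised

/-! ### The representing form depends holomorphically on the fibre -/

/-- The pair `(a, c)` is a null vector of `ℂ⁵` for the complexified Lorentz form `a · a - c²`, and
it is not proportional to a real null vector. Both properties can be read off at one point of the
fibre. -/
theorem Rep.isotropic {π : Sph 3 → Sph 2} (hπ : IsConformalCircleFibration π) {ε : ℝ}
    (hε : ε ^ 2 = 1) {p : Sph 2} (hm : 1 + ε * (p : E3) 2 ≠ 0) {a : Fin 4 → ℂ} {c : ℂ}
    (h : Rep ε π p a c) : a ⬝ᵥ a = c ^ 2 ∧ a ⬝ᵥ star a - c * star c ≠ 0 ∧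
      Function.Surjective (dotL a) := by
  obtain ⟨x, -, hx, -, -⟩ := exists_ne_fibre hπ p
  obtain ⟨f, hf, hfx⟩ := h.pos x hx
  obtain ⟨hg0, hgg, hgx, -⟩ := grad_chart hπ.1 x hε (by rwa [hx])
  set g := grad (chart ε π) x
  rw [sub_eq_iff_eq_add] at hfx
  have hxx : cx x ⬝ᵥ cx x = 1 := by rw [cx_dot_cx, Sph3.inner_self, Complex.ofReal_one]
  have hsx : star (cx x) = cx x := by funext i; simp [cx]
  have hgx' : cx x ⬝ᵥ star g = 0 := by
    rw [dotProduct_comm, star_dot_cx, hgx, star_zero]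
  refine ⟨?_, ?_, ?_⟩
  · rw [hfx, add_dotProduct, dotProduct_add, dotProduct_add]
    simp only [smul_dotProduct, dotProduct_smul, hgg, hgx, dotProduct_comm (cx x) g, hxx,
      smul_eq_mul]
    ring
  · have e : a ⬝ᵥ star a - c * star c = f * star f * (g ⬝ᵥ star g) := by
      rw [hfx, star_add, star_smul, star_smul, hsx, add_dotProduct, dotProduct_add, dotProduct_add]
      simp only [smul_dotProduct, dotProduct_smul, hgx, hgx', hxx, smul_eq_mul]
      ring
    rw [e]
    exact mul_ne_zero (mul_ne_zero hf (star_ne_zero.2 hf)) (dot_star_self_ne_zero hg0)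
  · rw [hfx]
    exact surjective_dotL_add hgg hg0 hgx hf c

/-- A form `E` which vanishes on a fibre is a combination of the form `g` representing the fibre
and of its conjugate. If `E` is orthogonal to `g`, it is a multiple of `g`, and it is zero if it
also vanishes at a point where `g` does not. -/
theorem eq_zero_of_ev {π : Sph 3 → Sph 2} (hπ : IsConformalCircleFibration π) {ε : ℝ}
    (hε : ε ^ 2 = 1) {p : Sph 2} (hm : 1 + ε * (p : E3) 2 ≠ 0) {g E : (Fin 4 → ℂ) × ℂ}
    (h : Rep ε π p g.1 g.2) (hE : ∀ y : Sph 3, π y = p → ev y E = 0)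
    (hgE : g.1 ⬝ᵥ E.1 = g.2 * E.2) {X : E4} (hX : ev X g ≠ 0) (hEX : ev X E = 0) : E = 0 := by
  obtain ⟨a, c⟩ := g
  obtain ⟨e, t⟩ := E
  simp only [ev, sub_eq_zero] at hE hgE hEX hX h
  obtain ⟨haa, hac, hsurj⟩ := h.isotropic hπ hε hm
  obtain ⟨x, x', hx, hx', hne⟩ := exists_ne_fibre hπ p
  have hax := (h.fibre x).1 hx
  -- a direction of the plane which is not tangent at `x` leads to a second point of the fibre
  have key : ∀ v : E4, a ⬝ᵥ cx v = 0 → inner ℝ (x : E4) v ≠ 0 → e ⬝ᵥ cx v = 0 := by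
    intro v hv hxv
    have hv0 : v ≠ 0 := by rintro rfl; simp at hxv
    have hvv : inner ℝ v v ≠ (0 : ℝ) := inner_self_ne_zero.2 hv0
    have h1 := hE ⟨second x v, second_mem x hv0⟩ ((h.fibre _).2 (by
      change a ⬝ᵥ cx (second x v) = c
      rw [second, cx_sub, cx_smul, dotProduct_sub, dotProduct_smul, hv, hax]
      simp))
    change e ⬝ᵥ cx (second x v) = t at h1
    rw [second, cx_sub, cx_smul, dotProduct_sub, dotProduct_smul, hE x hx, sub_eq_self, smul_eq_mul,
      mul_eq_zero] at h1
    refine h1.resolve_left ?_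
    have : 2 * inner ℝ (x : E4) v / inner ℝ v v ≠ 0 := by positivity
    exact_mod_cast this
  have hu : a ⬝ᵥ cx ((x' : E4) - x) = 0 := by
    rw [cx_sub, dotProduct_sub, hax, (h.fibre x').1 hx', sub_self]
  have hxu : inner ℝ (x : E4) ((x' : E4) - x) ≠ 0 := by
    rw [inner_sub_right, Sph3.inner_self]
    linarith [Sph3.inner_lt_one hne]
  have key2 : ∀ v : E4, a ⬝ᵥ cx v = 0 → e ⬝ᵥ cx v = 0 := by
    intro v hv
    by_cases hxv : inner ℝ (x : E4) v = 0
    · have h1 := key (v + ((x' : E4) - x)) (by rw [cx_add, dotProduct_add, hv, hu, add_zero])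
        (by rwa [inner_add_right, hxv, zero_add])
      rwa [cx_add, dotProduct_add, key _ hu hxu, add_zero] at h1
    · exact key v hv hxv
  obtain ⟨l, m, hlm⟩ := exists_comb hsurj key2
  have ht : l * c + m * star c = t := by
    rw [← hE x hx, hlm, add_dotProduct, smul_dotProduct, smul_dotProduct, star_dot_cx, hax]
    rfl
  have hm0 : m = 0 := by
    rw [hlm, dotProduct_add, dotProduct_smul, dotProduct_smul, haa, ← ht] at hgE
    simp only [smul_eq_mul] at hgE
    have : m * (a ⬝ᵥ star a - c * star c) = 0 := by linear_combination hgE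
    exact (mul_eq_zero.1 this).resolve_right hac
  rw [hm0] at hlm ht
  have hl0 : l = 0 := by
    rw [hlm, ← ht, add_dotProduct, smul_dotProduct] at hEX
    simp only [smul_eq_mul, zero_smul, zero_dotProduct, add_zero, zero_mul] at hEX
    have : l * (a ⬝ᵥ cx X - c) = 0 := by linear_combination hEX
    exact (mul_eq_zero.1 this).resolve_right hX
  rw [hl0] at hlm ht
  ext1
  · rw [hlm]; simp
  · change t = 0
    rw [← ht]; simp

theorem hasDerivAt_dot {f g : ℝ → Fin 4 → ℂ} {f' g' : Fin 4 → ℂ} {x : ℝ} (hf : HasDerivAt f f' x)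
    (hg : HasDerivAt g g' x) : HasDerivAt (fun t => f t ⬝ᵥ g t) (f' ⬝ᵥ g x + f x ⬝ᵥ g') x := by
  rw [hasDerivAt_pi] at hf hg
  simp only [dot4]
  refine ((((hf 0).mul (hg 0)).add ((hf 1).mul (hg 1))).add ((hf 2).mul (hg 2))).add
    ((hf 3).mul (hg 3)) |>.congr_deriv ?_
  ring

theorem hasDerivAt_fst {G : ℝ → (Fin 4 → ℂ) × ℂ} {G' : (Fin 4 → ℂ) × ℂ} {x : ℝ}
    (h : HasDerivAt G G' x) : HasDerivAt (fun t => (G t).1) G'.1 x := by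
  simpa using h.hasFDerivAt.fst.hasDerivAt

theorem hasDerivAt_snd {G : ℝ → (Fin 4 → ℂ) × ℂ} {G' : (Fin 4 → ℂ) × ℂ} {x : ℝ}
    (h : HasDerivAt G G' x) : HasDerivAt (fun t => (G t).2) G'.2 x := by
  simpa using h.hasFDerivAt.snd.hasDerivAt

section normalised

variable {π : Sph 3 → Sph 2} {ε : ℝ} {X : Sph 3}

/-- The derivative of the representing form, evaluated on the fibre, is complex linear, because the
form vanishes at `y` over the point with coordinate `chart ε π y`, which has a complex multiple of
the form as its gradient. -/
theorem Normalised.ev_fderiv (hπ : IsConformalCircleFibration π) (hε : ε ^ 2 = 1)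
    (hX : ∀ z, π X ≠ invStereo hε z) {G : ℂ → (Fin 4 → ℂ) × ℂ}
    (hG : ∀ z, Normalised hε π X z (G z)) {z₀ : ℂ} {y : Sph 3} (hy : π y = invStereo hε z₀) :
    ∃ f : ℂ, f ≠ 0 ∧ ∀ ζ, ev y (fderiv ℝ G z₀ ζ) = -(f * ζ) := by
  have hm : 1 + ε * (π y : E3) 2 ≠ 0 := by rw [hy]; exact one_add_invStereo_ne hε z₀
  have hm' : 1 + ε * ext π y 2 ≠ 0 := by rwa [ext_coe]
  obtain ⟨hg0, hgg, hgy, -⟩ := grad_chart hπ.1 y hε hm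
  obtain ⟨f, hf, hfy⟩ := (hG z₀).1.pos y hy
  have hD := (Normalised.differentiableAt hπ hε hX hG z₀).hasFDerivAt
  set D := fderiv ℝ G z₀
  refine ⟨f, hf, fun ζ => ?_⟩
  obtain ⟨v, hv, hv'⟩ := exists_dot_eq hgg hg0 ζ
  have hyv := hv' y hgy
  -- differentiate the incidence relation along a curve in direction `v`
  have hl : HasDerivAt (fun t : ℝ => (y : E4) + t • v) v 0 := by
    simpa using ((hasDerivAt_id (0 : ℝ)).smul_const v).const_add (y : E4)
  have e0 : (y : E4) + (0 : ℝ) • v = y := by simp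
  have hcy : chart ε π y = z₀ := by rw [chart, ext_coe, hy, stereo_invStereo]
  have hch : HasDerivAt (fun t : ℝ => chart ε π (y + t • v)) ζ 0 := by
    have h1 := ((contDiffAt_chart hπ.1.smooth y.ne_zero hm').differentiableAt (by simp)).hasFDerivAt
    rw [← e0] at h1
    have := h1.comp_hasDerivAt (0 : ℝ) hl
    rwa [e0, fderiv_eq_grad, hv] at this
  have hGc : HasDerivAt (fun t : ℝ => G (chart ε π (y + t • v))) (D ζ) 0 := by
    have h1 : HasFDerivAt G D (chart ε π ((y : E4) + (0 : ℝ) • v)) := by rwa [e0, hcy]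
    exact h1.comp_hasDerivAt (0 : ℝ) hch
  have hcx : HasDerivAt (fun t : ℝ => cx (y + t • v)) (cx v) 0 := by
    rw [hasDerivAt_pi]
    intro i
    have h1 := ((hasDerivAt_id (0 : ℝ)).mul_const (v i)).const_add ((y : E4) i)
    simpa [cx] using h1.ofReal_comp
  have hn : HasDerivAt (fun t : ℝ => ((‖(y : E4) + t • v‖ : ℝ) : ℂ)) 0 0 := by
    have h1 : HasDerivAt (fun t : ℝ => √(inner ℝ ((y : E4) + t • v) ((y : E4) + t • v))) 0 0 := by
      have := (hl.inner ℝ hl).sqrt (by simp [y.norm_eq])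
      refine this.congr_deriv ?_
      simp [real_inner_comm (y : E4) v, hyv]
    have := h1.ofReal_comp
    simpa only [← norm_eq_sqrt_real_inner, Complex.ofReal_zero] using this
  have h1 := (hasDerivAt_dot (hasDerivAt_fst hGc) hcx).sub ((hasDerivAt_snd hGc).mul hn)
  have h2 : HasDerivAt (fun t : ℝ => (G (chart ε π (y + t • v))).1 ⬝ᵥ cx (y + t • v) -
      (G (chart ε π (y + t • v))).2 * ((‖(y : E4) + t • v‖ : ℝ) : ℂ)) 0 0 := by
    refine (hasDerivAt_const (0 : ℝ) (0 : ℂ)).congr_of_eventuallyEq ?_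
    have hev := eventually_ne hπ.1.smooth y.ne_zero hm'
    rw [← e0] at hev
    filter_upwards [hl.continuousAt.eventually hev] with t ht
    have h3 := ((hG _).1.fibre _).1 (apply_normalize hε ht.1 ht.2)
    change _ ⬝ᵥ cx (‖(y : E4) + t • v‖⁻¹ • ((y : E4) + t • v)) = _ at h3
    have h4 : (‖(y : E4) + t • v‖ : ℂ) ≠ 0 := by exact_mod_cast norm_ne_zero_iff.2 ht.1
    rw [cx_smul, dotProduct_smul, smul_eq_mul, Complex.ofReal_inv, inv_mul_eq_iff_eq_mul₀ h4] at h3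
    rw [h3]
    ring
  have h3 := h1.unique h2
  rw [e0, hcy, y.norm_eq] at h3
  rw [sub_eq_iff_eq_add] at hfy
  have h4 : (G z₀).1 ⬝ᵥ cx v = f * ζ := by
    rw [hfy, add_dotProduct, smul_dotProduct, smul_dotProduct, hv, cx_dot_cx, hyv]
    simp
  rw [h4] at h3
  rw [ev]
  simp only [Complex.ofReal_one, mul_one, mul_zero, add_zero] at h3
  linear_combination h3

/-- The antilinear part of the derivative of the normalised form vanishes: it is zero on the
fibre, as the derivative is complex linear there by `Normalised.ev_fderiv`; it is orthogonal to
the form, as the form stays isotropic; and it is zero at `X` by the normalisation. Hence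
`eq_zero_of_ev` applies. -/
theorem Normalised.differentiable (hπ : IsConformalCircleFibration π) (hε : ε ^ 2 = 1)
    (hX : ∀ z, π X ≠ invStereo hε z) {G : ℂ → (Fin 4 → ℂ) × ℂ}
    (hG : ∀ z, Normalised hε π X z (G z)) : Differentiable ℂ G := by
  intro z₀
  have hd := Normalised.differentiableAt hπ hε hX hG z₀
  refine differentiableAt_complex_iff_differentiableAt_real.2 ⟨hd, ?_⟩
  have hD := hd.hasFDerivAt
  set D := fderiv ℝ G z₀ with hDdef
  rw [← sub_eq_zero]
  have hm := one_add_invStereo_ne hε z₀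
  have hline : ∀ ζ : ℂ, HasDerivAt (fun t : ℝ => G (z₀ + t * ζ)) (D ζ) 0 := by
    intro ζ
    have h1 : HasDerivAt (fun t : ℝ => z₀ + t * ζ) ζ 0 := by
      have := ((hasDerivAt_id (0 : ℝ)).ofReal_comp.mul_const ζ).const_add z₀
      simpa using this
    have h2 : HasFDerivAt G D (z₀ + ((0 : ℝ) : ℂ) * ζ) := by simpa using hD
    exact h2.comp_hasDerivAt (0 : ℝ) h1
  have hnull : ∀ ζ : ℂ, (G z₀).1 ⬝ᵥ (D ζ).1 = (G z₀).2 * (D ζ).2 := by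
    intro ζ
    have h1 := hasDerivAt_dot (hasDerivAt_fst (hline ζ)) (hasDerivAt_fst (hline ζ))
    have h2 := (hasDerivAt_snd (hline ζ)).mul (hasDerivAt_snd (hline ζ))
    have e : (fun t : ℝ => (G (z₀ + t * ζ)).1 ⬝ᵥ (G (z₀ + t * ζ)).1) =
        (fun t : ℝ => (G (z₀ + t * ζ)).2) * (fun t : ℝ => (G (z₀ + t * ζ)).2) := by
      funext t
      rw [((hG _).1.isotropic hπ hε (one_add_invStereo_ne hε _)).1, sq]
      rfl
    rw [e] at h1
    have h3 := h1.unique h2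
    simp only [Complex.ofReal_zero, zero_mul, add_zero, dotProduct_comm (D ζ).1] at h3
    linear_combination h3 / 2
  have hevX : ∀ ζ : ℂ, ev X (D ζ) = 0 := by
    intro ζ
    have h1 := (hasDerivAt_dot (hasDerivAt_fst (hline ζ)) (hasDerivAt_const (0 : ℝ) (cx X))).sub
      (hasDerivAt_snd (hline ζ))
    have h2 : HasDerivAt (fun t : ℝ => (G (z₀ + t * ζ)).1 ⬝ᵥ cx X - (G (z₀ + t * ζ)).2) 0 0 := by
      have e : (fun t : ℝ => (G (z₀ + t * ζ)).1 ⬝ᵥ cx X - (G (z₀ + t * ζ)).2) = fun _ => 1 :=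
        funext fun t => (hG _).2
      rw [e]
      exact hasDerivAt_const _ _
    have h3 := h1.unique h2
    simpa [ev] using h3
  refine eq_zero_of_ev hπ hε hm (hG z₀).1 (fun y hy => ?_) ?_ (X := X) ?_ ?_
  · obtain ⟨f, -, hf⟩ := Normalised.ev_fderiv hπ hε hX hG hy
    rw [ev_sub, ev_smul, hf, hf]
    ring
  · have h1 := hnull Complex.I
    have h2 := hnull 1
    simp only [Prod.fst_sub, Prod.snd_sub, Prod.smul_fst, Prod.smul_snd, dotProduct_sub,
      dotProduct_smul, smul_eq_mul]
    linear_combination h1 - Complex.I * h2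
  · rw [(hG z₀).2]; exact one_ne_zero
  · rw [ev_sub, ev_smul, hevX, hevX]; simp

/-- The representing form has a simple zero along the fibre. -/
theorem Normalised.ev_deriv_ne_zero (hπ : IsConformalCircleFibration π) (hε : ε ^ 2 = 1)
    (hX : ∀ z, π X ≠ invStereo hε z) {G : ℂ → (Fin 4 → ℂ) × ℂ}
    (hG : ∀ z, Normalised hε π X z (G z)) {z₀ : ℂ} {y : Sph 3} (hy : π y = invStereo hε z₀) :
    ev y (deriv G z₀) ≠ 0 := by
  obtain ⟨f, hf, h⟩ := Normalised.ev_fderiv hπ hε hX hG hy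
  have hd := Normalised.differentiable hπ hε hX hG z₀
  have : fderiv ℝ G z₀ 1 = deriv G z₀ := by
    rw [hd.fderiv_restrictScalars ℝ]
    simp
  rw [← this, h]
  simpa using hf

end normalised

/-! ### The representing form is affine in the coordinate -/

/-- The two stereographic coordinates are inverse to each other. -/
theorem stereo_mul_stereo_neg {ε : ℝ} (hε : ε ^ 2 = 1) {u : Sph 2} (hm : 1 + ε * (u : E3) 2 ≠ 0)
    (hm' : 1 + -ε * (u : E3) 2 ≠ 0) : stereo ε u * stereo (-ε) u = 1 := by
  have h1 := cast_ne hm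
  have h2 := cast_ne hm'
  have hu := congrArg (fun t : ℝ => (t : ℂ)) (Sph2.sq u)
  have hε' : (ε : ℂ) ^ 2 = 1 := by exact_mod_cast hε
  rw [stereo, stereo, div_mul_div_comm, div_eq_one_iff_eq (mul_ne_zero h1 h2)]
  push_cast at hu h2 ⊢
  linear_combination hu + (((u : E3) 1 : ℂ) ^ 2 + ((u : E3) 2 : ℂ) ^ 2) * hε' -
    (ε : ℂ) ^ 2 * ((u : E3) 1 : ℂ) ^ 2 * Complex.I_sq

/-- The two coordinates are inverse to each other, so that their gradients are proportional. -/
theorem grad_chart_neg {π : Sph 3 → Sph 2} (hπ : ContMDiff (𝓡 3) (𝓡 2) ∞ π) {ε : ℝ}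
    (hε : ε ^ 2 = 1) {x : Sph 3} (hm : 1 + ε * (π x : E3) 2 ≠ 0) (hm' : 1 + -ε * (π x : E3) 2 ≠ 0) :
    ∃ t : ℂ, t ≠ 0 ∧ grad (chart (-ε) π) x = t • grad (chart ε π) x := by
  have h1 : 1 + ε * ext π x 2 ≠ 0 := by rwa [ext_coe]
  have h2 : 1 + -ε * ext π x 2 ≠ 0 := by rwa [ext_coe]
  have hprod : ∀ᶠ y in 𝓝 (x : E4), chart ε π y * chart (-ε) π y = 1 := by
    filter_upwards [eventually_ne hπ x.ne_zero h1, eventually_ne hπ x.ne_zero h2] with y hy hy'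
    have hy1 := hy.2
    have hy2 := hy'.2
    rw [ext_of_ne π hy.1] at hy1 hy2
    rw [chart, chart, ext_of_ne π hy.1]
    exact stereo_mul_stereo_neg hε hy1 hy2
  have d1 := ((contDiffAt_chart hπ x.ne_zero h1).differentiableAt (by simp)).hasFDerivAt
  have d2 := ((contDiffAt_chart hπ x.ne_zero h2).differentiableAt (by simp)).hasFDerivAt
  have d3 := (d1.mul d2).unique ((hasFDerivAt_const (1 : ℂ) (x : E4)).congr_of_eventuallyEq hprod)
  have hp := hprod.self_of_nhds
  have hz : chart ε π x ≠ 0 := left_ne_zero_of_mul_eq_one hp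
  have hz' : chart (-ε) π x ≠ 0 := right_ne_zero_of_mul_eq_one hp
  refine ⟨-(chart (-ε) π x / chart ε π x), neg_ne_zero.2 (div_ne_zero hz' hz), ?_⟩
  funext i
  have h := congrArg (fun L => L (EuclideanSpace.single i 1)) d3
  simp only [add_apply, smul_apply, smul_eq_mul, zero_apply] at h
  simp only [grad, Pi.smul_apply, smul_eq_mul]
  field_simp
  linear_combination h

/-- The notion of a representing form does not depend on which of the two coordinates is used. -/
theorem Rep.neg {π : Sph 3 → Sph 2} (hπ : ContMDiff (𝓡 3) (𝓡 2) ∞ π) {ε : ℝ} (hε : ε ^ 2 = 1)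
    {p : Sph 2} (hm : 1 + ε * (p : E3) 2 ≠ 0) (hm' : 1 + -ε * (p : E3) 2 ≠ 0) {a : Fin 4 → ℂ}
    {c : ℂ} (h : Rep (-ε) π p a c) : Rep ε π p a c := by
  refine ⟨h.fibre, fun y hy => ?_⟩
  obtain ⟨f, hf, e⟩ := h.pos y hy
  obtain ⟨t, ht, e'⟩ := grad_chart_neg hπ hε (x := y) (by rwa [hy]) (by rwa [hy])
  exact ⟨f * t, mul_ne_zero hf ht, by rw [e, e', smul_smul]⟩

theorem neg_one_sq' {ε : ℝ} (hε : ε ^ 2 = 1) : (-ε) ^ 2 = 1 := by rw [neg_sq, hε]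

theorem invStereo_inv {ε : ℝ} (hε : ε ^ 2 = 1) {z : ℂ} (hz : z ≠ 0) :
    1 + -ε * (invStereo hε z : E3) 2 ≠ 0 ∧
      invStereo (neg_one_sq' hε) z⁻¹ = invStereo hε z := by
  have h := one_add_invStereo hε z
  have hn := Complex.normSq_pos.2 hz
  have h1 : 1 + -ε * (invStereo hε z : E3) 2 ≠ 0 := by
    have : 1 + -ε * (invStereo hε z : E3) 2 =
        2 * Complex.normSq z / (1 + Complex.normSq z) := by
      rw [show 1 + -ε * (invStereo hε z : E3) 2 = 2 - (1 + ε * (invStereo hε z : E3) 2) by ring, h]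
      field_simp
      ring
    rw [this]
    positivity
  refine ⟨h1, ?_⟩
  have h2 := stereo_mul_stereo_neg hε (one_add_invStereo_ne hε z) h1
  rw [stereo_invStereo] at h2
  rw [← eq_inv_of_mul_eq_one_right h2, invStereo_stereo (neg_one_sq' hε) h1]

/-- The point `0` of one coordinate is the point at infinity of the other. -/
theorem invStereo_neg_zero_ne {ε : ℝ} (hε : ε ^ 2 = 1) (z : ℂ) :
    invStereo (neg_one_sq' hε) 0 ≠ invStereo hε z := by
  intro h
  have h1 := one_add_invStereo_ne hε z
  rw [← h] at h1
  have h2 := one_add_invStereo (neg_one_sq' hε) 0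
  simp only [map_zero, add_zero, div_one] at h2
  apply h1
  linarith

/-- The value at `(y, 1)` as a continuous linear form. -/
def evL (y : E4) : ((Fin 4 → ℂ) × ℂ) →L[ℂ] ℂ :=
  LinearMap.toContinuousLinearMap
    { toFun := ev y
      map_add' := fun g h => by
        simp only [ev, Prod.fst_add, Prod.snd_add, add_dotProduct]; ring
      map_smul' := fun t g => ev_smul y t g }

/-- The form representing the fibre over the point with homogeneous coordinates `[z : 1]` can be
chosen affine in `z`: it is entire, and it grows linearly because the form in the coordinate `1 / z`
has a simple zero along the fibre at infinity. -/
theorem exists_affine {π : Sph 3 → Sph 2} (hπ : IsConformalCircleFibration π) {ε : ℝ}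
    (hε : ε ^ 2 = 1) : ∃ V₀ V₁ : (Fin 4 → ℂ) × ℂ,
      (∀ z : ℂ, Rep ε π (invStereo hε z) (V₀ + z • V₁).1 (V₀ + z • V₁).2) ∧
      Rep (-ε) π (invStereo (neg_one_sq' hε) 0) V₁.1 V₁.2 := by
  set hε' := neg_one_sq' hε
  obtain ⟨X, -, hX, -, -⟩ := exists_ne_fibre hπ (invStereo hε' 0)
  obtain ⟨X', -, hX', -, -⟩ := exists_ne_fibre hπ (invStereo hε 0)
  have hXne : ∀ z, π X ≠ invStereo hε z := fun z => by
    rw [hX]; exact invStereo_neg_zero_ne hε z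
  have hXne' : ∀ z, π X' ≠ invStereo hε' z := fun z => by
    rw [hX']
    have := invStereo_neg_zero_ne hε' z
    simpa only [neg_neg] using this
  choose G hG using fun z => Normalised.exists hπ hε z (hXne z)
  choose H hH using fun z => Normalised.exists hπ hε' z (hXne' z)
  have hGd := Normalised.differentiable hπ hε hXne hG
  have hHd := Normalised.differentiable hπ hε' hXne' hH
  set φ : ℂ → ℂ := fun ζ => ev X (H ζ) with hφ
  have hφ0 : φ 0 = 0 := by
    rw [hφ]
    simp only [ev, sub_eq_zero]
    exact ((hH 0).1.fibre X).1 hX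
  set d := ev X (deriv H 0) with hd
  have hd0 : d ≠ 0 := Normalised.ev_deriv_ne_zero hπ hε' hXne' hH hX
  have hφd : HasDerivAt φ d 0 := by
    have := (evL X).hasFDerivAt.comp_hasDerivAt (0 : ℂ) (hHd 0).hasDerivAt
    exact this
  have hGH : ∀ z : ℂ, z ≠ 0 → G z = (φ z⁻¹)⁻¹ • H z⁻¹ := by
    intro z hz
    obtain ⟨h1, h2⟩ := invStereo_inv hε hz
    have h3 := (hH z⁻¹).1
    rw [h2] at h3
    have h4 := h3.neg hπ.1.smooth hε (one_add_invStereo_ne hε z) h1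
    exact (hG z).unique hπ hε (Normalised.of_rep hε (hXne z) h4) |>.symm
  -- the limit of `G z / z` at infinity
  have hlim : Tendsto (fun z : ℂ => z⁻¹ • G z) (cocompact ℂ) (𝓝 (d⁻¹ • H 0)) := by
    have h1 : Tendsto (fun ζ : ℂ => (ζ⁻¹ * φ ζ)⁻¹ • H ζ) (𝓝[≠] 0) (𝓝 (d⁻¹ • H 0)) := by
      have h2 := hφd.tendsto_slope_zero
      simp only [zero_add, hφ0, sub_zero, smul_eq_mul] at h2
      exact (h2.inv₀ hd0).smul ((hHd.continuous.tendsto 0).mono_left nhdsWithin_le_nhds)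
    have h3 : Tendsto (fun z : ℂ => z⁻¹) (cocompact ℂ) (𝓝[≠] 0) := by
      rw [← Metric.cobounded_eq_cocompact]
      exact tendsto_inv₀_cobounded'
    refine (h1.comp h3).congr' ?_
    have h4 : ∀ᶠ z : ℂ in cocompact ℂ, z ≠ 0 := by
      filter_upwards [h3.eventually eventually_mem_nhdsWithin] with z hz
      simpa using hz
    filter_upwards [h4] with z hz
    simp only [Function.comp, inv_inv]
    rw [hGH z hz, smul_smul, mul_inv]
  -- the entire function `(G z - G 0) / z` has a limit at infinity, so it is constant
  set K := dslope G 0 with hK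
  have hKd : Differentiable ℂ K := by
    rw [← differentiableOn_univ]
    exact (Complex.differentiableOn_dslope univ_mem).2 hGd.differentiableOn
  have hKlim : Tendsto K (cocompact ℂ) (𝓝 (d⁻¹ • H 0)) := by
    have h3 : Tendsto (fun z : ℂ => z⁻¹) (cocompact ℂ) (𝓝 0) := by
      rw [← Metric.cobounded_eq_cocompact]
      exact tendsto_inv₀_cobounded
    have h5 := hlim.sub (h3.smul_const (G 0))
    rw [zero_smul, sub_zero] at h5
    refine h5.congr' ?_
    have h4 : ∀ᶠ z : ℂ in cocompact ℂ, z ≠ 0 := by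
      have := (isCompact_singleton (x := (0 : ℂ))).compl_mem_cocompact
      exact this
    filter_upwards [h4] with z hz
    rw [hK, dslope_of_ne _ hz, slope_def_module, sub_zero, smul_sub]
  have hconst := hKd.eq_const_of_tendsto_cocompact hKlim
  refine ⟨G 0, d⁻¹ • H 0, fun z => ?_, (hH 0).1.smul (inv_ne_zero hd0)⟩
  have : G 0 + z • d⁻¹ • H 0 = G z := by
    have h1 := sub_smul_dslope G 0 z
    rw [← hK, hconst, Function.const_apply, sub_zero] at h1
    rw [h1]
    abel
  rw [this]
  exact (hG z).1

/-! ### The exterior square of `ℂ⁴` -/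

/-- The bivector `eᵢ ∧ eⱼ`. -/
def basisWedge (i j : Fin 4) : ⋀[ℂ]^2 (Fin 4 → ℂ) :=
  exteriorPower.ιMulti ℂ 2 ![Pi.single i 1, Pi.single j 1]

theorem coe_wedge (v w : Fin 4 → ℂ) :
    (exteriorPower.ιMulti ℂ 2 ![v, w] : ExteriorAlgebra ℂ (Fin 4 → ℂ)) =
      ExteriorAlgebra.ι ℂ v * ExteriorAlgebra.ι ℂ w := by
  rw [exteriorPower.ιMulti_apply_coe, ExteriorAlgebra.ιMulti_apply]
  simp

/-- The Plücker coordinates of `v ∧ w`. -/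
theorem wedge_expand (v w : Fin 4 → ℂ) : exteriorPower.ιMulti ℂ 2 ![v, w] =
    (v 0 * w 1 - v 1 * w 0) • basisWedge 0 1 + (v 0 * w 2 - v 2 * w 0) • basisWedge 0 2 +
    (v 0 * w 3 - v 3 * w 0) • basisWedge 0 3 + (v 1 * w 2 - v 2 * w 1) • basisWedge 1 2 +
    (v 1 * w 3 - v 3 * w 1) • basisWedge 1 3 + (v 2 * w 3 - v 3 * w 2) • basisWedge 2 3 := by
  apply Subtype.ext
  simp only [Submodule.coe_add, Submodule.coe_smul, basisWedge, coe_wedge]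
  set e : Fin 4 → ExteriorAlgebra ℂ (Fin 4 → ℂ) :=
    fun i => ExteriorAlgebra.ι ℂ (Pi.single i 1) with he
  have hv : ∀ v : Fin 4 → ℂ, ExteriorAlgebra.ι ℂ v =
      v 0 • e 0 + v 1 • e 1 + v 2 • e 2 + v 3 • e 3 := by
    intro v
    simp only [he, ← map_smul, ← map_add]
    congr 1
    ext i
    fin_cases i <;> simp
  have hsq : ∀ i, e i * e i = 0 := fun i => ExteriorAlgebra.ι_sq_zero _
  have hsw : ∀ i j, e j * e i = -(e i * e j) := fun i j =>
    eq_neg_of_add_eq_zero_left (ExteriorAlgebra.ι_add_mul_swap _ _)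
  change _ = (v 0 * w 1 - v 1 * w 0) • (e 0 * e 1) + (v 0 * w 2 - v 2 * w 0) • (e 0 * e 2) +
    (v 0 * w 3 - v 3 * w 0) • (e 0 * e 3) + (v 1 * w 2 - v 2 * w 1) • (e 1 * e 2) +
    (v 1 * w 3 - v 3 * w 1) • (e 1 * e 3) + (v 2 * w 3 - v 3 * w 2) • (e 2 * e 3)
  rw [hv v, hv w]
  simp only [mul_add, add_mul, smul_mul_assoc, mul_smul_comm, hsq, hsw 0 1, hsw 0 2, hsw 0 3,
    hsw 1 2, hsw 1 3, hsw 2 3, smul_zero, smul_neg]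
  module

/-- The alternating form `v, w ↦ vᵢ wⱼ - vⱼ wᵢ`. -/
def minor (i j : Fin 4) : (Fin 4 → ℂ) [⋀^Fin 2]→ₗ[ℂ] ℂ where
  toFun v := v 0 i * v 1 j - v 0 j * v 1 i
  map_update_add' {inst} v k x y := by
    rw [Subsingleton.elim inst (instDecidableEqFin 2)]
    fin_cases k <;> simp <;> ring
  map_update_smul' {inst} v k c x := by
    rw [Subsingleton.elim inst (instDecidableEqFin 2)]
    fin_cases k <;> simp <;> ring
  map_eq_zero_of_eq' v k l h hkl := by
    fin_cases k <;> fin_cases l <;> first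
      | exact absurd rfl hkl
      | (simp at h; simp only [h]; ring)

theorem minor_apply (i j : Fin 4) (v w : Fin 4 → ℂ) :
    minor i j ![v, w] = v i * w j - v j * w i := rfl

theorem mul_eq_mul_of_wedge_eq_zero {v w : Fin 4 → ℂ} (h : exteriorPower.ιMulti ℂ 2 ![v, w] = 0)
    (i j : Fin 4) : v i * w j = v j * w i := by
  have := congrArg (exteriorPower.alternatingMapLinearEquiv (minor i j)) h
  rw [exteriorPower.alternatingMapLinearEquiv_apply_ιMulti, minor_apply, map_zero,
    sub_eq_zero] at this
  exact this

/-- Vectors whose wedge product vanishes are proportional: all their `2 × 2` minors vanish. -/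
theorem exists_smul_of_wedge_eq_zero {v w : Fin 4 → ℂ} (h : exteriorPower.ιMulti ℂ 2 ![v, w] = 0)
    (hv : v ≠ 0) : ∃ t : ℂ, w = t • v := by
  obtain ⟨i, hi⟩ := Function.ne_iff.1 hv
  refine ⟨w i / v i, funext fun j => ?_⟩
  have := mul_eq_mul_of_wedge_eq_zero h i j
  simp only [Pi.zero_apply] at hi
  rw [Pi.smul_apply, smul_eq_mul]
  field_simp
  linear_combination this

theorem wedge_comb (v w : Fin 4 → ℂ) (a b c d : ℂ) :
    exteriorPower.ιMulti ℂ 2 ![a • v + b • w, c • v + d • w] =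
      (a * d - b * c) • exteriorPower.ιMulti ℂ 2 ![v, w] := by
  rw [wedge_expand, wedge_expand v w]
  simp only [Pi.add_apply, Pi.smul_apply, smul_eq_mul, smul_add, smul_smul]
  congr 1 <;> [congr 1 <;> [congr 1 <;> [congr 1 <;> [congr 1; skip]; skip]; skip]; skip] <;>
    · congr 1
      ring

/-- The linear map which identifies `ℂ⁴ × ℂ` with `W`: for an isotropic vector `(a, c)` it gives
the bivector of the kernel of the Clifford multiplication by `(a, c)`. The coefficients are the
entries of `cliff a`. -/
def toBivector : ((Fin 4 → ℂ) × ℂ) →ₗ[ℂ] ⋀[ℂ]^2 (Fin 4 → ℂ) where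
  toFun g := g.2 • (basisWedge 0 1 + basisWedge 2 3) - cliff g.1 0 1 • basisWedge 0 2 +
    cliff g.1 0 0 • basisWedge 0 3 - cliff g.1 1 1 • basisWedge 1 2 + cliff g.1 1 0 • basisWedge 1 3
  map_add' g h := by
    simp only [cliff, Prod.fst_add, Prod.snd_add, Pi.add_apply, Matrix.of_apply,
      Matrix.cons_val_zero, Matrix.cons_val_one, Matrix.cons_val']
    module
  map_smul' t g := by
    simp only [cliff, Prod.smul_fst, Prod.smul_snd, Pi.smul_apply, Matrix.of_apply,
      Matrix.cons_val_zero, Matrix.cons_val_one, Matrix.cons_val', smul_eq_mul, RingHom.id_apply]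
    module

theorem toBivector_apply (g : (Fin 4 → ℂ) × ℂ) : toBivector g =
    g.2 • (basisWedge 0 1 + basisWedge 2 3) - cliff g.1 0 1 • basisWedge 0 2 +
    cliff g.1 0 0 • basisWedge 0 3 - cliff g.1 1 1 • basisWedge 1 2 +
    cliff g.1 1 0 • basisWedge 1 3 := rfl

theorem toBivector_mem (g : (Fin 4 → ℂ) × ℂ) : toBivector g ∈ W := by
  have h : ∀ i j : Fin 4, exteriorPower.alternatingMapLinearEquiv OmForm (basisWedge i j) =
      Om (Pi.single i 1) (Pi.single j 1) := fun i j => by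
    rw [basisWedge, exteriorPower.alternatingMapLinearEquiv_apply_ιMulti]
    rfl
  rw [W, LinearMap.mem_ker, toBivector_apply]
  simp only [map_add, map_sub, map_smul, h]
  simp [Om]

/-- `toBivector` as a map to `W`. -/
def toW : ((Fin 4 → ℂ) × ℂ) →ₗ[ℂ] W := toBivector.codRestrict W toBivector_mem

theorem toW_coe (g : (Fin 4 → ℂ) × ℂ) : (toW g : ⋀[ℂ]^2 (Fin 4 → ℂ)) = toBivector g := rfl

/-- Decomposable bivectors give points of the quadric. -/
theorem mk_mem_Q3 {v w : Fin 4 → ℂ} {a : W} (ha : a ≠ 0)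
    (h : (a : ⋀[ℂ]^2 (Fin 4 → ℂ)) = exteriorPower.ιMulti ℂ 2 ![v, w]) :
    Projectivization.mk ℂ a ha ∈ Q3 := by
  intro b hb
  rw [Projectivization.submodule_mk, Submodule.mem_span_singleton] at hb
  obtain ⟨t, rfl⟩ := hb
  have : ((a : ⋀[ℂ]^2 (Fin 4 → ℂ)) : ExteriorAlgebra ℂ (Fin 4 → ℂ)) *
      (a : ⋀[ℂ]^2 (Fin 4 → ℂ)) = 0 := by
    rw [h, coe_wedge]
    have hsw : ExteriorAlgebra.ι ℂ w * ExteriorAlgebra.ι ℂ v =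
        -(ExteriorAlgebra.ι ℂ v * ExteriorAlgebra.ι ℂ w) :=
      eq_neg_of_add_eq_zero_left (ExteriorAlgebra.ι_add_mul_swap _ _)
    rw [mul_assoc, ← mul_assoc (ExteriorAlgebra.ι ℂ w), hsw, neg_mul, mul_assoc,
      ExteriorAlgebra.ι_sq_zero]
    simp
  simp only [Submodule.coe_smul, smul_mul_smul_comm, this, smul_zero, map_zero]

/-! ### The contact line of an oriented circle -/

/-- The unit normal is a multiple of the vector product of `x` and the real and imaginary parts of
`w`. -/
theorem exists_isNormalTo (x : Sph 3) {w : Fin 4 → ℂ} (hw : w ≠ 0) (hww : w ⬝ᵥ w = 0)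
    (hwx : w ⬝ᵥ cx x = 0) : ∃ T, IsNormalTo x T w := by
  have e1 := dot_self_re w
  have e2 := dot_self_im w
  have e3 := dot_cx_re w x
  have e4 := dot_cx_im w x
  rw [hww] at e1 e2
  rw [hwx] at e3 e4
  simp only [Complex.zero_re, Complex.zero_im] at e1 e2 e3 e4
  have hxx := Sph3.inner_self x
  set y : E4 := (x : E4) with hy
  set A := reV w with hA
  set B := imV w with hB
  set r := inner ℝ A A with hr
  have hBB : inner ℝ B B = r := by linarith
  have hAB : inner ℝ A B = 0 := by linarith
  have hr0 : 0 < r := by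
    refine lt_of_le_of_ne real_inner_self_nonneg fun h0 => hw ?_
    have hA0 : A = 0 := inner_self_eq_zero.1 h0.symm
    have hB0 : B = 0 := inner_self_eq_zero.1 (hBB.trans h0.symm)
    rw [reV_add_imV w, ← hA, ← hB, hA0, hB0]
    simp
  let T : E4 := WithLp.toLp 2 fun i => det4 y (EuclideanSpace.single i 1) A B
  have hT : ∀ v : E4, inner ℝ T v = det4 y v A B := by
    intro v
    rw [inner_E4]
    simp [T, det4_eq]
    ring
  have hTT : inner ℝ T T = r ^ 2 := by
    have gram : inner ℝ T T = inner ℝ y y * (inner ℝ A A * inner ℝ B B - inner ℝ A B ^ 2)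
        - inner ℝ A y * (inner ℝ A y * inner ℝ B B - inner ℝ A B * inner ℝ B y)
        + inner ℝ B y * (inner ℝ A y * inner ℝ A B - inner ℝ A A * inner ℝ B y) := by
      simp only [inner_E4]
      simp [T, det4_eq]
      ring
    rw [gram, hxx, hBB, hAB, ← e3, ← e4, ← hr]
    ring
  have hyT : inner ℝ T y = 0 := by rw [hT, det4_eq]; ring
  have hAT : inner ℝ A T = 0 := by rw [real_inner_comm, hT, det4_eq]; ring
  have hBT : inner ℝ B T = 0 := by rw [real_inner_comm, hT, det4_eq]; ring
  refine ⟨r⁻¹ • T, ?_, ?_, ?_, ?_⟩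
  · rw [norm_smul, ← sq_eq_sq₀ (by positivity) zero_le_one, mul_pow, ← real_inner_self_eq_norm_sq T,
      hTT, norm_inv, Real.norm_of_nonneg hr0.le]
    field_simp
  · rw [inner_smul_right, real_inner_comm, hyT, mul_zero]
  · apply Complex.ext
    · rw [dot_cx_re, ← hA, inner_smul_right, hAT, mul_zero, Complex.zero_re]
    · rw [dot_cx_im, ← hB, inner_smul_right, hBT, mul_zero, Complex.zero_im]
  · rw [← hT, inner_smul_right, hTT]
    positivity

/-- The kernel of the Clifford multiplication by `(a, c)` on `ℂ⁴`. -/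
def OnLine (a : Fin 4 → ℂ) (c : ℂ) (ψ : Fin 4 → ℂ) : Prop :=
  cliff a *ᵥ ![ψ 2, ψ 3] = c • ![ψ 0, ψ 1] ∧ cliffT a *ᵥ ![ψ 0, ψ 1] = c • ![ψ 2, ψ 3]

theorem cliff_sub_smul (a b : Fin 4 → ℂ) (c : ℂ) : cliff (a - c • b) = cliff a - c • cliff b := by
  ext i j
  fin_cases i <;> fin_cases j <;> simp [cliff] <;> ring

theorem cliffT_cliff_self {x : E4} (hx : inner ℝ x x = 1) : cliffT (cx x) * cliff (cx x) = 1 := by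
  have h := cliffT_cliff (cx x) (cx x)
  rw [cx_dot_cx, hx, ← two_smul ℂ, Complex.ofReal_one, mul_one] at h
  exact smul_right_injective _ (two_ne_zero (α := ℂ)) h

/-- The four coordinates in `ℂ⁴` of a pair of vectors of `ℂ²`. -/
def join (p q : Fin 2 → ℂ) : Fin 4 → ℂ := ![p 0, p 1, q 0, q 1]

/-- Left multiplication by a unit quaternion is an isometry. -/
theorem herm_eq_zero_of_mulVec {x : E4} (hx : inner ℝ x x = 1) {ψ : Fin 4 → ℂ}
    (h : ![ψ 0, ψ 1] = cliff (cx x) *ᵥ ![ψ 2, ψ 3]) : herm ψ = 0 := by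
  have h0 := congrFun h 0
  have h1 := congrFun h 1
  rw [inner_E4] at hx
  simp [cliff, cx, Complex.ext_iff] at h0 h1
  simp only [herm, Complex.normSq_apply, h0.1, h0.2, h1.1, h1.2]
  linear_combination ((ψ 2).re ^ 2 + (ψ 2).im ^ 2 + (ψ 3).re ^ 2 + (ψ 3).im ^ 2) * hx

/-- A null vector which is not zero is `(x q, q)` for some `x ∈ S³`. -/
theorem exists_mulVec_of_herm_eq_zero {ψ : Fin 4 → ℂ} (h0 : ψ ≠ 0) (h : herm ψ = 0) :
    ![ψ 2, ψ 3] ≠ 0 ∧ ∃ x : Sph 3, ![ψ 0, ψ 1] = cliff (cx x) *ᵥ ![ψ 2, ψ 3] := by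
  have hn : ∀ q : Fin 2 → ℂ, Quaternion.normSq (quatOf q) =
      Complex.normSq (q 0) + Complex.normSq (q 1) := by
    intro q
    rw [Quaternion.normSq_def', Complex.normSq_apply, Complex.normSq_apply]
    simp
    ring
  set P := quatOf ![ψ 0, ψ 1] with hP
  set L := quatOf ![ψ 2, ψ 3] with hL
  have hnPL : Quaternion.normSq P = Quaternion.normSq L := by
    rw [hP, hL, hn, hn]
    simp only [herm] at h
    simp
    linarith
  have hnL : Quaternion.normSq L ≠ 0 := by
    intro hl
    refine h0 ?_
    have hp := hnPL.trans hl
    rw [hP, hn] at hp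
    rw [hL, hn] at hl
    have a0 := Complex.normSq_nonneg (ψ 0)
    have a1 := Complex.normSq_nonneg (ψ 1)
    have a2 := Complex.normSq_nonneg (ψ 2)
    have a3 := Complex.normSq_nonneg (ψ 3)
    simp at hp hl
    ext i
    refine Complex.normSq_eq_zero.1 ?_
    fin_cases i <;> simp <;> rw [← Complex.normSq_eq_zero] <;> linarith
  have hL0 : L ≠ 0 := fun hl => hnL (by rw [hl, map_zero])
  refine ⟨fun hq => hL0 ?_, ?_⟩
  · rw [hL, hq]
    ext <;> simp
  set X := P * L⁻¹ with hX
  have hXL : X * L = P := by rw [hX, mul_assoc, inv_mul_cancel₀ hL0, mul_one]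
  have hnX : Quaternion.normSq X = 1 := by
    have := congrArg Quaternion.normSq hXL
    rw [map_mul, hnPL] at this
    exact mul_right_cancel₀ hnL (this.trans (one_mul _).symm)
  let x : E4 := !₂[X.re, X.imI, X.imJ, -X.imK]
  have hx : x ∈ Metric.sphere (0 : E4) 1 := by
    rw [mem_sphere_zero_iff_norm, ← sq_eq_sq₀ (norm_nonneg _) zero_le_one,
      ← real_inner_self_eq_norm_sq, inner_E4]
    rw [Quaternion.normSq_def'] at hnX
    simp [x]
    linarith
  have hxX : toQuat x = X := by ext <;> simp [x]
  refine ⟨⟨x, hx⟩, ((toC4_eq_iff x L ψ).1 ?_).2⟩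
  rw [hxX, hXL, hP, hL]
  ext i
  fin_cases i <;> simp [toC4]

/-- The vectors `(x q, q)` with `(a - c x) q = 0` are in the kernel of the Clifford multiplication
by `(a, c)`. -/
theorem onLine_of_tangent {a : Fin 4 → ℂ} {c : ℂ} {x : E4} (hx : inner ℝ x x = 1)
    (hax : a ⬝ᵥ cx x = c) {ψ : Fin 4 → ℂ} (h1 : ![ψ 0, ψ 1] = cliff (cx x) *ᵥ ![ψ 2, ψ 3])
    (h2 : cliff (a - c • cx x) *ᵥ ![ψ 2, ψ 3] = 0) : OnLine a c ψ := by
  rw [cliff_sub_smul, Matrix.sub_mulVec, Matrix.smul_mulVec, ← h1, sub_eq_zero] at h2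
  refine ⟨h2, ?_⟩
  have h := congrArg (· *ᵥ ![ψ 2, ψ 3]) (cliffT_cliff a (cx x))
  simp only [Matrix.add_mulVec, ← Matrix.mulVec_mulVec, ← h1, h2, Matrix.smul_mulVec,
    Matrix.one_mulVec, hax] at h
  rw [Matrix.mulVec_smul, h1, Matrix.mulVec_mulVec _ (cliffT (cx x)), cliffT_cliff_self hx,
    Matrix.one_mulVec, ← h1] at h
  rw [eq_sub_of_add_eq h]
  module

/-- Conversely, if `(x q, q)` is in the kernel of the Clifford multiplication by `(a, c)`, then the
Clifford relation between `a` and `x` gives `a · x = c`. -/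
theorem tangent_of_onLine {a : Fin 4 → ℂ} {c : ℂ} {x : E4} {ψ : Fin 4 → ℂ} (h : OnLine a c ψ)
    (hq : ![ψ 2, ψ 3] ≠ 0) (hx : inner ℝ x x = 1)
    (h1 : ![ψ 0, ψ 1] = cliff (cx x) *ᵥ ![ψ 2, ψ 3]) :
    a ⬝ᵥ cx x = c ∧ cliff (a - c • cx x) *ᵥ ![ψ 2, ψ 3] = 0 := by
  constructor
  · have e := congrArg (· *ᵥ ![ψ 2, ψ 3]) (cliffT_cliff a (cx x))
    simp only [Matrix.add_mulVec, ← Matrix.mulVec_mulVec, ← h1, h.1, h.2, Matrix.smul_mulVec,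
      Matrix.one_mulVec] at e
    rw [Matrix.mulVec_smul, h1, Matrix.mulVec_mulVec _ (cliffT (cx x)), cliffT_cliff_self hx,
      Matrix.one_mulVec, ← two_smul ℂ, smul_smul] at e
    exact (mul_left_cancel₀ two_ne_zero (smul_left_injective ℂ hq e)).symm
  · rw [cliff_sub_smul, Matrix.sub_mulVec, Matrix.smul_mulVec, ← h1, h.1, sub_self]

/-- A nilpotent `2 × 2` matrix is `y ↦ det (n, y) • n` for a vector `n`. -/
theorem exists_eq_of_nilpotent {N : Matrix (Fin 2) (Fin 2) ℂ} (ht : N 0 0 + N 1 1 = 0)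
    (hd : N.det = 0) (hN : N ≠ 0) : ∃ n y : Fin 2 → ℂ, n 0 * y 1 - n 1 * y 0 = 1 ∧
      N = !![-(n 0 * n 1), n 0 ^ 2; -(n 1 ^ 2), n 0 * n 1] := by
  rw [Matrix.det_fin_two] at hd
  -- with `J = !![0, 1; -1, 0]` the matrix `-(N * J)` is symmetric of rank one, so it is `n nᵀ`
  obtain ⟨n, hn⟩ : ∃ n : Fin 2 → ℂ,
      N = !![-(n 0 * n 1), n 0 ^ 2; -(n 1 ^ 2), n 0 * n 1] := by
    obtain ⟨n0, h0⟩ := IsAlgClosed.exists_pow_nat_eq (N 0 1) two_pos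
    obtain ⟨n1, h1⟩ := IsAlgClosed.exists_pow_nat_eq (-N 1 0) two_pos
    have hsq : N 1 1 ^ 2 = (n0 * n1) ^ 2 := by
      rw [mul_pow, h0, h1]
      linear_combination N 1 1 * ht - hd
    rcases sq_eq_sq_iff_eq_or_eq_neg.1 hsq with h | h
    · refine ⟨![n0, n1], ?_⟩
      ext i j
      fin_cases i <;> fin_cases j <;> simp
      · linear_combination ht - h
      · exact h0.symm
      · linear_combination h1
      · exact h
    · refine ⟨![n0, -n1], ?_⟩
      ext i j
      fin_cases i <;> fin_cases j <;> simp
      · linear_combination ht - h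
      · exact h0.symm
      · linear_combination h1
      · exact h
  by_cases h0 : n 0 = 0
  · have h1 : n 1 ≠ 0 := by
      intro h1
      refine hN ?_
      rw [hn, h0, h1]
      ext i j
      fin_cases i <;> fin_cases j <;> simp
    exact ⟨n, ![-(n 1)⁻¹, 0], by simp [h1], hn⟩
  · exact ⟨n, ![0, (n 0)⁻¹], by simp [h0], hn⟩

theorem join_eta (ψ : Fin 4 → ℂ) : join ![ψ 0, ψ 1] ![ψ 2, ψ 3] = ψ := by
  ext i; fin_cases i <;> rfl

/-- The Plücker coordinates of the kernel of the Clifford multiplication by `(a, c)`, where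
`cliff a = X (N + c)` for the nilpotent matrix `N` given by the vector `n`. -/
theorem wedge_join {X : Matrix (Fin 2) (Fin 2) ℂ} (hdet : X.det = 1) {n y : Fin 2 → ℂ}
    (hny : n 0 * y 1 - n 1 * y 0 = 1) (c : ℂ) {a : Fin 4 → ℂ}
    (ha : cliff a = X * (!![-(n 0 * n 1), n 0 ^ 2; -(n 1 ^ 2), n 0 * n 1] + c • 1)) :
    toBivector (a, c) =
      exteriorPower.ιMulti ℂ 2 ![join (X *ᵥ n) n, join (X *ᵥ (c • y + n)) (c • y)] := by
  have a00 := congrFun (congrFun ha 0) 0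
  have a01 := congrFun (congrFun ha 0) 1
  have a10 := congrFun (congrFun ha 1) 0
  have a11 := congrFun (congrFun ha 1) 1
  simp [Matrix.mul_apply, Fin.sum_univ_two] at a00 a01 a10 a11
  rw [Matrix.det_fin_two] at hdet
  rw [wedge_expand, toBivector_apply, a00, a01, a10, a11]
  generalize basisWedge 0 1 = k01
  generalize basisWedge 0 2 = k02
  generalize basisWedge 0 3 = k03
  generalize basisWedge 1 2 = k12
  generalize basisWedge 1 3 = k13
  generalize basisWedge 2 3 = k23
  have e : ∀ p q : Fin 2 → ℂ, join p q 0 = p 0 ∧ join p q 1 = p 1 ∧ join p q 2 = q 0 ∧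
      join p q 3 = q 1 := fun _ _ => ⟨rfl, rfl, rfl, rfl⟩
  have eX : ∀ (p : Fin 2 → ℂ) i, (X *ᵥ p) i = X i 0 * p 0 + X i 1 * p 1 := fun p i => by
    simp [Matrix.mulVec, dotProduct, Fin.sum_univ_two]
  simp only [e, eX, Pi.add_apply, Pi.smul_apply, smul_eq_mul]
  have key : ∀ {t01 t02 t03 t12 t13 t23 s02 s03 s12 s13 : ℂ}, t01 = c → t02 = -s02 → t03 = s03 →
      t12 = -s12 → t13 = s13 → t23 = c →
      c • (k01 + k23) - s02 • k02 + s03 • k03 - s12 • k12 + s13 • k13 =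
        t01 • k01 + t02 • k02 + t03 • k03 + t12 • k12 + t13 • k13 + t23 • k23 := by
    intro t01 t02 t03 t12 t13 t23 s02 s03 s12 s13 h1 h2 h3 h4 h5 h6
    rw [h1, h2, h3, h4, h5, h6]
    module
  refine key ?_ ?_ ?_ ?_ ?_ ?_
  · linear_combination c * hdet + c * (X 0 0 * X 1 1 - X 0 1 * X 1 0) * hny
  · linear_combination -c * X 0 1 * hny
  · linear_combination c * X 0 0 * hny
  · linear_combination -c * X 1 1 * hny
  · linear_combination c * X 1 0 * hny
  · linear_combination c * hny

/-- The equations `OnLine a c` for `(X p', q)` are `N q = N p' = c (p' - q)`. They say that `p' -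
q` is a multiple `r n` of `n` and that `q` is `c r y`, up to a multiple of `n`. -/
theorem mem_span_join_iff {X X' : Matrix (Fin 2) (Fin 2) ℂ} (hXX : X' * X = 1) (hXX' : X * X' = 1)
    {n y : Fin 2 → ℂ} (hny : n 0 * y 1 - n 1 * y 0 = 1) {c : ℂ} {a : Fin 4 → ℂ}
    {N : Matrix (Fin 2) (Fin 2) ℂ} (hNv : ∀ v : Fin 2 → ℂ, N *ᵥ v = (n 0 * v 1 - n 1 * v 0) • n)
    (hA : cliff a = X * (N + c • 1)) (hA' : cliffT a = (c • 1 - N) * X') (ψ : Fin 4 → ℂ) :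
    ψ ∈ Submodule.span ℂ {join (X *ᵥ n) n, join (X *ᵥ (c • y + n)) (c • y)} ↔ OnLine a c ψ := by
  -- the equations of the line, in terms of `p = x p'`
  have hline : ∀ p' q : Fin 2 → ℂ, OnLine a c (join (X *ᵥ p') q) ↔
      N *ᵥ q = c • (p' - q) ∧ N *ᵥ p' = c • (p' - q) := by
    intro p' q
    have e1 : ![join (X *ᵥ p') q 0, join (X *ᵥ p') q 1] = X *ᵥ p' := by ext i; fin_cases i <;> rfl
    have e2 : ![join (X *ᵥ p') q 2, join (X *ᵥ p') q 3] = q := by ext i; fin_cases i <;> rfl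
    have hinj : ∀ u v : Fin 2 → ℂ, X *ᵥ u = X *ᵥ v ↔ u = v := fun u v =>
      ⟨fun h => by
        have := congrArg (X' *ᵥ ·) h
        simpa only [Matrix.mulVec_mulVec, hXX, Matrix.one_mulVec] using this, fun h => by rw [h]⟩
    rw [OnLine, e1, e2, hA, hA', ← Matrix.mulVec_mulVec, ← Matrix.mulVec_mulVec,
      ← Matrix.mulVec_smul, hinj, Matrix.mulVec_mulVec _ X', hXX, Matrix.one_mulVec,
      Matrix.add_mulVec, Matrix.sub_mulVec, Matrix.smul_mulVec, Matrix.smul_mulVec,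
      Matrix.one_mulVec, Matrix.one_mulVec, smul_sub]
    refine and_congr ⟨eq_sub_of_add_eq, fun h => by rw [h, sub_add_cancel]⟩
      ⟨fun h => by rw [← h]; abel, fun h => by rw [h]; abel⟩
  have hNn0 : N *ᵥ n = 0 := by rw [hNv, mul_comm, sub_self, zero_smul]
  have hNy : N *ᵥ y = n := by rw [hNv, hny, one_smul]
  have hψ : ψ = join (X *ᵥ (X' *ᵥ ![ψ 0, ψ 1])) ![ψ 2, ψ 3] := by
    rw [Matrix.mulVec_mulVec, hXX', Matrix.one_mulVec, join_eta]
  have hjoin : ∀ (s r : ℂ), s • join (X *ᵥ n) n + r • join (X *ᵥ (c • y + n)) (c • y) =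
      join (X *ᵥ (s • n + r • (c • y + n))) (s • n + r • c • y) := by
    intro s r
    rw [Matrix.mulVec_add X (s • n), Matrix.mulVec_smul, Matrix.mulVec_smul _ r]
    ext i
    fin_cases i <;> rfl
  rw [Submodule.mem_span_pair]
  constructor
  · rintro ⟨s, r, rfl⟩
    rw [hjoin, hline]
    simp only [Matrix.mulVec_add, Matrix.mulVec_smul, hNn0, hNy]
    constructor <;> module
  · intro h
    rw [hψ, hline] at h
    set p' := X' *ᵥ ![ψ 0, ψ 1]
    set q := ![ψ 2, ψ 3]
    obtain ⟨h1, h2⟩ := h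
    have hn0 : n ≠ 0 := by
      rintro rfl
      simp at hny
    have h3 := h2.trans h1.symm
    rw [← sub_eq_zero, ← Matrix.mulVec_sub, hNv, smul_eq_zero, or_iff_left hn0] at h3
    rw [hNv] at h1
    simp only [Pi.sub_apply] at h3
    set r := (p' 0 - q 0) * y 1 - (p' 1 - q 1) * y 0 with hr
    have hp : p' - q = r • n := by
      ext i
      fin_cases i <;> simp [hr]
      · linear_combination (-(p' 0 - q 0)) * hny + y 0 * h3
      · linear_combination (-(p' 1 - q 1)) * hny + y 1 * h3
    have hc : n 0 * q 1 - n 1 * q 0 = c * r := by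
      rw [hp, smul_smul] at h1
      exact smul_left_injective ℂ hn0 h1
    have hq : q = (q 0 * y 1 - q 1 * y 0) • n + r • c • y := by
      ext i
      fin_cases i <;> simp
      · linear_combination (-q 0) * hny + y 0 * hc
      · linear_combination (-q 1) * hny + y 1 * hc
    refine ⟨q 0 * y 1 - q 1 * y 0, r, ?_⟩
    rw [hjoin, smul_add, ← add_assoc, ← hq, ← hp, hψ]
    congr 2
    abel

theorem det_cliff (a : Fin 4 → ℂ) : (cliff a).det = a ⬝ᵥ a := by
  rw [Matrix.det_fin_two, dot4]
  simp [cliff]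
  linear_combination -(a 1 ^ 2 + a 3 ^ 2) * Complex.I_sq

theorem trace_cliffT_mul_cliff (a b : Fin 4 → ℂ) :
    (cliffT a * cliff b) 0 0 + (cliffT a * cliff b) 1 1 = 2 * (b ⬝ᵥ a) := by
  rw [dot4]
  simp [cliff, cliffT, Matrix.mul_apply, Fin.sum_univ_succ]
  linear_combination -2 * (b 1 * a 1 + b 3 * a 3) * Complex.I_sq

theorem eq_zero_of_cliff_eq_zero {a : Fin 4 → ℂ} (h : cliff a = 0) : a = 0 := by
  have h00 := congrFun (congrFun h 0) 0
  have h01 := congrFun (congrFun h 0) 1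
  have h10 := congrFun (congrFun h 1) 0
  have h11 := congrFun (congrFun h 1) 1
  simp [cliff] at h00 h01 h10 h11
  ext i
  fin_cases i <;> simp
  · linear_combination h00 / 2 + h11 / 2
  · linear_combination (h11 - h00) / 2 * Complex.I + a 1 * Complex.I_sq
  · linear_combination (h10 - h01) / 2
  · linear_combination -(h01 + h10) / 2 * Complex.I + a 3 * Complex.I_sq

theorem nilpotent_mulVec (n v : Fin 2 → ℂ) :
    !![-(n 0 * n 1), n 0 ^ 2; -(n 1 ^ 2), n 0 * n 1] *ᵥ v = (n 0 * v 1 - n 1 * v 0) • n := by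
  ext i
  fin_cases i <;> simp [Matrix.mulVec, dotProduct, Fin.sum_univ_succ] <;> ring

/-- The kernel of the Clifford multiplication by an isotropic vector `(a, c)` is a line of `ℂP³`,
and `toBivector (a, c)` is its Plücker vector. -/
theorem exists_basis_onLine {a : Fin 4 → ℂ} {c : ℂ} {x : Sph 3}
    (haa : a ⬝ᵥ a = c ^ 2) (hax : a ⬝ᵥ cx x = c) (hne : a - c • cx x ≠ 0) :
    ∃ v w : Fin 4 → ℂ, toBivector (a, c) = exteriorPower.ιMulti ℂ 2 ![v, w] ∧
      ∀ ψ, ψ ∈ Submodule.span ℂ {v, w} ↔ OnLine a c ψ := by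
  have hx := Sph3.inner_self x
  obtain ⟨X, hX⟩ : ∃ X, X = cliff (cx x) := ⟨_, rfl⟩
  obtain ⟨X', hX'⟩ : ∃ X', X' = cliffT (cx x) := ⟨_, rfl⟩
  have hXX : X' * X = 1 := by rw [hX, hX', cliffT_cliff_self hx]
  have hXX' : X * X' = 1 := mul_eq_one_comm.1 hXX
  obtain ⟨w, hw⟩ : ∃ w, w = a - c • cx x := ⟨_, rfl⟩
  obtain ⟨N, hN⟩ : ∃ N, N = X' * cliff w := ⟨_, rfl⟩
  have hXN : X * N = cliff w := by rw [hN, ← mul_assoc, hXX', one_mul]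
  have hwx : w ⬝ᵥ cx x = 0 := by rw [hw, sub_dot_self hax]
  have hww : w ⬝ᵥ w = 0 := by rw [hw, isotropic_sub haa hax]
  have hdet : X.det = 1 := by rw [hX, det_cliff, cx_dot_cx, hx, Complex.ofReal_one]
  have hNd : N.det = 0 := by rw [hN, Matrix.det_mul, det_cliff, hww, mul_zero]
  have hNt : N 0 0 + N 1 1 = 0 := by rw [hN, hX', trace_cliffT_mul_cliff, hwx, mul_zero]
  have hN0 : N ≠ 0 := fun h0 =>
    hne (hw ▸ eq_zero_of_cliff_eq_zero (by rw [← hXN, h0, mul_zero]))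
  obtain ⟨n, y, hny, hNn⟩ := exists_eq_of_nilpotent hNt hNd hN0
  have hA : cliff a = X * (N + c • 1) := by
    rw [mul_add, hXN, hw, cliff_sub_smul, mul_smul_comm, mul_one, ← hX]
    abel
  have hA' : cliffT a = (c • 1 - N) * X' := by
    have h := cliffT_cliff a (cx x)
    rw [hax, ← hX, ← hX', hA, ← mul_assoc, hXX, one_mul] at h
    calc cliffT a = cliffT a * X * X' := by rw [mul_assoc, hXX', mul_one]
      _ = _ := by
        congr 1
        rw [eq_sub_of_add_eq h]
        module
  have hNv : ∀ v : Fin 2 → ℂ, N *ᵥ v = (n 0 * v 1 - n 1 * v 0) • n := by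
    rw [hNn]
    exact nilpotent_mulVec n
  exact ⟨_, _, wedge_join hdet hny c (by rw [← hNn]; exact hA),
    mem_span_join_iff hXX hXX' hny hNv hA hA'⟩

/-- At a point `y` of the fibre, `a - c y` is a nonzero isotropic vector to which the positive unit
tangent of the fibre is normal. -/
theorem Rep.isPositiveUnitTangent_iff {π : Sph 3 → Sph 2} (hπ : IsConformalSubmersion π) {ε : ℝ}
    (hε : ε ^ 2 = 1) {p : Sph 2} (hm : 1 + ε * (p : E3) 2 ≠ 0) {a : Fin 4 → ℂ} {c : ℂ}
    (h : Rep ε π p a c) {y : Sph 3} (hy : π y = p) :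
    a - c • cx y ≠ 0 ∧
      ∀ T, IsPositiveUnitTangent π y T ↔ IsNormalTo y T (a - c • cx y) := by
  obtain ⟨f, hf, e⟩ := h.pos y hy
  obtain ⟨hg0, -, -, hT⟩ := grad_chart hπ y hε (by rwa [hy])
  rw [e]
  exact ⟨smul_ne_zero hf hg0, fun T => by rw [isNormalTo_smul hf, hT]⟩

/-- The points of the line `OnLine a c` which lie on the quadric `(z, z) = 0` are the positive
tangent directions of the fibre. -/
theorem Rep.onLine_iff {π : Sph 3 → Sph 2} (hπ : IsConformalCircleFibration π) {ε : ℝ}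
    (hε : ε ^ 2 = 1) {p : Sph 2} (hm : 1 + ε * (p : E3) 2 ≠ 0) {a : Fin 4 → ℂ} {c : ℂ}
    (h : Rep ε π p a c) {ψ : Fin 4 → ℂ} (hψ : ψ ≠ 0) :
    (OnLine a c ψ ∧ herm ψ = 0) ↔
      ∃ x T, π x = p ∧ IsPositiveUnitTangent π x T ∧ ψ ∈ tangentLine x T := by
  have haa := (h.isotropic hπ hε hm).1
  constructor
  · rintro ⟨h1, h2⟩
    obtain ⟨hq, x, hx⟩ := exists_mulVec_of_herm_eq_zero hψ h2
    obtain ⟨hax, hw⟩ := tangent_of_onLine h1 hq (Sph3.inner_self x) hx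
    have hxp := (h.fibre x).2 hax
    obtain ⟨hw0, hT⟩ := h.isPositiveUnitTangent_iff hπ.1 hε hm hxp
    obtain ⟨T, hxT⟩ := exists_isNormalTo x hw0 (isotropic_sub haa hax) (sub_dot_self hax)
    exact ⟨x, T, hxp, (hT T).2 hxT,
      (mem_tangentLine_iff (isotropic_sub haa hax) (sub_dot_self hax) hxT ψ).2 ⟨hx, hw⟩⟩
  · rintro ⟨x, T, hxp, hT, hmem⟩
    have hax := (h.fibre x).1 hxp
    have hxT := ((h.isPositiveUnitTangent_iff hπ.1 hε hm hxp).2 T).1 hT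
    obtain ⟨h1, h2⟩ :=
      (mem_tangentLine_iff (isotropic_sub haa hax) (sub_dot_self hax) hxT ψ).1 hmem
    exact ⟨onLine_of_tangent (Sph3.inner_self x) hax h1 h2,
      herm_eq_zero_of_mulVec (Sph3.inner_self x) h1⟩

/-- The tangent line of a fibre at each of its points contains a vector which is not zero. -/
theorem Rep.exists_tangent {π : Sph 3 → Sph 2} (hπ : IsConformalCircleFibration π) {ε : ℝ}
    (hε : ε ^ 2 = 1) {p : Sph 2} (hm : 1 + ε * (p : E3) 2 ≠ 0) {a : Fin 4 → ℂ} {c : ℂ}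
    (h : Rep ε π p a c) {x : Sph 3} (hx : π x = p) : ∃ ψ : Fin 4 → ℂ, ψ ≠ 0 ∧
      ![ψ 0, ψ 1] = cliff (cx x) *ᵥ ![ψ 2, ψ 3] ∧
      ∃ T, IsPositiveUnitTangent π x T ∧ ψ ∈ tangentLine x T := by
  have haa := (h.isotropic hπ hε hm).1
  have hax := (h.fibre x).1 hx
  obtain ⟨hw0, hT⟩ := h.isPositiveUnitTangent_iff hπ.1 hε hm hx
  obtain ⟨T, hxT⟩ := exists_isNormalTo x hw0 (isotropic_sub haa hax) (sub_dot_self hax)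
  obtain ⟨q, hq0, hq⟩ := Matrix.exists_mulVec_eq_zero_iff.2
    ((det_cliff (a - c • cx x)).trans (isotropic_sub haa hax))
  have e1 : ∀ p : Fin 2 → ℂ, ![join p q 0, join p q 1] = p := fun p => by
    ext i; fin_cases i <;> rfl
  have e2 : ∀ p : Fin 2 → ℂ, ![join p q 2, join p q 3] = q := fun p => by
    ext i; fin_cases i <;> rfl
  refine ⟨join (cliff (cx x) *ᵥ q) q, fun h0 => hq0 ?_, by rw [e1, e2], T, (hT T).2 hxT,
    (mem_tangentLine_iff (isotropic_sub haa hax) (sub_dot_self hax) hxT _).2 ?_⟩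
  · rw [← e2 (cliff (cx x) *ᵥ q), h0]
    ext i; fin_cases i <;> rfl
  · rw [e1, e2]
    exact ⟨rfl, hq⟩

/-- Tangent vectors at different points of `S³` give different points of `ℂP³`. -/
theorem eq_of_smul_tangent {x x' : Sph 3} {ψ : Fin 4 → ℂ} (hψ : ψ ≠ 0) {t : ℂ} (ht : t ≠ 0)
    (h : ![ψ 0, ψ 1] = cliff (cx x) *ᵥ ![ψ 2, ψ 3])
    (h' : ![(t • ψ) 0, (t • ψ) 1] = cliff (cx x') *ᵥ ![(t • ψ) 2, (t • ψ) 3]) : x = x' := by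
  have hs : ∀ i j : Fin 4, ![(t • ψ) i, (t • ψ) j] = t • ![ψ i, ψ j] := fun i j => by
    ext k; fin_cases k <;> rfl
  rw [hs, hs, Matrix.mulVec_smul] at h'
  have h'' := smul_right_injective _ ht h'
  have hq : ![ψ 2, ψ 3] ≠ 0 := (exists_mulVec_of_herm_eq_zero hψ
    (herm_eq_zero_of_mulVec (Sph3.inner_self x) h)).1
  have hz : cliff (cx ((x : E4) - x')) *ᵥ ![ψ 2, ψ 3] = 0 := by
    have := cliff_sub_smul (cx x) (cx x') 1
    rw [one_smul, one_smul] at this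
    rw [cx_sub, this, Matrix.sub_mulVec, ← h, ← h'', sub_self]
  have hd := Matrix.exists_mulVec_eq_zero_iff.1 ⟨_, hq, hz⟩
  rw [det_cliff, cx_dot_cx, Complex.ofReal_eq_zero, inner_self_eq_zero, sub_eq_zero] at hd
  exact Subtype.ext hd

/-- The point of `𝒬³` given by `toBivector (a, c)` is the only one which represents the fibre. -/
theorem Rep.representsFibre_iff {π : Sph 3 → Sph 2} (hπ : IsConformalCircleFibration π) {ε : ℝ}
    (hε : ε ^ 2 = 1) {p : Sph 2} (hm : 1 + ε * (p : E3) 2 ≠ 0) {g : (Fin 4 → ℂ) × ℂ}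
    (h : Rep ε π p g.1 g.2) : ∃ (hg : toW g ≠ 0) (hQ : Projectivization.mk ℂ (toW g) hg ∈ Q3),
      ∀ η : Q3, RepresentsFibre π p η ↔ η = ⟨Projectivization.mk ℂ (toW g) hg, hQ⟩ := by
  obtain ⟨x, x', hx, hx', hne⟩ := exists_ne_fibre hπ p
  obtain ⟨ψ, hψ, hψx, T, hT, hψT⟩ := h.exists_tangent hπ hε hm hx
  obtain ⟨ψ', hψ', hψx', T', hT', hψT'⟩ := h.exists_tangent hπ hε hm hx'
  have hwedge : exteriorPower.ιMulti ℂ 2 ![ψ, ψ'] ≠ 0 := by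
    intro h0
    obtain ⟨t, rfl⟩ := exists_smul_of_wedge_eq_zero h0 hψ
    exact hne (eq_of_smul_tangent hψ (left_ne_zero_of_smul hψ') hψx hψx')
  -- a line which contains both tangent directions has the Plücker vector `ψ ∧ ψ'`, up to a factor
  have hspan : ∀ v w : Fin 4 → ℂ, ψ ∈ Submodule.span ℂ {v, w} → ψ' ∈ Submodule.span ℂ {v, w} →
      ∃ t : ℂ, t • exteriorPower.ιMulti ℂ 2 ![v, w] = exteriorPower.ιMulti ℂ 2 ![ψ, ψ'] := by
    intro v w h1 h2
    obtain ⟨a, b, rfl⟩ := Submodule.mem_span_pair.1 h1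
    obtain ⟨c, d, rfl⟩ := Submodule.mem_span_pair.1 h2
    exact ⟨_, (wedge_comb v w a b c d).symm⟩
  have hax := (h.fibre x).1 hx
  obtain ⟨v, w, hvw, hline⟩ := exists_basis_onLine (h.isotropic hπ hε hm).1 hax
    (h.isPositiveUnitTangent_iff hπ.1 hε hm hx).1
  obtain ⟨t, ht⟩ := hspan v w
    ((hline ψ).2 ((h.onLine_iff hπ hε hm hψ).2 ⟨x, T, hx, hT, hψT⟩).1)
    ((hline ψ').2 ((h.onLine_iff hπ hε hm hψ').2 ⟨x', T', hx', hT', hψT'⟩).1)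
  have hg : toW g ≠ 0 := by
    intro h0
    have : toBivector g = 0 := congrArg Subtype.val h0
    rw [← hvw, this, smul_zero] at ht
    exact hwedge ht.symm
  refine ⟨hg, mk_mem_Q3 hg hvw, fun η => ⟨?_, ?_⟩⟩
  · rintro ⟨v', w', b, hb, hbv, hη, hψs⟩
    obtain ⟨s, hs⟩ := hspan v' w' ((hψs ψ hψ).2 ⟨x, T, hx, hT, hψT⟩).1
      ((hψs ψ' hψ').2 ⟨x', T', hx', hT', hψT'⟩).1
    refine Subtype.ext (hη.trans ((Projectivization.mk_eq_mk_iff' ℂ _ _ _ _).2 ⟨s⁻¹ * t, ?_⟩))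
    have hs0 : s ≠ 0 := by
      rintro rfl
      rw [zero_smul] at hs
      exact hwedge hs.symm
    refine Subtype.ext ?_
    rw [Submodule.coe_smul, toW_coe, mul_smul, hbv]
    refine (inv_smul_eq_iff₀ hs0).2 ?_
    rw [hs, ← ht, hvw]
  · rintro rfl
    refine ⟨v, w, toW g, hg, hvw, rfl, fun χ hχ => ?_⟩
    rw [hline, h.onLine_iff hπ hε hm hχ]

/-! ### The curve of fibres -/

theorem toS2_mk_coe {u : Fin 2 → ℂ} (hu : u ≠ 0) :
    (toS2 (Projectivization.mk ℂ u hu) : E3) = homToS2 u := rfl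

/-- The fibres of `π` are represented by a linear family. -/
theorem exists_linear {π : Sph 3 → Sph 2} (hπ : IsConformalCircleFibration π) :
    ∃ V₀ V₁ : (Fin 4 → ℂ) × ℂ, ∀ (u : Fin 2 → ℂ) (hu : u ≠ 0), ∃ ε : ℝ, ε ^ 2 = 1 ∧
      1 + ε * (toS2 (Projectivization.mk ℂ u hu) : E3) 2 ≠ 0 ∧
      Rep ε π (toS2 (Projectivization.mk ℂ u hu)) (u 1 • V₀ + u 0 • V₁).1
        (u 1 • V₀ + u 0 • V₁).2 := by
  have h1 : (1 : ℝ) ^ 2 = 1 := one_pow 2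
  obtain ⟨V₀, V₁, hV, hV'⟩ := exists_affine hπ h1
  refine ⟨V₀, V₁, fun u hu => ?_⟩
  by_cases hw : u 1 = 0
  · have hz : u 0 ≠ 0 := fun hz => hu (by ext i; fin_cases i <;> simp [hz, hw])
    have e : toS2 (Projectivization.mk ℂ u hu) = invStereo (neg_one_sq' h1) 0 := by
      apply Subtype.ext
      rw [toS2_mk_coe]
      ext i
      fin_cases i <;> simp [homToS2, invStereo, hw, hz]
    rw [e]
    refine ⟨-1, by norm_num, one_add_invStereo_ne _ 0, ?_⟩
    have := hV'.smul hz
    simpa [hw] using this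
  · have e : toS2 (Projectivization.mk ℂ u hu) = invStereo h1 (u 0 / u 1) := by
      have hn : Complex.normSq (u 1) ≠ 0 := fun h0 => hw (Complex.normSq_eq_zero.1 h0)
      apply Subtype.ext
      have hs : u = u 1 • ![u 0 / u 1, 1] := by
        ext i; fin_cases i <;> simp [mul_div_cancel₀ _ hw]
      rw [toS2_mk_coe, hs, homToS2_smul hw, ← hs]
      ext i
      fin_cases i <;> simp [homToS2, invStereo] <;> ring
    rw [e]
    refine ⟨1, h1, one_add_invStereo_ne _ _, ?_⟩
    have := (hV (u 0 / u 1)).smul hw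
    have e2 : u 1 • V₀ + u 0 • V₁ = u 1 • (V₀ + (u 0 / u 1) • V₁) := by
      rw [smul_add, smul_smul, mul_div_cancel₀ _ hw]
    rw [e2]
    exact this

end CircleFibration

end

theorem mainTheorem2 (π : CircleFibration.Sph 3 → CircleFibration.Sph 2)
    (hπ : CircleFibration.IsConformalCircleFibration π) :
    ∃ γ : CircleFibration.CP1 → CircleFibration.Q3,
      (∀ (p : CircleFibration.CP1) (η : CircleFibration.Q3),
        CircleFibration.RepresentsFibre π (CircleFibration.toS2 p) η ↔ η = γ p) ∧
      CircleFibration.IsHolomorphicCurve (fun p => (γ p : ℙ ℂ CircleFibration.W)) ∧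
      CircleFibration.HasDegree (fun p => (γ p : ℙ ℂ CircleFibration.W)) 1 := by
  obtain ⟨V₀, V₁, hV⟩ := CircleFibration.exists_linear hπ
  have hrep : ∀ (u : Fin 2 → ℂ) (hu : u ≠ 0),
      ∃ (hg : CircleFibration.toW (u 1 • V₀ + u 0 • V₁) ≠ 0)
        (hQ : Projectivization.mk ℂ (CircleFibration.toW (u 1 • V₀ + u 0 • V₁)) hg ∈
          CircleFibration.Q3),
        ∀ η : CircleFibration.Q3, CircleFibration.RepresentsFibre π
          (CircleFibration.toS2 (Projectivization.mk ℂ u hu)) η ↔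
            η = ⟨Projectivization.mk ℂ (CircleFibration.toW (u 1 • V₀ + u 0 • V₁)) hg, hQ⟩ := by
    intro u hu
    obtain ⟨ε, hε, hm, h⟩ := hV u hu
    exact h.representsFibre_iff hπ hε hm
  have hex : ∀ p : CircleFibration.CP1, ∃ γp : CircleFibration.Q3, ∀ η : CircleFibration.Q3,
      CircleFibration.RepresentsFibre π (CircleFibration.toS2 p) η ↔ η = γp := by
    intro p
    induction p using Projectivization.ind with
    | h u hu =>
      obtain ⟨hg, hQ, h⟩ := hrep u hu
      exact ⟨_, h⟩
  choose γ hγ using hex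
  have hlift : ∀ (u : Fin 2 → ℂ) (hu : u ≠ 0),
      ∃ hg : u 1 • CircleFibration.toW V₀ + u 0 • CircleFibration.toW V₁ ≠ 0,
        (γ (Projectivization.mk ℂ u hu) : ℙ ℂ CircleFibration.W) = Projectivization.mk ℂ _ hg := by
    intro u hu
    obtain ⟨hg, hQ, h⟩ := hrep u hu
    simp only [map_add, map_smul] at hg hQ h
    exact ⟨hg, congrArg Subtype.val ((h _).1 ((hγ _ _).2 rfl))⟩
  refine ⟨γ, hγ, fun u₀ _ => ⟨Set.univ, isOpen_univ, Set.mem_univ _,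
    fun u => u 1 • CircleFibration.toW V₀ + u 0 • CircleFibration.toW V₁, fun l => ?_,
    fun u _ hu => hlift u hu⟩,
    fun k => if k = 0 then CircleFibration.toW V₀ else CircleFibration.toW V₁, fun u hu => ?_⟩
  · simp only [map_add, map_smul, smul_eq_mul]
    fun_prop
  · have e : ∑ k ∈ Finset.range (1 + 1), (u 0 ^ k * u 1 ^ (1 - k)) •
        (if k = 0 then CircleFibration.toW V₀ else CircleFibration.toW V₁) =
        u 1 • CircleFibration.toW V₀ + u 0 • CircleFibration.toW V₁ := by
      simp [Finset.sum_range_succ]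
    obtain ⟨hg, h⟩ := hlift u hu
    refine ⟨by rw [e]; exact hg, ?_⟩
    refine h.trans ?_
    congr 1
    exact e.symm
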